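/- Let $l$ be a prime, let $K$ be a finite extension of $\mathbb{Q}_l$ with ring of integers $\mathcal{O}$, maximal ideal $\lambda\subset\mathcal{O}$ and residue field $k$. Let $n\ge 0$ and $q$ be integers, and let $\alpha_1,\dots,\alpha_n$ be roots of unity in $\mathcal{O}^\times$. Let $\mathcal{M}(\prod_{i=1}^n(X-\alpha_i),q)$ be the affine $\mathcal{O}$-scheme representing the functor that sends an $\mathcal{O}$-algebra $R$ to the set of pairs $(\Phi,\Sigma)$ of $n\times n$ matrices over $R$ such that $\Phi$ is invertible, the characteristic polynomial of $\Sigma$ is $\prod_{i=1}^n(X-\alpha_i)$, and $\Phi\Sigma\Phi^{-1}=\Sigma^q$ (note that $\Sigma$ is automatically invertible, so $\Sigma^q$ makes sense for every integer $q$). (i) Suppose that $\alpha_j=1$ for each $j$ and that $l\nmid q$. Let $\mathcal{M}_i$ denote the irreducible components of $\mathcal{M}((X-1)^n,q)$ with their reduced subscheme structure. Then each $\mathcal{M}_i\otimes_{\mathcal{O}}K$ is non-empty of dimension $n^2$. Moreover, the distinct irreducible components of $\mathcal{M}((X-1)^n,q)\otimes_{\mathcal{O}}k$ are the $\mathcal{M}_i\otimes_{\mathcal{O}}k$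 (that is, passing from $\mathcal{M}_i$ to the underlying closed subset of $\mathcal{M}_i\otimes_{\mathcal{O}}k$ is a bijection between the two sets of irreducible components), and each scheme $\mathcal{M}_i\otimes_{\mathcal{O}}k$ is non-empty and generically reduced (its local rings at the generic points of its irreducible components are reduced). (ii) Suppose that $q\equiv 1 \bmod l$, and that the $\alpha_j$ are distinct roots of unity in $1+\lambda\subset\mathcal{O}^\times$. If $q\neq 1$, suppose moreover that each $\alpha_j$ is a $(q-1)$-st root of unity. Then the reduced scheme $\mathcal{M}(\prod_{i=1}^n(X-\alpha_i),q)^{\mathrm{red}}$ is flat over $\mathcal{O}$. -/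

import Mathlib

open TensorProduct

noncomputable section

/-! ### The ring of integers of a finite extension of `ℚ_[l]` -/

section RingOfIntegers

variable (l : ℕ) [Fact l.Prime] (K : Type*) [Field K] [Algebra ℚ_[l] K] [Algebra ℤ_[l] K]
  [IsScalarTower ℤ_[l] ℚ_[l] K] [FiniteDimensional ℚ_[l] K]

/-- An element of a finite extension of `ℚ_[l]` is integral over `ℤ_[l]` iff its norm is at most
one. -/
theorem isIntegral_padicInt_iff_spectralNorm_le_one (x : K) :
    IsIntegral ℤ_[l] x ↔ spectralNorm ℚ_[l] K x ≤ 1 := by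
  have hx : IsIntegral ℚ_[l] x := Algebra.IsIntegral.isIntegral x
  rw [spectralNorm, spectralValue_le_one_iff (minpoly.monic hx)]
  constructor
  · intro h i
    have hm : minpoly ℚ_[l] x = (minpoly ℤ_[l] x).map (algebraMap ℤ_[l] ℚ_[l]) :=
      minpoly.isIntegrallyClosed_eq_field_fractions' ℚ_[l] h
    rw [hm, Polynomial.coeff_map]
    exact PadicInt.norm_le_one _
  · intro h
    have hl : minpoly ℚ_[l] x ∈ Polynomial.lifts (algebraMap ℤ_[l] ℚ_[l]) := by
      rw [Polynomial.lifts_iff_coeff_lifts]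
      intro i
      exact ⟨⟨_, h i⟩, rfl⟩
    obtain ⟨P, hP, -, hmon⟩ := Polynomial.lifts_and_degree_eq_and_monic hl (minpoly.monic hx)
    refine ⟨P, hmon, ?_⟩
    rw [← Polynomial.aeval_def, ← Polynomial.aeval_map_algebraMap ℚ_[l], hP, minpoly.aeval]

/-- The ring of integers of a finite extension of `ℚ_[l]` is a local ring. -/
instance isLocalRing_integralClosure_padicInt : IsLocalRing (integralClosure ℤ_[l] K) := by
  have key : ∀ x : integralClosure ℤ_[l] K, ¬ IsUnit x → spectralNorm ℚ_[l] K (x : K) < 1 := by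
    intro x hx
    refine lt_of_le_of_ne ((isIntegral_padicInt_iff_spectralNorm_le_one l K x).1 x.2) ?_
    intro h1
    apply hx
    have hx0 : (x : K) ≠ 0 := by
      intro h0
      rw [h0, spectralNorm_zero] at h1
      exact zero_ne_one h1
    have hmul : spectralNorm ℚ_[l] K (x : K) * spectralNorm ℚ_[l] K (x : K)⁻¹ = 1 := by
      have h2 := (spectralMulAlgNorm ℚ_[l] K).map_mul' (x : K) (x : K)⁻¹
      rw [mul_inv_cancel₀ hx0] at h2
      have h3 : spectralNorm ℚ_[l] K (1 : K) =
        spectralNorm ℚ_[l] K (x : K) * spectralNorm ℚ_[l] K (x : K)⁻¹ := h2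
      rw [← h3, spectralNorm_one]
    rw [h1, one_mul] at hmul
    have hinv : IsIntegral ℤ_[l] (x : K)⁻¹ :=
      (isIntegral_padicInt_iff_spectralNorm_le_one l K _).2 hmul.le
    refine IsUnit.of_mul_eq_one (⟨(x : K)⁻¹, hinv⟩ : integralClosure ℤ_[l] K) ?_
    exact Subtype.ext (mul_inv_cancel₀ hx0)
  refine IsLocalRing.of_nonunits_add ?_
  intro a b ha hb hab
  have hlt : spectralNorm ℚ_[l] K ((a : K) + (b : K)) < 1 :=
    lt_of_le_of_lt (isNonarchimedean_spectralNorm (a : K) (b : K))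
      (max_lt (key a ha) (key b hb))
  obtain ⟨c, hc⟩ := isUnit_iff_exists_inv.1 hab
  have hc' : ((a : K) + (b : K)) * (c : K) = 1 := congrArg Subtype.val hc
  have hcle := (isIntegral_padicInt_iff_spectralNorm_le_one l K (c : K)).1 c.2
  have h2 : spectralNorm ℚ_[l] K (((a : K) + (b : K)) * (c : K)) =
      spectralNorm ℚ_[l] K ((a : K) + (b : K)) * spectralNorm ℚ_[l] K (c : K) :=
    (spectralMulAlgNorm ℚ_[l] K).map_mul' _ _
  rw [hc', spectralNorm_one] at h2
  have h3 : spectralNorm ℚ_[l] K ((a : K) + (b : K)) * spectralNorm ℚ_[l] K (c : K) < 1 :=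
    mul_lt_one_of_nonneg_of_lt_one_left (spectralNorm_nonneg _) hlt hcle
  exact absurd h2.symm h3.ne

end RingOfIntegers

/-! ### The moduli scheme of pairs `(Φ, Σ)` -/

section Moduli

/-- The `R`-valued points of the moduli problem, for an algebra `R` over the base ring `O`: pairs
of matrices `(P, S)` (written `(Φ, Σ)` on paper) with `P` invertible, `S` of characteristic
polynomial `∏ (X - α j)` and `P * S * P⁻¹ = S ^ q`.  As `det S = ∏ α j` is a unit, the integral
power `S ^ q` is the genuine one for negative `q` too. -/
structure IsModuliPair {O : Type*} [CommRing O] {n : ℕ} (α : Fin n → Oˣ) (q : ℤ)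
    {R : Type*} [CommRing R] [Algebra O R] (P S : Matrix (Fin n) (Fin n) R) : Prop where
  isUnit_det : IsUnit P.det
  charpoly_eq : S.charpoly =
    ∏ j, (Polynomial.X - Polynomial.C (algebraMap O R (α j : O)))
  conj_eq : P * S * P⁻¹ = S ^ q

variable (O : Type*) [CommRing O] (n : ℕ)

/-- The polynomial ring over `O` in the `2 n ^ 2` entries of two `n × n` matrices. -/
abbrev PairPoly : Type _ := MvPolynomial ((Fin n × Fin n) ⊕ (Fin n × Fin n)) O

/-- The generic first matrix. -/
def polyΦ : Matrix (Fin n) (Fin n) (PairPoly O n) :=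
  Matrix.of fun i j => MvPolynomial.X (Sum.inl (i, j))

/-- The generic second matrix. -/
def polyS : Matrix (Fin n) (Fin n) (PairPoly O n) :=
  Matrix.of fun i j => MvPolynomial.X (Sum.inr (i, j))

/-- The coordinate ring of `GL_n × GL_n` over `O`. -/
abbrev GLPairRing : Type _ := Localization.Away ((polyΦ O n).det * (polyS O n).det)

/-- The first of the two universal invertible matrices. -/
def glΦ : Matrix (Fin n) (Fin n) (GLPairRing O n) :=
  (polyΦ O n).map (algebraMap (PairPoly O n) (GLPairRing O n))

/-- The second of the two universal invertible matrices. -/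
def glS : Matrix (Fin n) (Fin n) (GLPairRing O n) :=
  (polyS O n).map (algebraMap (PairPoly O n) (GLPairRing O n))

variable {O n}

/-- The ideal generated by the coefficients of `char_Σ - ∏ (X - α j)` and by the entries of
`Φ Σ Φ⁻¹ - Σ ^ q`. -/
def moduliIdeal (α : Fin n → Oˣ) (q : ℤ) : Ideal (GLPairRing O n) :=
  Ideal.span
    ((Set.range fun m : ℕ => ((glS O n).charpoly -
        ∏ j, (Polynomial.X - Polynomial.C (algebraMap O (GLPairRing O n) (α j : O)))).coeff m) ∪
      Set.range fun ij : Fin n × Fin n =>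
        (glΦ O n * glS O n * (glΦ O n)⁻¹ - glS O n ^ q) ij.1 ij.2)

/-- The coordinate ring of the affine `O`-scheme `ℳ(∏ (X - α j), q)`. -/
def ModuliRing (α : Fin n → Oˣ) (q : ℤ) : Type _ := GLPairRing O n ⧸ moduliIdeal α q

instance (α : Fin n → Oˣ) (q : ℤ) : CommRing (ModuliRing α q) :=
  inferInstanceAs (CommRing (GLPairRing O n ⧸ moduliIdeal α q))

instance (α : Fin n → Oˣ) (q : ℤ) : Algebra O (ModuliRing α q) :=
  inferInstanceAs (Algebra O (GLPairRing O n ⧸ moduliIdeal α q))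

/-- The quotient map onto the coordinate ring of `ℳ(∏ (X - α j), q)`. -/
def ModuliRing.mk (α : Fin n → Oˣ) (q : ℤ) : GLPairRing O n →ₐ[O] ModuliRing α q :=
  Ideal.Quotient.mkₐ O (moduliIdeal α q)

theorem ModuliRing.mk_eq_zero_iff (α : Fin n → Oˣ) (q : ℤ) (x : GLPairRing O n) :
    (ModuliRing.mk α q : GLPairRing O n →+* ModuliRing α q) x = 0 ↔ x ∈ moduliIdeal α q :=
  Ideal.Quotient.eq_zero_iff_mem

/-- The universal matrix `Φ`. -/
def univΦ (α : Fin n → Oˣ) (q : ℤ) : Matrix (Fin n) (Fin n) (ModuliRing α q) :=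
  (glΦ O n).map (ModuliRing.mk α q : GLPairRing O n →+* ModuliRing α q)

/-- The universal matrix `Σ`. -/
def univS (α : Fin n → Oˣ) (q : ℤ) : Matrix (Fin n) (Fin n) (ModuliRing α q) :=
  (glS O n).map (ModuliRing.mk α q : GLPairRing O n →+* ModuliRing α q)

theorem isUnit_det_glΦ : IsUnit (glΦ O n).det := by
  have h := IsLocalization.Away.algebraMap_isUnit (S := GLPairRing O n)
    ((polyΦ O n).det * (polyS O n).det)
  rw [map_mul, RingHom.map_det] at h
  exact isUnit_of_mul_isUnit_left h

theorem isUnit_det_glS : IsUnit (glS O n).det := by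
  have h := IsLocalization.Away.algebraMap_isUnit (S := GLPairRing O n)
    ((polyΦ O n).det * (polyS O n).det)
  rw [map_mul, RingHom.map_det, RingHom.map_det] at h
  exact isUnit_of_mul_isUnit_right h

theorem matrix_map_zpow {R T : Type*} [CommRing R] [CommRing T] (f : R →+* T)
    {A : Matrix (Fin n) (Fin n) R} (hA : IsUnit A.det) (m : ℤ) :
    (A ^ m).map f = A.map f ^ m := by
  obtain ⟨u, rfl⟩ := (Matrix.isUnit_iff_isUnit_det A).2 hA
  have h := map_zpow (Units.map (f.mapMatrix (m := Fin n)).toMonoidHom) u m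
  have h2 := congrArg Units.val h
  rw [Matrix.coe_units_zpow] at h2
  rw [← Matrix.coe_units_zpow]
  exact h2

theorem matrix_map_inv {R T : Type*} [CommRing R] [CommRing T] (f : R →+* T)
    {A : Matrix (Fin n) (Fin n) R} (hA : IsUnit A.det) :
    A⁻¹.map f = (A.map f)⁻¹ := by
  have h := matrix_map_zpow f hA (-1)
  simpa using h

theorem IsModuliPair.isUnit_det_right {α : Fin n → Oˣ} {q : ℤ} {R : Type*} [CommRing R]
    [Algebra O R] {P S : Matrix (Fin n) (Fin n) R} (h : IsModuliPair α q P S) :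
    IsUnit S.det := by
  have h0 : S.det = ∏ j, algebraMap O R (α j : O) := by
    rw [Matrix.det_eq_sign_charpoly_coeff, h.charpoly_eq, Polynomial.coeff_zero_eq_eval_zero,
      Polynomial.eval_prod]
    simp [Finset.prod_neg, ← mul_assoc, ← mul_pow]
  rw [h0, ← map_prod, ← Units.coe_prod]
  exact (Units.isUnit _).map _

/-- The universal pair is a point of the moduli problem. -/
theorem isModuliPair_univ (α : Fin n → Oˣ) (q : ℤ) :
    IsModuliPair α q (univΦ α q) (univS α q) := by
  refine ⟨?_, ?_, ?_⟩
  · have h := (isUnit_det_glΦ (O := O) (n := n)).map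
      (ModuliRing.mk α q : GLPairRing O n →+* ModuliRing α q)
    rw [RingHom.map_det] at h
    exact h
  · rw [univS, Matrix.charpoly_map]
    ext m
    have hm : ((glS O n).charpoly - ∏ j, (Polynomial.X - Polynomial.C
        (algebraMap O (GLPairRing O n) (α j : O)))).coeff m ∈ moduliIdeal α q :=
      Ideal.subset_span (Or.inl ⟨m, rfl⟩)
    rw [← ModuliRing.mk_eq_zero_iff, Polynomial.coeff_sub, map_sub, sub_eq_zero,
      ← Polynomial.coeff_map, ← Polynomial.coeff_map, Polynomial.map_prod] at hm
    simp only [Polynomial.map_sub, Polynomial.map_X, Polynomial.map_C, RingHom.coe_coe,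
      AlgHom.commutes] at hm
    exact hm
  · rw [univS, univΦ, ← matrix_map_inv _ isUnit_det_glΦ, ← matrix_map_zpow _ isUnit_det_glS,
      ← Matrix.map_mul, ← Matrix.map_mul]
    ext i j
    have hm : (glΦ O n * glS O n * (glΦ O n)⁻¹ - glS O n ^ q) i j ∈ moduliIdeal α q :=
      Ideal.subset_span (Or.inr ⟨(i, j), rfl⟩)
    rw [← ModuliRing.mk_eq_zero_iff, Matrix.sub_apply, map_sub, sub_eq_zero] at hm
    exact hm

/-- The universal property: every point of the moduli problem with values in an `O`-algebra is the
image of the universal pair under a unique homomorphism of `O`-algebras. -/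
theorem existsUnique_moduliRing_lift {α : Fin n → Oˣ} {q : ℤ} {R : Type*} [CommRing R]
    [Algebra O R] {P S : Matrix (Fin n) (Fin n) R} (h : IsModuliPair α q P S) :
    ∃! f : ModuliRing α q →ₐ[O] R, (univΦ α q).map f = P ∧ (univS α q).map f = S := by
  let g : PairPoly O n →ₐ[O] R :=
    MvPolynomial.aeval (Sum.elim (fun ij => P ij.1 ij.2) (fun ij => S ij.1 ij.2))
  have gΦ : (polyΦ O n).map g = P := by ext i j; simp [polyΦ, g]
  have gS : (polyS O n).map g = S := by ext i j; simp [polyS, g]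
  have hu : IsUnit (g ((polyΦ O n).det * (polyS O n).det)) := by
    rw [map_mul, AlgHom.map_det, AlgHom.map_det]
    change IsUnit (((polyΦ O n).map g).det * ((polyS O n).map g).det)
    rw [gΦ, gS]
    exact h.isUnit_det.mul h.isUnit_det_right
  let g₁ : GLPairRing O n →ₐ[O] R := IsLocalization.liftAlgHom
    (M := Submonoid.powers ((polyΦ O n).det * (polyS O n).det)) (f := g) (by
      rintro ⟨_, m, rfl⟩
      rw [map_pow]
      exact hu.pow m)
  have hg₁ : ∀ x, g₁ (algebraMap _ _ x) = g x := fun x => IsLocalization.lift_eq _ x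
  have g₁Φ : (glΦ O n).map g₁ = P := by
    rw [← gΦ]; ext i j; simp [glΦ, hg₁]
  have g₁S : (glS O n).map g₁ = S := by
    rw [← gS]; ext i j; simp [glS, hg₁]
  have hker : ∀ x ∈ moduliIdeal α q, g₁ x = 0 := by
    intro x hx
    refine (Ideal.span_le (I := RingHom.ker (g₁ : GLPairRing O n →+* R))).2 ?_ hx
    rintro _ (⟨m, rfl⟩ | ⟨⟨i, j⟩, rfl⟩)
    · change (g₁ : GLPairRing O n →+* R) (Polynomial.coeff (_ - _) m) = 0
      rw [Polynomial.coeff_sub, map_sub, sub_eq_zero, ← Polynomial.coeff_map,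
        ← Polynomial.coeff_map, ← Matrix.charpoly_map, Polynomial.map_prod]
      simp only [Polynomial.map_sub, Polynomial.map_X, Polynomial.map_C, RingHom.coe_coe, g₁S,
        AlgHom.commutes]
      rw [h.charpoly_eq]
    · change (g₁ : GLPairRing O n →+* R)
        ((glΦ O n * glS O n * (glΦ O n)⁻¹ - glS O n ^ q) i j) = 0
      have h1 : (glΦ O n * glS O n * (glΦ O n)⁻¹).map (g₁ : GLPairRing O n →+* R) =
          (glS O n ^ q).map (g₁ : GLPairRing O n →+* R) := by
        rw [Matrix.map_mul, Matrix.map_mul, matrix_map_inv _ isUnit_det_glΦ,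
          matrix_map_zpow _ isUnit_det_glS]
        simp only [RingHom.coe_coe, g₁Φ, g₁S]
        exact h.conj_eq
      have h2 := congrFun (congrFun h1 i) j
      rw [Matrix.sub_apply, map_sub, sub_eq_zero]
      exact h2
  let f₀ : ModuliRing α q →ₐ[O] R := Ideal.Quotient.liftₐ (moduliIdeal α q) g₁ hker
  have hf₀ : ∀ x, f₀ (ModuliRing.mk α q x) = g₁ x := fun x => rfl
  refine ⟨f₀, ⟨?_, ?_⟩, ?_⟩
  · rw [← g₁Φ]; ext i j; exact hf₀ _
  · rw [← g₁S]; ext i j; exact hf₀ _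
  · rintro f ⟨hf1, hf2⟩
    have hcomp : f.comp (ModuliRing.mk α q) = g₁ := by
      apply IsLocalization.algHom_ext
        (Submonoid.powers ((polyΦ O n).det * (polyS O n).det))
      apply MvPolynomial.algHom_ext
      rintro (⟨i, j⟩ | ⟨i, j⟩)
      · exact congrFun (congrFun (hf1.trans g₁Φ.symm) i) j
      · exact congrFun (congrFun (hf2.trans g₁S.symm) i) j
    ext x
    obtain ⟨y, rfl⟩ := Ideal.Quotient.mkₐ_surjective O (moduliIdeal α q) x
    exact (DFunLike.congr_fun hcomp y).trans (hf₀ y).symm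

end Moduli

/-! ### Components and fibres of an affine scheme over `O` -/

section Fibres

variable (O : Type*) [CommRing O] (F : Type*) [CommRing F] [Algebra O F]
  {A : Type*} [CommRing A] [Algebra O A]

/-- The coordinate ring of `Z ⊗ F`, where the closed subset `Z` of `Spec A` carries its reduced
subscheme structure, that is, where `Z` is regarded as the spectrum of `A` modulo the ideal of all
functions vanishing on `Z`. -/
abbrev ReducedFibreRing (Z : Set (PrimeSpectrum A)) : Type _ :=
  F ⊗[O] (A ⧸ PrimeSpectrum.vanishingIdeal Z)

/-- The underlying closed subset of the closed subscheme `Z ⊗ F` of `Spec A ⊗ F`. -/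
def reducedFibre (Z : Set (PrimeSpectrum A)) : Set (PrimeSpectrum (F ⊗[O] A)) :=
  Set.range (PrimeSpectrum.comap (Algebra.TensorProduct.map (AlgHom.id O F)
    (Ideal.Quotient.mkₐ O (PrimeSpectrum.vanishingIdeal Z))).toRingHom)

/-- The spectrum of `R` is generically reduced: its local rings at the generic points of its
irreducible components are reduced. -/
def IsGenericallyReduced (R : Type*) [CommRing R] : Prop :=
  ∀ (p : Ideal R) [p.IsPrime], p ∈ minimalPrimes R → IsReduced (Localization.AtPrime p)

end Fibres

end

-- Part (i). Write Σ = 1 + N. Here N is nilpotent and (1 + N)^q = 1 + N f(N) for an integer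
-- polynomial f with constant term q, so the relation becomes Φ N = N f(N) Φ, which is linear in Φ.
-- Stratify by the Jordan type σ of N, with N_σ the Jordan matrix. On a stratum N = g N_σ g⁻¹ and Φ
-- = g P g⁻¹, where P is determined by the images of the cyclic generators; since q is a unit, these
-- images range over a coordinate subspace. The parameters (g, P) thus form an open subset of an
-- affine space over O (`ParamRing`), in which a uniformizer w stays prime. This yields a generic
-- point of the stratum (`genericPrime`) and a generic point of its special fibre (`specialPrime`),
-- and every point is a specialization of those of its own Jordan type (`exists_genericPrime_le`).
--
-- The heart is `rank_eq_of_genericPrime_le_specialPrime`: if the closure of the stratum of σ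
-- contains the special point of τ, both types agree. Ranks of powers of N can only drop under
-- specialization. For the other direction, the eigenvalues of Φ can be listed as q^a γ_i, with i a
-- block of N and a a position in it. In characteristic l one has q^(l-1) = 1, so (l-1)-st powers of
-- the specialized eigenvalues depend only on the block. At a point of τ where these powers separate
-- the blocks, each block of τ must be a union of blocks of σ, and merging blocks only raises ranks.
--
-- All strata have dimension n²: if s, with entries in the field generated by N, brings N f(N) to
-- the form N_σ, then g = Φ⁻¹ s determines the point (Φ, Σ), and conversely. By Zariski's main
-- theorem (`trdeg_le_of_mem_minimalPrimes`) the dimension does not drop on passing to the special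
-- fibre of a component, so each component of that fibre is the closure of a special stratum, and
-- the comparison identifies its type. At its generic point the powers of N have the same ranks as
-- at the generic point of the component. Hence N has a Jordan form over the local ring, the local
-- ring receives a map from the parameter ring, and elements of the special prime become multiples
-- of w: this is generic reducedness.
--
-- Part (ii). The hypotheses force Σ^q = Σ, so the pairs are commuting pairs. Over a discrete
-- valuation ring flat means torsion-free, and for the reduced ring it suffices that every prime
-- containing w contains a prime meeting O in 0. Generically on a stratum of the special fibre, Φ
-- has distinct eigenvalues on the cokernel of N; the space then splits into cyclic N-modules on
-- each of which Φ is a polynomial in N (`exists_mul_eq_blockPoly`). Such a pair lifts: replace N by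
-- N + diag(α_j - 1) and keep the polynomials, with lifted coefficients
-- (`exists_isModuliPair_map_eq`).

universe u

noncomputable section

open scoped Matrix Cardinal

/-! ### Transcendence degree and Krull dimension of finitely generated domains. -/

section Dimension

open MvPolynomial in
/-- Let `p` be a prime of a finitely generated domain `B` over `O`, minimal over the ideal generated
by finitely many elements and by `p ∩ O`.  Then the transcendence degree of `B` exceeds the
transcendence degree of `B ⧸ p` by at most the number of these elements. -/
theorem trdeg_le_of_mem_minimalPrimes {O B ι : Type u} [CommRing O] [CommRing B]
    [IsDomain B] [IsNoetherianRing B] [Algebra O B] [Algebra.FiniteType O B] (x : ι → B)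
    (s : Finset B) (p : Ideal B) [p.IsPrime]
    (hp : p ∈ (Ideal.span (s : Set B) ⊔ (p.under O).map (algebraMap O B)).minimalPrimes)
    (halg : Algebra.IsAlgebraic (Algebra.adjoin O (Set.range (Ideal.Quotient.mk p ∘ x))) (B ⧸ p)) :
    Algebra.trdeg O B ≤ Cardinal.mk ι + s.card := by
  classical
  let v : ι ⊕ s → B := Sum.elim x Subtype.val
  let F : MvPolynomial (ι ⊕ s) O →ₐ[O] B := aeval v
  let _ : Algebra (MvPolynomial (ι ⊕ s) O) B := F.toRingHom.toAlgebra
  have hF : ∀ z, algebraMap (MvPolynomial (ι ⊕ s) O) B z = F z := fun _ => rfl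
  have : IsScalarTower O (MvPolynomial (ι ⊕ s) O) B :=
    IsScalarTower.of_algebraMap_eq fun r => (F.commutes r).symm
  have : Algebra.FiniteType (MvPolynomial (ι ⊕ s) O) B :=
    Algebra.FiniteType.of_restrictScalars_finiteType O _ B
  set J := Ideal.span (s : Set B) ⊔ (p.under O).map (algebraMap O B) with hJ
  let q : PrimeSpectrum B := ⟨p, inferInstance⟩
  let A₀ := Algebra.adjoin O (Set.range (Ideal.Quotient.mk p ∘ x))
  let G : MvPolynomial (ι ⊕ s) O →ₐ[O] B ⧸ p := (Ideal.Quotient.mkₐ O p).comp F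
  have hGX : ∀ i, G (X i) = Ideal.Quotient.mk p (v i) := fun i => by simp [G, F]
  have hGmem : ∀ z, G z ∈ A₀ := by
    intro z
    have : G.range ≤ A₀ := by
      rw [← Algebra.map_top, ← MvPolynomial.adjoin_range_X, AlgHom.map_adjoin, Algebra.adjoin_le_iff]
      rintro _ ⟨_, ⟨i, rfl⟩, rfl⟩
      change G (X i) ∈ A₀
      rw [hGX]
      rcases i with i | i
      · exact Algebra.subset_adjoin ⟨i, rfl⟩
      · have : Ideal.Quotient.mk p (v (Sum.inr i)) = 0 :=
          Ideal.Quotient.eq_zero_iff_mem.2 (hp.1.2 (Ideal.mem_sup_left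
            (Ideal.subset_span i.2)))
        rw [this]; exact A₀.zero_mem
    exact this ⟨z, rfl⟩
  let φ : MvPolynomial (ι ⊕ s) O →ₐ[O] A₀ := G.codRestrict A₀ hGmem
  have hφ : Function.Surjective φ := by
    rintro ⟨a, ha⟩
    have ha' := ha
    change a ∈ Algebra.adjoin O _ at ha'
    rw [Algebra.adjoin_range_eq_range_aeval] at ha'
    obtain ⟨z, rfl⟩ := ha'
    refine ⟨rename Sum.inl z, Subtype.ext ?_⟩
    change G (rename Sum.inl z) = aeval _ z
    rw [← AlgHom.comp_apply]
    congr 1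
    apply MvPolynomial.algHom_ext
    intro i
    simp [hGX, v]
  -- The point `p` is isolated in its fibre over the polynomial ring. A prime `P` with the same
  -- contraction contains `J`, so away from the other, finitely many minimal primes of `J` it
  -- contains `p`. The inclusion cannot be strict: `B ⧸ p` is algebraic over the image of the
  -- polynomial ring, so a larger prime would have a larger contraction.
  have : Algebra.QuasiFiniteAt (MvPolynomial (ι ⊕ s) O) p := by
    refine Algebra.QuasiFiniteAt.of_isOpen_singleton_fiber q ?_
    have hfin : (J.minimalPrimes \ {p}).Finite :=
      (Ideal.finite_minimalPrimes_of_isNoetherianRing B J).subset Set.sdiff_subset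
    have hcl : IsClosed (⋃ p' ∈ J.minimalPrimes \ {p}, PrimeSpectrum.zeroLocus (p' : Set B)) :=
      hfin.isClosed_biUnion fun p' _ => PrimeSpectrum.isClosed_zeroLocus _
    rw [isOpen_induced_iff]
    refine ⟨_, hcl.isOpen_compl, ?_⟩
    ext ⟨P, hP⟩
    simp only [Set.mem_preimage, Set.mem_compl_iff, Set.mem_iUnion, not_exists,
      Set.mem_singleton_iff]
    constructor
    · intro hPU
      have hPc : P.asIdeal.comap (algebraMap (MvPolynomial (ι ⊕ s) O) B) =
          p.comap (algebraMap (MvPolynomial (ι ⊕ s) O) B) := congrArg PrimeSpectrum.asIdeal hP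
      have hJP : J ≤ P.asIdeal := by
        rw [hJ, sup_le_iff, Ideal.span_le, Ideal.map_le_iff_le_comap]
        constructor
        · intro b hb
          have h1 : X (Sum.inr ⟨b, hb⟩) ∈ p.comap (algebraMap (MvPolynomial (ι ⊕ s) O) B) := by
            rw [Ideal.mem_comap, hF]
            simp only [F, aeval_X, v, Sum.elim_inr]
            exact hp.1.2 (Ideal.mem_sup_left (Ideal.subset_span hb))
          rw [← hPc, Ideal.mem_comap, hF] at h1
          simpa [F, v] using h1
        · intro a ha
          have h1 : C a ∈ p.comap (algebraMap (MvPolynomial (ι ⊕ s) O) B) := by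
            rw [Ideal.mem_comap, hF]
            simpa [F] using ha
          rw [← hPc, Ideal.mem_comap, hF] at h1
          simpa [F] using h1
      obtain ⟨p', hp', hle⟩ := Ideal.exists_minimalPrimes_le hJP
      have hpp : p' = p := by
        by_contra hne
        exact hPU p' ⟨hp', hne⟩ hle
      subst hpp
      refine Subtype.ext (PrimeSpectrum.ext (le_antisymm (?_ : P.asIdeal ≤ p') hle))
      intro b hb
      by_contra hbp
      obtain ⟨g, hg0, hg⟩ := halg.isAlgebraic (Ideal.Quotient.mk p' b)
      obtain ⟨f, rfl⟩ := Polynomial.map_surjective φ.toRingHom hφ g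
      have hlt := Ideal.comap_lt_comap_of_root_mem_sdiff
        (f := algebraMap (MvPolynomial (ι ⊕ s) O) B) (I := p') (J := P.asIdeal) hle
        (r := b) ⟨hb, hbp⟩ (p := f) ?_ ?_
      · exact absurd hPc hlt.ne'
      · intro h0
        apply hg0
        ext i
        have h1 := congrArg (fun r => Polynomial.coeff r i) h0
        simp only [Polynomial.coeff_map, Polynomial.coeff_zero] at h1 ⊢
        rw [Ideal.Quotient.eq_zero_iff_mem, Ideal.mem_comap, hF] at h1
        exact congrArg Subtype.val
          (Subtype.ext (Ideal.Quotient.eq_zero_iff_mem.2 h1) : φ (f.coeff i) = 0)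
      · rw [← Ideal.Quotient.eq_zero_iff_mem, ← hg, Polynomial.aeval_def, Polynomial.eval₂_map,
          Polynomial.hom_eval₂]
        rfl
    · intro hPq p' ⟨hp', hne⟩ hle
      obtain rfl : P = q := congrArg Subtype.val hPq
      exact hne (le_antisymm hle (hp.2 hp'.1 hle))
  -- Zariski's main theorem: some `r` outside `p` is integral and every `b` becomes integral after
  -- multiplication by a power of `r`. So `B` is algebraic over the subalgebra generated by `x` and
  -- `s`.
  obtain ⟨r, hrp, hr, H⟩ := Algebra.zariskisMainProperty_iff.1
    (Algebra.ZariskisMainProperty.of_finiteType (R := MvPolynomial (ι ⊕ s) O) p)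
  have hr0 : r ≠ 0 := fun h => hrp (h ▸ p.zero_mem)
  let S₀ := Algebra.adjoin O (Set.range v)
  have hS₀ : ∀ z, F z ∈ S₀ := fun z => by
    change _ ∈ Algebra.adjoin O _
    rw [Algebra.adjoin_range_eq_range_aeval]
    exact ⟨z, rfl⟩
  have hint : ∀ b : B, IsIntegral (MvPolynomial (ι ⊕ s) O) b → IsIntegral S₀ b := by
    rintro b ⟨f, hf, hfb⟩
    refine ⟨f.map (F.codRestrict S₀ hS₀).toRingHom, hf.map _, ?_⟩
    rw [Polynomial.eval₂_map]
    exact hfb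
  have : Algebra.IsAlgebraic S₀ B := by
    refine ⟨fun b => ?_⟩
    obtain ⟨m, hm⟩ := H b
    exact IsAlgebraic.of_mul (mem_nonZeroDivisors_of_ne_zero (pow_ne_zero m hr0))
      (hint _ (hr.pow m)).isAlgebraic (hint _ hm).isAlgebraic
  refine (Algebra.IsAlgebraic.trdeg_le_cardinalMk O (Set.range v)).trans ?_
  refine Cardinal.mk_range_le.trans ?_
  simp

/-- Incomparability makes contraction of primes strictly monotone; lying over and going up lift a
chain of primes. -/
theorem ringKrullDim_eq_of_isIntegral {R S : Type*} [CommRing R] [CommRing S] [Algebra R S]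
    [Algebra.IsIntegral R S] [FaithfulSMul R S] : ringKrullDim S = ringKrullDim R := by
  apply le_antisymm
  · refine Order.krullDim_le_of_strictMono (PrimeSpectrum.comap (algebraMap R S)) ?_
    intro P Q hPQ
    exact Ideal.IsIntegral.comap_lt_comap (I := P.asIdeal) (J := Q.asIdeal) hPQ
  · refine iSup_le fun c => ?_
    obtain ⟨P, _, hP⟩ := Ideal.exists_ideal_over_prime_of_isIntegral c.head.asIdeal (⊥ : Ideal S) (by
      rw [← RingHom.ker_eq_comap_bot,
        (RingHom.injective_iff_ker_eq_bot _).1 (FaithfulSMul.algebraMap_injective R S)]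
      exact bot_le)
    have : P.LiesOver c.head.asIdeal := ⟨hP.2.symm⟩
    have := hP.1
    obtain ⟨L, hL, -⟩ := Ideal.exists_ltSeries_of_hasGoingUp c P
    rw [← hL]
    exact Order.LTSeries.length_le_krullDim L

/-- By Noether normalization, both invariants equal the number of variables of a polynomial subring
over which `R` is integral. -/
theorem exists_trdeg_eq_and_ringKrullDim_eq (F R : Type u) [Field F] [CommRing R] [IsDomain R]
    [Algebra F R] [Algebra.FiniteType F R] :
    ∃ m : ℕ, Algebra.trdeg F R = m ∧ ringKrullDim R = m := by
  obtain ⟨s, g, hg, hint⟩ := exists_integral_inj_algHom_of_fg F R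
  let _ : Algebra (MvPolynomial (Fin s) F) R := g.toRingHom.toAlgebra
  have : IsScalarTower F (MvPolynomial (Fin s) F) R :=
    IsScalarTower.of_algebraMap_eq fun r => (g.commutes r).symm
  have : Algebra.IsIntegral (MvPolynomial (Fin s) F) R := ⟨hint⟩
  have : FaithfulSMul (MvPolynomial (Fin s) F) R :=
    (faithfulSMul_iff_algebraMap_injective _ _).2 hg
  refine ⟨s, ?_, ?_⟩
  · rw [← trdeg_add_eq F (MvPolynomial (Fin s) F) (A := R),
      trdeg_eq_zero (R := MvPolynomial (Fin s) F), MvPolynomial.trdeg_of_isDomain]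
    simp
  · rw [ringKrullDim_eq_of_isIntegral (R := MvPolynomial (Fin s) F),
      MvPolynomial.ringKrullDim_of_isNoetherianRing, ringKrullDim_eq_zero_of_field]
    simp

/-- A surjection of finitely generated domains over a field which does not lower the dimension is
injective. -/
theorem injective_of_ringKrullDim_le {R S : Type*} [CommRing R] [CommRing S] [IsDomain R]
    [IsDomain S] (f : R →+* S) (hf : Function.Surjective f) {m : ℕ} (hR : ringKrullDim R ≤ m)
    (hS : (m : WithBot ℕ∞) ≤ ringKrullDim S) : Function.Injective f := by
  rw [injective_iff_map_eq_zero]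
  intro r hr
  by_contra h0
  have h1 := ringKrullDim_succ_le_of_surjective f hf (mem_nonZeroDivisors_of_ne_zero h0) hr
  have h2 : ((m + 1 : ℕ) : WithBot ℕ∞) ≤ (m : ℕ) := by
    push_cast
    exact ((add_le_add_left hS 1).trans h1).trans hR
  exact absurd (by exact_mod_cast h2) (Nat.not_succ_le_self m)

end Dimension

/-! ### Jordan types, standard nilpotent matrices and their intertwiners. -/

/-- The shape of a nilpotent matrix in Jordan form: a list of block sizes, with an indexing of the
standard basis by the pairs consisting of a block and a position in it. -/
structure JordanType (n : ℕ) where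
  /-- the number of blocks -/
  parts : ℕ
  /-- the size of a block -/
  size : Fin parts → ℕ
  size_pos : ∀ i, 0 < size i
  /-- the labelling of the standard basis -/
  index : Fin n ≃ Σ i, Fin (size i)

namespace JordanType

variable {n : ℕ} (σ : JordanType n)

/-- The block of a basis vector. -/
def blk (j : Fin n) : Fin σ.parts := (σ.index j).1

/-- The position of a basis vector in its block. -/
def pos (j : Fin n) : ℕ := (σ.index j).2

/-- The basis vector with given block and position. -/
def vec (i : Fin σ.parts) (a : ℕ) (h : a < σ.size i) : Fin n := σ.index.symm ⟨i, ⟨a, h⟩⟩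

/-- The first basis vector of a block. -/
def base (i : Fin σ.parts) : Fin n := σ.vec i 0 (σ.size_pos i)

@[simp] theorem blk_vec (i : Fin σ.parts) (a : ℕ) (h : a < σ.size i) : σ.blk (σ.vec i a h) = i := by
  simp [blk, vec]

@[simp] theorem pos_vec (i : Fin σ.parts) (a : ℕ) (h : a < σ.size i) : σ.pos (σ.vec i a h) = a := by
  rw [pos, vec, Equiv.apply_symm_apply]

@[simp] theorem blk_base (i : Fin σ.parts) : σ.blk (σ.base i) = i := blk_vec ..

@[simp] theorem pos_base (i : Fin σ.parts) : σ.pos (σ.base i) = 0 := pos_vec ..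

theorem pos_lt (j : Fin n) : σ.pos j < σ.size (σ.blk j) := (σ.index j).2.2

@[simp] theorem vec_blk_pos (j : Fin n) (h : σ.pos j < σ.size (σ.blk j)) :
    σ.vec (σ.blk j) (σ.pos j) h = j := by
  simp [vec, blk, pos]

variable {σ} in
theorem ext_iff' {i j : Fin n} : i = j ↔ σ.blk i = σ.blk j ∧ σ.pos i = σ.pos j := by
  refine ⟨fun h => h ▸ ⟨rfl, rfl⟩, fun ⟨h1, h2⟩ => ?_⟩
  rw [← σ.vec_blk_pos i (σ.pos_lt i), ← σ.vec_blk_pos j (σ.pos_lt j)]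
  simp only [h1, h2]

theorem eq_vec_iff {j : Fin n} {i : Fin σ.parts} {a : ℕ} {h : a < σ.size i} :
    j = σ.vec i a h ↔ σ.blk j = i ∧ σ.pos j = a := by
  rw [ext_iff' (σ := σ), blk_vec, pos_vec]

/-- The rank of the `a`-th power of a nilpotent matrix of shape `σ`. -/
def rank (a : ℕ) : ℕ := ∑ i, (σ.size i - a)

theorem sum_index {M : Type*} [AddCommMonoid M] (f : Fin σ.parts → ℕ → M) :
    ∑ j, f (σ.blk j) (σ.pos j) = ∑ i, ∑ a ∈ Finset.range (σ.size i), f i a := by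
  rw [← Equiv.sum_comp σ.index.symm, Fintype.sum_sigma]
  refine Finset.sum_congr rfl fun i _ => ?_
  rw [← Fin.sum_univ_eq_sum_range]
  refine Finset.sum_congr rfl fun a _ => ?_
  rw [blk, pos, Equiv.apply_symm_apply]

theorem card_le_pos (a : ℕ) : Fintype.card {j : Fin n // a ≤ σ.pos j} = σ.rank a := by
  rw [Fintype.card_subtype, Finset.card_filter, σ.sum_index fun _ b => if a ≤ b then 1 else 0, rank]
  refine Finset.sum_congr rfl fun i _ => ?_
  rw [← Finset.card_filter]
  have : Finset.filter (fun b => a ≤ b) (Finset.range (σ.size i)) = Finset.Ico a (σ.size i) := by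
    ext b; simp [and_comm]
  rw [this, Nat.card_Ico]

section Nilp

variable (R : Type*) [CommRing R]

/-- The nilpotent matrix of shape `σ` in Jordan form. -/
def nilp : Matrix (Fin n) (Fin n) R :=
  Matrix.of fun i j => if σ.blk i = σ.blk j ∧ σ.pos i = σ.pos j + 1 then 1 else 0

variable {R}

theorem mul_nilp_apply (X : Matrix (Fin n) (Fin n) R) (i j : Fin n) :
    (X * σ.nilp R) i j = if h : σ.pos j + 1 < σ.size (σ.blk j) then
      X i (σ.vec (σ.blk j) (σ.pos j + 1) h) else 0 := by
  rw [Matrix.mul_apply]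
  split_ifs with h
  · rw [Finset.sum_eq_single (σ.vec (σ.blk j) (σ.pos j + 1) h)]
    · simp [nilp]
    · intro k _ hk
      rw [nilp, Matrix.of_apply, if_neg, mul_zero]
      exact fun h1 => hk (σ.eq_vec_iff.2 h1)
    · simp
  · refine Finset.sum_eq_zero fun k _ => ?_
    rw [nilp, Matrix.of_apply, if_neg, mul_zero]
    rintro ⟨h1, h2⟩
    have := σ.pos_lt k
    rw [h1, h2] at this
    exact h this

theorem nilp_pow_apply (a : ℕ) (i j : Fin n) :
    (σ.nilp R ^ a) i j = if σ.blk i = σ.blk j ∧ σ.pos i = σ.pos j + a then 1 else 0 := by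
  induction a generalizing j with
  | zero => simp [Matrix.one_apply, ext_iff' (σ := σ)]
  | succ a ih =>
    rw [pow_succ, mul_nilp_apply]
    split_ifs with h h' h'
    · rw [ih, blk_vec, pos_vec, if_pos ⟨h'.1, by omega⟩]
    · rw [ih, blk_vec, pos_vec, if_neg]
      rintro ⟨h1, h2⟩
      exact h' ⟨h1, by omega⟩
    · have := σ.pos_lt i
      rw [h'.1] at this
      omega
    · rfl

theorem nilp_pow_mulVec_apply (a : ℕ) (w : Fin n → R) (i : Fin n) :
    ((σ.nilp R ^ a) *ᵥ w) i = if a ≤ σ.pos i then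
      w (σ.vec (σ.blk i) (σ.pos i - a) ((Nat.sub_le _ _).trans_lt (σ.pos_lt i))) else 0 := by
  rw [Matrix.mulVec, dotProduct]
  split_ifs with h
  · rw [Finset.sum_eq_single
      (σ.vec (σ.blk i) (σ.pos i - a) ((Nat.sub_le _ _).trans_lt (σ.pos_lt i)))]
    · rw [nilp_pow_apply, blk_vec, pos_vec, if_pos ⟨rfl, by omega⟩, one_mul]
    · intro k _ hk
      rw [nilp_pow_apply, if_neg, zero_mul]
      exact fun h1 => hk (σ.eq_vec_iff.2 ⟨h1.1.symm, by omega⟩)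
    · simp
  · refine Finset.sum_eq_zero fun k _ => ?_
    rw [nilp_pow_apply, if_neg, zero_mul]
    omega

theorem size_le (i : Fin σ.parts) : σ.size i ≤ n := by
  have h := Fintype.card_congr σ.index
  simp only [Fintype.card_fin, Fintype.card_sigma] at h
  refine le_of_le_of_eq ?_ h.symm
  exact Finset.single_le_sum (f := σ.size) (fun _ _ => Nat.zero_le _) (Finset.mem_univ i)

theorem nilp_pow_eq_zero : σ.nilp R ^ n = 0 := by
  ext i j
  rw [nilp_pow_apply, if_neg, Matrix.zero_apply]
  have := σ.pos_lt i
  have := σ.size_le (σ.blk i)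
  omega

theorem nilp_map {S : Type*} [CommRing S] (f : R →+* S) : (σ.nilp R).map f = σ.nilp S := by
  ext i j
  simp only [nilp, Matrix.map_apply, Matrix.of_apply]
  split_ifs <;> simp

/-- The matrix whose column labelled by a block `i` and a position `a` is `T ^ a` applied to the
`i`-th given vector. -/
def cyc (T : Matrix (Fin n) (Fin n) R) (v : Fin σ.parts → Fin n → R) : Matrix (Fin n) (Fin n) R :=
  Matrix.of fun i j => ((T ^ σ.pos j) *ᵥ v (σ.blk j)) i

theorem col_cyc (T : Matrix (Fin n) (Fin n) R) (v : Fin σ.parts → Fin n → R) (j : Fin n) :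
    (σ.cyc T v).col j = (T ^ σ.pos j) *ᵥ v (σ.blk j) := rfl

theorem cyc_map {S : Type*} [CommRing S] (f : R →+* S) (T : Matrix (Fin n) (Fin n) R)
    (v : Fin σ.parts → Fin n → R) :
    (σ.cyc T v).map f = σ.cyc (T.map f) fun i => f ∘ v i := by
  ext i j
  simp only [cyc, Matrix.map_apply, Matrix.of_apply]
  rw [f.map_mulVec]
  congr 2
  exact map_pow f.mapMatrix T _

/-- Multiplication by `T` moves each column to the next one of its block, and the hypothesis kills
what would come after the last column. -/
theorem mul_cyc (T : Matrix (Fin n) (Fin n) R) (v : Fin σ.parts → Fin n → R)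
    (h : ∀ i, (T ^ σ.size i) *ᵥ v i = 0) : T * σ.cyc T v = σ.cyc T v * σ.nilp R := by
  have h1 : ∀ j, (T * σ.cyc T v).col j = (T ^ (σ.pos j + 1)) *ᵥ v (σ.blk j) := fun j => by
    rw [pow_succ', ← Matrix.mulVec_mulVec, ← col_cyc]
    rfl
  ext i j
  refine (congrFun (h1 j) i).trans ?_
  rw [mul_nilp_apply]
  split_ifs with hj
  · simp [cyc]
  · have : σ.pos j + 1 = σ.size (σ.blk j) := by
      have := σ.pos_lt j
      omega
    rw [this, h, Pi.zero_apply]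

theorem pow_mul_eq_of_mul_eq {M N X : Matrix (Fin n) (Fin n) R} (h : M * X = X * N) (a : ℕ) :
    M ^ a * X = X * N ^ a := by
  induction a with
  | zero => simp
  | succ a ih => rw [pow_succ, Matrix.mul_assoc, h, ← Matrix.mul_assoc, ih, Matrix.mul_assoc, ← pow_succ]

theorem pow_mulVec_col {M X : Matrix (Fin n) (Fin n) R} (h : M * X = X * σ.nilp R)
    (i : Fin σ.parts) (a : ℕ) : (M ^ a) *ᵥ X.col (σ.base i) =
      if ha : a < σ.size i then X.col (σ.vec i a ha) else 0 := by
  have h1 : (M ^ a) *ᵥ X.col (σ.base i) = (M ^ a * X).col (σ.base i) := rfl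
  rw [h1, pow_mul_eq_of_mul_eq h]
  ext r
  rw [Matrix.col_apply, Matrix.mul_apply]
  split_ifs with ha
  · rw [Finset.sum_eq_single (σ.vec i a ha)]
    · simp [nilp_pow_apply]
    · intro k _ hk
      rw [nilp_pow_apply, if_neg, mul_zero]
      simpa using fun h1 h2 => hk (σ.eq_vec_iff.2 ⟨h1, h2⟩)
    · simp
  · refine Finset.sum_eq_zero fun k _ => ?_
    rw [nilp_pow_apply, if_neg, mul_zero]
    rintro ⟨h1, h2⟩
    have := σ.pos_lt k
    rw [h1, h2] at this
    simp at this
    exact ha this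

/-- With `mul_cyc` and `size_pow_mulVec_col` this identifies the solutions `X` of `M * X = X * nilp`
with the families of vectors killed by `M ^ size i`. This is what makes the spaces of intertwiners
accessible. -/
theorem eq_cyc {M X : Matrix (Fin n) (Fin n) R} (h : M * X = X * σ.nilp R) :
    X = σ.cyc M fun i => X.col (σ.base i) := by
  ext i j
  rw [cyc, Matrix.of_apply, pow_mulVec_col σ h, dif_pos (σ.pos_lt j), vec_blk_pos, Matrix.col_apply]

theorem size_pow_mulVec_col {M X : Matrix (Fin n) (Fin n) R} (h : M * X = X * σ.nilp R)
    (i : Fin σ.parts) : (M ^ σ.size i) *ᵥ X.col (σ.base i) = 0 := by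
  rw [pow_mulVec_col σ h, dif_neg (lt_irrefl _)]

end Nilp

section Rank

variable {F : Type*} [Field F]

/-- The product of `nilp ^ a` with its transpose is the diagonal projector onto the positions at
least `a`, and this projector fixes `nilp ^ a`. -/
theorem rank_nilp_pow (a : ℕ) : (σ.nilp F ^ a).rank = σ.rank a := by
  classical
  have hE : σ.nilp F ^ a * (σ.nilp F ^ a)ᵀ =
      Matrix.diagonal fun i => if a ≤ σ.pos i then (1 : F) else 0 := by
    ext i j
    have h1 : (σ.nilp F ^ a * (σ.nilp F ^ a)ᵀ) i j =
      ((σ.nilp F ^ a) *ᵥ fun k => (σ.nilp F ^ a) j k) i := rfl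
    rw [h1, nilp_pow_mulVec_apply, Matrix.diagonal_apply, nilp_pow_apply, blk_vec, pos_vec]
    by_cases ha : a ≤ σ.pos i
    · simp only [ha, if_true]
      refine if_congr ?_ rfl rfl
      rw [ext_iff' (σ := σ), Nat.sub_add_cancel ha]
      exact and_congr eq_comm eq_comm
    · simp [ha]
  have hd : (σ.nilp F ^ a * (σ.nilp F ^ a)ᵀ).rank = σ.rank a := by
    rw [hE, Matrix.rank_diagonal, ← σ.card_le_pos a]
    refine Fintype.card_congr (Equiv.subtypeEquivRight fun i => ?_)
    simp
  have hN : σ.nilp F ^ a * (σ.nilp F ^ a)ᵀ * σ.nilp F ^ a = σ.nilp F ^ a := by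
    rw [hE]
    ext i j
    rw [Matrix.diagonal_mul, nilp_pow_apply]
    split_ifs with h1 h2 h2
    · simp
    · simp
    · exact absurd (h2.2 ▸ Nat.le_add_left _ _) h1
    · simp
  apply le_antisymm
  · rw [← hd]
    nth_rw 1 [← hN]
    exact Matrix.rank_mul_le_left _ _
  · rw [← hd]
    exact Matrix.rank_mul_le_left _ _

theorem rank_pow_of_mul_eq {N g : Matrix (Fin n) (Fin n) F} (hg : IsUnit g.det)
    (h : N * g = g * σ.nilp F) (a : ℕ) : (N ^ a).rank = σ.rank a := by
  rw [← Matrix.rank_mul_eq_left_of_isUnit_det g (N ^ a) hg, pow_mul_eq_of_mul_eq h,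
    Matrix.rank_mul_eq_right_of_isUnit_det g _ hg, rank_nilp_pow]

end Rank

end JordanType

/-! ### Minors, and ranks under specialization. -/

section Rank

variable {m p : Type*}

theorem exists_linearIndependent_comp [Finite p] {F V : Type*} [Field F] [AddCommGroup V] [Module F V]
    (v : p → V) {r : ℕ} (hr : Module.finrank F (Submodule.span F (Set.range v)) = r) :
    ∃ f : Fin r → p, LinearIndependent F (v ∘ f) := by
  subst hr
  have := Module.Finite.span_of_finite F (Set.finite_range v)
  obtain ⟨c, hc, -, hli⟩ := Submodule.exists_fun_fin_finrank_span_eq F (Set.range v)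
  choose f hf using hc
  exact ⟨f, by convert hli using 1; exact funext hf⟩

/-- Independent columns are chosen first, then independent rows of the resulting submatrix, whose
rank is unchanged. -/
theorem exists_det_submatrix_ne_zero [Fintype m] [Fintype p] {F : Type*} [Field F] (A : Matrix m p F) :
    ∃ (f : Fin A.rank → m) (g : Fin A.rank → p), (A.submatrix f g).det ≠ 0 := by
  classical
  obtain ⟨g, hg⟩ := exists_linearIndependent_comp A.col (A.rank_eq_finrank_span_cols).symm
  have h1 : ((A.submatrix id g)ᵀ).rank = A.rank := by
    have h2 := LinearIndependent.rank_matrix (M := (A.submatrix id g)ᵀ) hg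
    rwa [Fintype.card_fin] at h2
  rw [Matrix.rank_transpose] at h1
  obtain ⟨f, hf⟩ := exists_linearIndependent_comp (A.submatrix id g).row
    ((Matrix.rank_eq_finrank_span_row (A.submatrix id g)).symm.trans h1)
  refine ⟨f, g, ?_⟩
  have h3 : IsUnit (A.submatrix f g) := Matrix.linearIndependent_rows_iff_isUnit.1 hf
  exact ((Matrix.isUnit_iff_isUnit_det _).1 h3).ne_zero

theorem le_rank_of_det_submatrix_ne_zero [Fintype p] {F : Type*} [Field F] (A : Matrix m p F) {r : ℕ}
    (f : Fin r → m) (g : Fin r → p) (h : (A.submatrix f g).det ≠ 0) : r ≤ A.rank := by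
  have h1 := Matrix.rank_of_det_ne_zero h
  rw [Fintype.card_fin] at h1
  conv_lhs => rw [← h1]
  rw [← Matrix.eRank_toNat_eq_rank, ← Matrix.eRank_toNat_eq_rank]
  refine ENat.toNat_le_toNat (Matrix.eRank_submatrix_le A f g) ?_
  exact ((Matrix.eRank_le_card_width A).trans_lt (by simp)).ne

/-- Ranks do not grow under specialization. -/
theorem rank_map_le_rank_map [Fintype m] [Fintype p] {R E F : Type*} [CommRing R] [Field E] [Field F] (f : R →+* E)
    (g : R →+* F) (hg : Function.Injective g) (A : Matrix m p R) :
    (A.map f).rank ≤ (A.map g).rank := by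
  -- A nonzero maximal minor over `E` comes from a minor over `R`; the latter is nonzero, and stays
  -- so in `F`.
  obtain ⟨a, b, h⟩ := exists_det_submatrix_ne_zero (A.map f)
  refine le_rank_of_det_submatrix_ne_zero _ a b ?_
  have h1 : ((A.map f).submatrix a b).det = f (A.submatrix a b).det := by
    rw [RingHom.map_det]; rfl
  have h2 : ((A.map g).submatrix a b).det = g (A.submatrix a b).det := by
    rw [RingHom.map_det]; rfl
  rw [h1] at h
  rw [h2]
  intro h0
  rw [(map_eq_zero_iff g hg).1 h0, map_zero] at h
  exact h rfl

theorem Matrix.rank_map_ringHom [Fintype m] [Fintype p] {E F : Type*} [Field E] [Field F] (f : E →+* F) (A : Matrix m p E) :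
    (A.map f).rank = A.rank := by
  apply le_antisymm
  · simpa using rank_map_le_rank_map f (RingHom.id E) Function.injective_id A
  · simpa using rank_map_le_rank_map (RingHom.id E) f f.injective A

end Rank

/-! ### The Jordan form over a field. -/

section Jordan

theorem DFinsupp.basis_apply_single {ι R : Type*} [DecidableEq ι] {M η : ι → Type*} [Semiring R]
    [∀ i, AddCommMonoid (M i)] [∀ i, Module R (M i)] (b : ∀ i, Module.Basis (η i) R (M i)) (i : ι)
    (a : η i) : DFinsupp.basis b ⟨i, a⟩ = DFinsupp.single i (b i a) := by
  apply (DFinsupp.basis b).repr.injective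
  rw [Module.Basis.repr_self]
  change _ = (sigmaFinsuppLequivDFinsupp R).symm
    (DFinsupp.mapRange.linearEquiv (fun i => (b i).repr) (DFinsupp.single i (b i a)))
  rw [LinearEquiv.eq_symm_apply]
  change sigmaFinsuppEquivDFinsupp _ = _
  simp [DFinsupp.mapRange_single]

variable {n : ℕ}

open Polynomial in
/-- Every nilpotent matrix over a field has a Jordan form. -/
theorem exists_jordanType {F : Type*} [Field F] (N : Matrix (Fin n) (Fin n) F)
    (hN : IsNilpotent N) : ∃ (σ : JordanType n) (g : Matrix (Fin n) (Fin n) F), IsUnit g.det ∧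
      N * g = g * σ.nilp F := by
  classical
  let φ : (Fin n → F) →ₗ[F] (Fin n → F) := N.mulVecLin
  have hφ : ∀ (a : ℕ) v, (φ ^ a) v = (N ^ a) *ᵥ v := by
    intro a v
    induction a generalizing v with
    | zero => simp
    | succ a ih => rw [pow_succ, Module.End.mul_apply, ih, pow_succ, ← Matrix.mulVec_mulVec]; rfl
  obtain ⟨r, hr⟩ := hN
  have htor : Module.IsTorsion' (Module.AEval' φ) (Submonoid.powers (X : F[X])) := by
    rw [Submodule.isTorsion'_powers_iff]
    intro x
    refine ⟨r, ?_⟩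
    obtain ⟨v, rfl⟩ := (Module.AEval'.of φ).surjective x
    rw [Module.AEval'.X_pow_smul_of, Module.End.smul_def, hφ, hr, Matrix.zero_mulVec, map_zero]
  -- With `X` acting as `N`, the space is an `F[X]`-module killed by a power of `X`, hence a direct
  -- sum of modules `F[X] / (X ^ k i)`; the powers of `X` in each summand give the Jordan basis.
  obtain ⟨d, k, ⟨E⟩⟩ := Module.torsion_by_prime_power_decomposition irreducible_X htor
  let b₀ : ∀ i : Fin d, Module.Basis (Fin (k i)) F (F[X] ⧸ (F[X] ∙ (X ^ k i : F[X]))) := fun i =>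
    ((AdjoinRoot.powerBasis' (monic_X_pow (R := F) (k i))).basis.reindex
      (finCongr (natDegree_X_pow (R := F) (k i))) :)
  have hb₀ : ∀ i a, b₀ i a = (X ^ (a : ℕ) : F[X]) • Submodule.Quotient.mk 1 := by
    intro i a
    simp only [b₀]
    erw [Module.Basis.reindex_apply]
    rw [PowerBasis.basis_eq_pow, AdjoinRoot.powerBasis'_gen, ← Submodule.Quotient.mk_smul,
      smul_eq_mul, mul_one]
    exact (map_pow (AdjoinRoot.mk (X ^ k i)) X (a : ℕ)).symm
  let b := (DFinsupp.basis b₀).map (E.restrictScalars F).symm |>.map (Module.AEval'.of φ).symm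
  let v : Fin d → Fin n → F := fun i =>
    (Module.AEval'.of φ).symm (E.symm (DirectSum.lof F[X] (Fin d) (fun i => F[X] ⧸ (F[X] ∙ (X ^ k i : F[X]))) i (Submodule.Quotient.mk 1)))
  have hpow : ∀ (a : ℕ) i, (N ^ a) *ᵥ v i = (Module.AEval'.of φ).symm
      (E.symm (DirectSum.lof F[X] (Fin d) (fun i => F[X] ⧸ (F[X] ∙ (X ^ k i : F[X]))) i ((X ^ a : F[X]) • Submodule.Quotient.mk 1))) := by
    intro a i
    rw [← hφ, map_smul, map_smul, LinearEquiv.eq_symm_apply]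
    have h1 := Module.AEval'.X_pow_smul_of φ (v i) a
    rw [Module.End.smul_def] at h1
    rw [← h1]
    simp only [v, LinearEquiv.apply_symm_apply]
  have hb : ∀ i a, b ⟨i, a⟩ = (N ^ (a : ℕ)) *ᵥ v i := by
    intro i a
    rw [hpow, ← hb₀]
    simp only [b, Module.Basis.map_apply, DFinsupp.basis_apply_single]
    rfl
  have hv : ∀ i, (N ^ k i) *ᵥ v i = 0 := by
    intro i
    have : (X ^ k i : F[X]) • (Submodule.Quotient.mk 1 : F[X] ⧸ (F[X] ∙ (X ^ k i : F[X]))) = 0 := by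
      rw [← Submodule.Quotient.mk_smul, Submodule.Quotient.mk_eq_zero, smul_eq_mul, mul_one]
      exact Submodule.mem_span_singleton_self _
    rw [hpow, this, map_zero, map_zero, map_zero]
  -- Summands with `k i = 0` are zero; they are discarded because a `JordanType` has positive block
  -- sizes.
  let e := Fintype.equivFin {i // 0 < k i}
  let ψ : (Σ i, Fin (k (e.symm i).1)) → Σ i, Fin (k i) := fun x => ⟨(e.symm x.1).1, x.2⟩
  have hψ : Function.Bijective ψ := by
    constructor
    · rintro ⟨i, a⟩ ⟨j, c⟩ h
      obtain ⟨i', rfl⟩ := e.surjective i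
      obtain ⟨j', rfl⟩ := e.surjective j
      simp only [ψ, Sigma.mk.injEq] at h
      obtain rfl : i' = j' := Subtype.ext (by simpa using h.1)
      simpa using h.2
    · rintro ⟨i, a⟩
      have hi : 0 < k i := a.pos
      refine ⟨⟨e ⟨i, hi⟩, Fin.cast (by simp) a⟩, ?_⟩
      simp only [ψ]
      have h1 : e.symm (e ⟨i, hi⟩) = ⟨i, hi⟩ := e.symm_apply_apply _
      rw [Sigma.mk.injEq]
      refine ⟨by rw [h1], ?_⟩
      rw [Fin.heq_ext_iff (by rw [h1])]
      simp
  have hcard : Fintype.card (Fin n) = Fintype.card (Σ i, Fin (k (e.symm i).1)) := by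
    rw [Fintype.card_of_bijective hψ, ← Module.finrank_eq_card_basis b, Module.finrank_fin_fun,
      Fintype.card_fin]
  let σ : JordanType n := ⟨_, fun i => k (e.symm i).1, fun i => (e.symm i).2,
    Fintype.equivOfCardEq hcard⟩
  let w : Fin σ.parts → Fin n → F := fun i => v (e.symm i).1
  refine ⟨σ, σ.cyc N w, ?_, σ.mul_cyc N w fun i => hv _⟩
  rw [← Matrix.isUnit_iff_isUnit_det, ← Matrix.linearIndependent_cols_iff_isUnit]
  have h1 := b.linearIndependent.comp _ (hψ.1.comp σ.index.injective)
  convert h1 using 1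
  ext j : 1
  rw [σ.col_cyc]
  exact (hb _ _).symm

end Jordan

/-! ### Ranks of powers determine the Jordan form, over fields and over local domains. -/

namespace JordanType

variable {n : ℕ}

theorem rank_add_card (σ : JordanType n) (a : ℕ) :
    σ.rank (a + 1) + Fintype.card {i // a < σ.size i} = σ.rank a := by
  rw [Fintype.card_subtype, Finset.card_filter, rank, rank, ← Finset.sum_add_distrib]
  refine Finset.sum_congr rfl fun i _ => ?_
  split_ifs <;> omega

/-- First differences of the rank function count the blocks longer than a given length, so second
differences count those of exactly that length. -/
theorem card_size_eq {σ τ : JordanType n} (h : σ.rank = τ.rank) (b : ℕ) :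
    Fintype.card {i // σ.size i = b} = Fintype.card {i // τ.size i = b} := by
  rcases b with _ | b
  · have h1 : ∀ ρ : JordanType n, Fintype.card {i // ρ.size i = 0} = 0 := fun ρ =>
      Fintype.card_eq_zero_iff.2 ⟨fun i => (ρ.size_pos i.1).ne' i.2⟩
    rw [h1, h1]
  · have h1 : ∀ ρ : JordanType n, Fintype.card {i // b + 1 < ρ.size i} +
        Fintype.card {i // ρ.size i = b + 1} = Fintype.card {i // b < ρ.size i} := fun ρ => by
      simp only [Fintype.card_subtype, Finset.card_filter]
      rw [← Finset.sum_add_distrib]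
      refine Finset.sum_congr rfl fun i _ => ?_
      split_ifs <;> omega
    have h2 := h1 σ
    have h3 := h1 τ
    have h4 := σ.rank_add_card b
    have h5 := τ.rank_add_card b
    have h6 := σ.rank_add_card (b + 1)
    have h7 := τ.rank_add_card (b + 1)
    rw [h] at h4 h6
    omega

/-- Equal ranks give a size-preserving bijection of blocks. A permutation is still needed because
the shapes may label the standard basis differently. -/
theorem exists_perm_of_rank_eq {σ τ : JordanType n} (h : σ.rank = τ.rank) :
    ∃ π : Equiv.Perm (Fin n), ∀ (R : Type u) [CommRing R],
      (τ.nilp R).submatrix π π = σ.nilp R := by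
  classical
  let e : Fin σ.parts ≃ Fin τ.parts := Equiv.ofFiberEquiv (f := σ.size) (g := τ.size)
    fun b => Fintype.equivOfCardEq (card_size_eq h b)
  have he : ∀ i, τ.size (e i) = σ.size i := fun i => Equiv.ofFiberEquiv_map _ i
  let π : Fin n → Fin n := fun j =>
    τ.vec (e (σ.blk j)) (σ.pos j) ((he (σ.blk j)).symm ▸ σ.pos_lt j)
  have hπ : Function.Injective π := by
    intro i j hij
    rw [ext_iff' (σ := τ)] at hij
    simp only [π, blk_vec, pos_vec, EmbeddingLike.apply_eq_iff_eq] at hij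
    exact ext_iff'.2 hij
  refine ⟨Equiv.ofBijective π (Finite.injective_iff_bijective.1 hπ), fun R _ => ?_⟩
  ext i j
  simp [nilp, π]

/-- Nilpotency of `N` need not be assumed: it follows from the rank of `N ^ n`. The Jordan form of
`N` then has the same ranks as `σ`, so it is `σ` up to a permutation of the basis. -/
theorem exists_mul_eq_of_rank_eq {F : Type u} [Field F] (σ : JordanType n)
    (N : Matrix (Fin n) (Fin n) F) (h : ∀ a, (N ^ a).rank = σ.rank a) :
    ∃ g : Matrix (Fin n) (Fin n) F, IsUnit g.det ∧ N * g = g * σ.nilp F := by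
  have hN : IsNilpotent N := by
    refine ⟨n, ?_⟩
    have h1 := h n
    rw [← rank_nilp_pow (F := F), nilp_pow_eq_zero, Matrix.rank_zero] at h1
    have h2 : LinearMap.range (N ^ n).mulVecLin = ⊥ := Submodule.finrank_eq_zero.1 h1
    rw [LinearMap.range_eq_bot] at h2
    ext i j
    have h3 := congrFun (LinearMap.congr_fun h2 (Pi.single j 1)) i
    simpa using h3
  obtain ⟨τ, g, hg, hNg⟩ := exists_jordanType N hN
  have hr : σ.rank = τ.rank := funext fun a => (h a).symm.trans (τ.rank_pow_of_mul_eq hg hNg a)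
  obtain ⟨π, hπ⟩ := exists_perm_of_rank_eq hr
  refine ⟨g.submatrix id π, ?_, ?_⟩
  · rw [Matrix.det_permute']
    exact (Units.isUnit _).map (Int.castRingHom F) |>.mul hg
  · have h1 : N * g.submatrix id π = (N * g).submatrix id π := rfl
    rw [h1, hNg, ← hπ F]
    rw [Matrix.submatrix_mul_equiv]

/-- If the rank of a matrix over a local domain does not drop modulo the maximal ideal, then its
kernel commutes with reduction. -/
theorem exists_lift_mulVec_eq_zero {R K : Type*} [CommRing R] [IsLocalRing R] [Field K]
    (ι : R →+* K) (hι : Function.Injective ι) (T : Matrix (Fin n) (Fin n) R)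
    (hT : (T.map ι).rank ≤ (T.map (IsLocalRing.residue R)).rank)
    (v : Fin n → IsLocalRing.ResidueField R)
    (hv : (T.map (IsLocalRing.residue R)) *ᵥ v = 0) :
    ∃ w : Fin n → R, (∀ i, IsLocalRing.residue R (w i) = v i) ∧ T *ᵥ w = 0 := by
  obtain ⟨f, g, hfg⟩ := exists_det_submatrix_ne_zero (T.map (IsLocalRing.residue R))
  generalize (T.map (IsLocalRing.residue R)).rank = r at hT f g hfg
  have hdet : IsUnit (T.submatrix f g).det := by
    have h1 : ((T.map (IsLocalRing.residue R)).submatrix f g).det =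
        IsLocalRing.residue R (T.submatrix f g).det := by rw [RingHom.map_det]; rfl
    rw [h1] at hfg
    exact (IsLocalRing.residue_ne_zero_iff_isUnit _).1 hfg
  choose w₀ hw₀ using fun i => IsLocalRing.residue_surjective (v i)
  have hw₀' : ∀ i, IsLocalRing.residue R ((T *ᵥ w₀) i) = 0 := fun i => by
    rw [RingHom.map_mulVec]
    have : IsLocalRing.residue R ∘ w₀ = v := funext hw₀
    rw [this, hv, Pi.zero_apply]
  -- An arbitrary lift `w₀` solves the equation modulo the maximal ideal. Cramer's rule on the unit
  -- minor corrects it so that the chosen rows vanish exactly, and the correction has zero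
  -- reduction.
  let c : Fin r → R := (T.submatrix f g)⁻¹ *ᵥ fun a => (T *ᵥ w₀) (f a)
  have hc : ∀ b, IsLocalRing.residue R (c b) = 0 := fun b => by
    simp only [c, Matrix.mulVec, dotProduct, map_sum, map_mul]
    refine Finset.sum_eq_zero fun a _ => ?_
    have := hw₀' (f a)
    simp only [Matrix.mulVec, dotProduct, map_sum, map_mul] at this
    rw [this, mul_zero]
  let u : Fin n → R := fun i => ∑ b, if g b = i then c b else 0
  have hu : ∀ i, (T *ᵥ u) i = ∑ b, T i (g b) * c b := fun i => by
    simp only [u, Matrix.mulVec, dotProduct, Finset.mul_sum]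
    rw [Finset.sum_comm]
    refine Finset.sum_congr rfl fun b _ => ?_
    rw [Finset.sum_eq_single (g b)] <;> simp +contextual [eq_comm]
  have hw : ∀ a, (T *ᵥ (w₀ - u)) (f a) = 0 := fun a => by
    rw [Matrix.mulVec_sub, Pi.sub_apply, hu, sub_eq_zero]
    have h1 : (T.submatrix f g) *ᵥ c = fun a => (T *ᵥ w₀) (f a) := by
      rw [Matrix.mulVec_mulVec, Matrix.mul_nonsing_inv _ hdet, Matrix.one_mulVec]
    exact (congrFun h1 a).symm
  refine ⟨w₀ - u, fun i => ?_, ?_⟩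
  · rw [Pi.sub_apply, map_sub, hw₀, map_sum, Finset.sum_eq_zero, sub_zero]
    intro b _
    split_ifs
    · exact hc b
    · simp
  · have hli : LinearIndependent K fun a => (T.map ι).row (f a) := by
      have h1 : IsUnit ((T.map ι).submatrix f g) := by
        rw [Matrix.isUnit_iff_isUnit_det]
        have : ((T.map ι).submatrix f g).det = ι (T.submatrix f g).det := by
          rw [RingHom.map_det]; rfl
        rw [this]
        exact hdet.map ι
      have h2 := Matrix.linearIndependent_rows_iff_isUnit.2 h1
      exact LinearIndependent.of_comp (LinearMap.funLeft K K g) h2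
    -- As the rank over `K` is at most the size of the minor, the chosen rows span all rows over
    -- `K`, and the remaining equations follow.
    have hspan : Submodule.span K (Set.range fun a => (T.map ι).row (f a)) =
        Submodule.span K (Set.range (T.map ι).row) := by
      refine Submodule.eq_of_le_of_finrank_le (Submodule.span_mono ?_) ?_
      · rintro _ ⟨a, rfl⟩
        exact ⟨f a, rfl⟩
      · rw [finrank_span_eq_card hli, ← Matrix.rank_eq_finrank_span_row, Fintype.card_fin]
        exact hT
    ext i
    apply hι
    have hi : (T.map ι).row i ∈ Submodule.span K (Set.range fun a => (T.map ι).row (f a)) := by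
      rw [hspan]
      exact Submodule.subset_span ⟨i, rfl⟩
    have h3 : Submodule.span K (Set.range fun a => (T.map ι).row (f a)) ≤
        LinearMap.ker (dotProductBilin K K |>.flip (ι ∘ (w₀ - u))) := by
      rw [Submodule.span_le]
      rintro _ ⟨a, rfl⟩
      have h5 := congrArg ι (hw a)
      rw [RingHom.map_mulVec, map_zero] at h5
      exact h5
    have h4 := h3 hi
    rw [LinearMap.mem_ker] at h4
    rw [RingHom.map_mulVec, Pi.zero_apply, map_zero]
    exact h4

/-- A nilpotent matrix over a local domain has Jordan form as soon as its powers have constant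
ranks. -/
theorem exists_mul_eq_of_isLocalRing {R K : Type u} [CommRing R] [IsLocalRing R] [Field K]
    (ι : R →+* K) (hι : Function.Injective ι) (σ : JordanType n)
    (N : Matrix (Fin n) (Fin n) R) (hK : ∀ a, ((N.map ι) ^ a).rank = σ.rank a)
    (hk : ∀ a, ((N.map (IsLocalRing.residue R)) ^ a).rank = σ.rank a) :
    ∃ g : Matrix (Fin n) (Fin n) R, IsUnit g.det ∧ N * g = g * σ.nilp R := by
  obtain ⟨g, hg, hNg⟩ := σ.exists_mul_eq_of_rank_eq _ hk
  have hpow : ∀ {S : Type u} [CommRing S] (φ : R →+* S) (a : ℕ), (N.map φ) ^ a = (N ^ a).map φ :=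
    fun φ a => (map_pow φ.mapMatrix N a).symm
  -- The cyclic generators of a Jordan basis of the reduction lift to vectors killed by the right
  -- powers of `N`. The matrix they generate reduces to `g`, so it is invertible.
  choose v hv hv0 using fun i => exists_lift_mulVec_eq_zero ι hι (N ^ σ.size i)
    (by rw [← hpow, ← hpow, hK, hk]) (g.col (σ.base i))
    (by rw [← hpow]; exact σ.size_pow_mulVec_col hNg i)
  refine ⟨σ.cyc N v, ?_, σ.mul_cyc N v hv0⟩
  rw [← IsLocalRing.residue_ne_zero_iff_isUnit, RingHom.map_det]
  have h1 : (IsLocalRing.residue R).mapMatrix (σ.cyc N v) = g := by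
    rw [σ.eq_cyc hNg]
    refine (σ.cyc_map _ _ _).trans ?_
    congr 1
    ext i j
    exact hv i j
  rw [h1]
  exact hg.ne_zero

end JordanType

/-! ### The power `(1 + N) ^ q` as a polynomial in a nilpotent matrix. -/

section PowerPolynomial

open Polynomial

/-- The value `N f(N)` of a polynomial without constant term at a square matrix. -/
def Matrix.aevalMul {n : ℕ} {R : Type*} [CommRing R] (f : ℤ[X]) (N : Matrix (Fin n) (Fin n) R) :
    Matrix (Fin n) (Fin n) R := N * aeval N f

variable {n : ℕ} {R : Type*} [CommRing R] (f : ℤ[X])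

theorem Matrix.commute_aeval (N : Matrix (Fin n) (Fin n) R) (g : ℤ[X]) :
    Commute N (aeval N g) := by
  have h := (Commute.all (X : ℤ[X]) g).map (aeval N)
  rwa [aeval_X] at h

theorem Matrix.aeval_map {S : Type*} [CommRing S] (φ : R →+* S) (N : Matrix (Fin n) (Fin n) R) :
    (aeval N f).map φ = aeval (N.map φ) f := by
  have h := Polynomial.hom_eval₂ f (algebraMap ℤ (Matrix (Fin n) (Fin n) R)) φ.mapMatrix N
  rw [Polynomial.aeval_def, Polynomial.aeval_def]
  refine h.trans ?_
  congr 1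
  exact RingHom.ext_int _ _

theorem Matrix.aevalMul_map {S : Type*} [CommRing S] (φ : R →+* S)
    (N : Matrix (Fin n) (Fin n) R) :
    (aevalMul f N).map φ = aevalMul f (N.map φ) := by
  rw [aevalMul, Matrix.map_mul, Matrix.aeval_map, aevalMul]

theorem Matrix.aevalMul_mul {N M X : Matrix (Fin n) (Fin n) R} (h : N * X = X * M) :
    aevalMul f N * X = X * aevalMul f M := by
  have h1 : aeval N f * X = X * aeval M f := by
    induction f using Polynomial.induction_on' with
    | add p q hp hq => rw [map_add, map_add, add_mul, mul_add, hp, hq]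
    | monomial a c =>
      rw [Polynomial.aeval_monomial, Polynomial.aeval_monomial, mul_assoc,
        JordanType.pow_mul_eq_of_mul_eq h, ← mul_assoc, ← mul_assoc, Algebra.commutes c X]
  rw [aevalMul, mul_assoc, h1, ← mul_assoc, h, mul_assoc, aevalMul]

/-- A unit scalar plus a commuting nilpotent matrix. -/
theorem Matrix.isUnit_aeval {N : Matrix (Fin n) (Fin n) R} (hN : IsNilpotent N)
    (hf : IsUnit ((f.coeff 0 : ℤ) : R)) : IsUnit (aeval N f) := by
  have h1 : aeval N f = N * aeval N f.divX + algebraMap R _ ((f.coeff 0 : ℤ) : R) := by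
    conv_lhs => rw [← Polynomial.divX_mul_X_add f, map_add, map_mul, aeval_X, aeval_C,
      ← (Matrix.commute_aeval N _).eq]
    simp
  rw [h1]
  have h2 : IsNilpotent (N * aeval N f.divX) := (Matrix.commute_aeval N _).isNilpotent_mul_right hN
  exact h2.isUnit_add_right_of_commute (hf.map (algebraMap R _)) (Algebra.commutes _ _).symm

/-- A polynomial `f` with constant term `q` such that `(1 + N) ^ q = 1 + N f(N)` for every
nilpotent `n × n` matrix `N`. -/
def zpowPoly (n : ℕ) : ℤ → ℤ[X]
  | Int.ofNat m => ((1 + X) ^ m : ℤ[X]).divX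
  -- The truncated geometric series inverts `1 + X` modulo `X ^ (n + 2)`. At least two terms are
  -- needed, also for `n = 0`, so that the coefficient of `X` in the power, which becomes the
  -- constant term here, is correct.
  | Int.negSucc m => ((∑ k ∈ Finset.range (n + 2), (-X) ^ k : ℤ[X]) ^ (m + 1)).divX

theorem coeff_one_pow_of_coeff_zero_eq_one {p : ℤ[X]} (h : p.coeff 0 = 1) (m : ℕ) :
    (p ^ m).coeff 0 = 1 ∧ (p ^ m).coeff 1 = m * p.coeff 1 := by
  induction m with
  | zero => simp [Polynomial.coeff_one]
  | succ m ih =>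
    rw [pow_succ, mul_coeff_zero, ih.1, h, mul_coeff_one, ih.1, ih.2, h]
    refine ⟨rfl, ?_⟩
    push_cast
    ring

theorem coeff_sum_neg_X_pow (m j : ℕ) (h : j < m) :
    (∑ k ∈ Finset.range m, (-X) ^ k : ℤ[X]).coeff j = (-1) ^ j := by
  rw [Polynomial.finsetSum_coeff, Finset.sum_eq_single j]
  · rw [neg_pow, ← C_1, ← C_neg, ← C_pow, coeff_C_mul, coeff_X_pow_self, mul_one]
  · intro k _ hk
    rw [neg_pow, ← C_1, ← C_neg, ← C_pow, coeff_C_mul, coeff_X_pow, if_neg hk.symm, mul_zero]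
  · simp [h]

theorem coeff_zero_zpowPoly (n : ℕ) (q : ℤ) : (zpowPoly n q).coeff 0 = q := by
  rcases q with m | m
  · rw [zpowPoly, coeff_divX, zero_add, (coeff_one_pow_of_coeff_zero_eq_one _ m).2]
    · simp [Polynomial.coeff_one]
    · simp
  · rw [zpowPoly, coeff_divX, zero_add, (coeff_one_pow_of_coeff_zero_eq_one _ _).2,
      coeff_sum_neg_X_pow _ _ (by omega)]
    · rw [Int.negSucc_eq]
      push_cast
      ring
    · rw [coeff_sum_neg_X_pow _ _ (by omega), pow_zero]

theorem one_add_aevalMul_divX {p : ℤ[X]} (h : p.coeff 0 = 1) (N : Matrix (Fin n) (Fin n) R) :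
    1 + Matrix.aevalMul p.divX N = aeval N p := by
  conv_rhs => rw [← Polynomial.divX_mul_X_add p, map_add, map_mul, aeval_X, aeval_C, h,
      ← (Matrix.commute_aeval N _).eq, map_one, add_comm]
  rfl

theorem one_add_zpow_eq {N : Matrix (Fin n) (Fin n) R} (hN : N ^ n = 0) (q : ℤ) :
    (1 + N) ^ q = 1 + Matrix.aevalMul (zpowPoly n q) N := by
  rcases q with m | m
  · rw [zpowPoly, one_add_aevalMul_divX (coeff_one_pow_of_coeff_zero_eq_one (by simp) m).1]
    simp [zpow_natCast]
  · rw [zpowPoly, one_add_aevalMul_divX (coeff_one_pow_of_coeff_zero_eq_one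
      (coeff_sum_neg_X_pow _ _ (by omega)) _).1, map_pow]
    have h1 : (1 + N) * aeval N (∑ k ∈ Finset.range (n + 2), (-X) ^ k : ℤ[X]) = 1 := by
      rw [map_sum]
      simp only [map_pow, map_neg, aeval_X]
      have h2 := mul_neg_geom_sum (-N) (n + 2)
      rw [sub_neg_eq_add, neg_pow, pow_add N, hN, zero_mul, mul_zero, sub_zero] at h2
      exact h2
    rw [zpow_negSucc, ← Matrix.inv_pow', Matrix.inv_eq_right_inv h1]

end PowerPolynomial

/-! ### Pairs with unipotent second matrix, in additive form. -/

section Unipotent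

open Polynomial

variable {n : ℕ} {R : Type*} [CommRing R]

/-- Over a general ring, nilpotency determines the characteristic polynomial only up to nilpotents;
so it is computed over ℤ and mapped to `R`. -/
theorem JordanType.charpoly_one_add_nilp (σ : JordanType n) :
    (1 + σ.nilp R).charpoly = (X - 1) ^ n := by
  have h1 : (σ.nilp ℤ).charpoly = X ^ n := by
    have h := Matrix.isNilpotent_charpoly_sub_pow_of_isNilpotent (M := σ.nilp ℤ)
      ⟨n, σ.nilp_pow_eq_zero⟩
    rw [isNilpotent_iff_eq_zero, sub_eq_zero, Fintype.card_fin] at h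
    exact h
  have h2 := congrArg (Polynomial.map (Int.castRingHom R)) h1
  rw [← Matrix.charpoly_map, σ.nilp_map, Polynomial.map_pow, map_X] at h2
  have h3 := Matrix.charpoly_sub_scalar (σ.nilp R) (-1)
  rw [h2, map_neg, map_one, sub_neg_eq_add, add_comm] at h3
  rw [h3]
  simp [sub_eq_add_neg]

theorem Matrix.charpoly_eq_of_mul_eq {S T g : Matrix (Fin n) (Fin n) R} (hg : IsUnit g.det)
    (h : S * g = g * T) : S.charpoly = T.charpoly := by
  obtain ⟨u, rfl⟩ := (Matrix.isUnit_iff_isUnit_det g).2 hg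
  have h1 : S = u.val * T * u⁻¹.val := by
    rw [← h, mul_assoc, Units.mul_inv, mul_one]
  rw [h1, Matrix.coe_units_inv, Matrix.charpoly_units_conj]

theorem Matrix.sub_one_pow_eq_zero {S : Matrix (Fin n) (Fin n) R}
    (h : S.charpoly = (X - 1) ^ n) : (S - 1) ^ n = 0 := by
  have h1 := Matrix.aeval_self_charpoly S
  rw [h] at h1
  simpa using h1

end Unipotent

section Pairs

variable {O : Type*} [CommRing O] {n : ℕ} {q : ℤ} {R : Type*} [CommRing R] [Algebra O R]

theorem Matrix.conj_eq_iff {P S T : Matrix (Fin n) (Fin n) R} (hP : IsUnit P.det) :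
    P * S * P⁻¹ = T ↔ P * S = T * P := by
  constructor
  · rintro rfl
    rw [Matrix.mul_assoc, Matrix.nonsing_inv_mul _ hP, Matrix.mul_one]
  · intro h
    rw [h, Matrix.mul_assoc, Matrix.mul_nonsing_inv _ hP, Matrix.mul_one]

theorem IsModuliPair.sub_one_pow {P S : Matrix (Fin n) (Fin n) R}
    (h : IsModuliPair (fun _ : Fin n => (1 : Oˣ)) q P S) : (S - 1) ^ n = 0 := by
  refine Matrix.sub_one_pow_eq_zero ?_
  rw [h.charpoly_eq]
  simp

/-- Subtracting the identity on both sides leaves a relation that is linear in `P`, which allows the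
first matrix to be parametrised once the second is in Jordan form. -/
theorem IsModuliPair.mul_sub_one {P S : Matrix (Fin n) (Fin n) R}
    (h : IsModuliPair (fun _ : Fin n => (1 : Oˣ)) q P S) :
    P * (S - 1) = Matrix.aevalMul (zpowPoly n q) (S - 1) * P := by
  have h1 := (Matrix.conj_eq_iff h.isUnit_det).1 h.conj_eq
  have h2 := one_add_zpow_eq h.sub_one_pow q
  rw [add_sub_cancel] at h2
  rw [h2] at h1
  rw [mul_sub, h1, add_mul]
  simp

theorem isModuliPair_of_mul_eq (σ : JordanType n) {P S g : Matrix (Fin n) (Fin n) R}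
    (hP : IsUnit P.det) (hg : IsUnit g.det) (hS : (S - 1) * g = g * σ.nilp R)
    (h : P * (S - 1) = Matrix.aevalMul (zpowPoly n q) (S - 1) * P) :
    IsModuliPair (fun _ : Fin n => (1 : Oˣ)) q P S := by
  have hc : S.charpoly = (Polynomial.X - 1) ^ n := by
    rw [← σ.charpoly_one_add_nilp]
    refine Matrix.charpoly_eq_of_mul_eq hg ?_
    rw [mul_add, ← hS, sub_mul]
    simp
  refine ⟨hP, ?_, ?_⟩
  · rw [hc]
    simp
  · rw [Matrix.conj_eq_iff hP]
    have h2 := one_add_zpow_eq (Matrix.sub_one_pow_eq_zero hc) q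
    rw [add_sub_cancel] at h2
    rw [h2, add_mul, ← h, mul_sub]
    simp

end Pairs

/-! ### An explicit invertible intertwiner and its eigenvalues. -/

section Triangular

open Polynomial

theorem Matrix.BlockTriangular.charpoly_eq_prod {m α R : Type*} [Fintype m] [DecidableEq m]
    [CommRing R] [LinearOrder α] {b : m → α} {M : Matrix m m R} (h : M.BlockTriangular b)
    (c : m → R)
    (hc : ∀ a, (M.toSquareBlock b a).charpoly = ∏ i : {i // b i = a}, (X - C (c i))) :
    M.charpoly = ∏ i, (X - C (c i)) := by
  rw [h.charpoly, ← Finset.prod_fiberwise_of_maps_to (g := b) (t := Finset.univ.image b)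
    (fun i _ => Finset.mem_image_of_mem b (Finset.mem_univ i))]
  refine Finset.prod_congr rfl fun a _ => ?_
  rw [hc]
  symm
  exact Finset.prod_subtype _ (by simp) _

namespace JordanType

variable {n : ℕ} (σ : JordanType n) {R : Type*} [CommRing R] (f : ℤ[X])

theorem commute_pow (N : Matrix (Fin n) (Fin n) R) (a : ℕ) :
    Matrix.aevalMul f N ^ a = N ^ a * aeval N (f ^ a) := by
  rw [Matrix.aevalMul, (Matrix.commute_aeval N f).mul_pow, map_pow]

theorem aevalMul_nilp_pow_mulVec_of_lt (a : ℕ) (w : Fin n → R) (i : Fin n) (h : σ.pos i < a) :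
    ((Matrix.aevalMul f (σ.nilp R) ^ a) *ᵥ w) i = 0 := by
  rw [commute_pow, ← Matrix.mulVec_mulVec, nilp_pow_mulVec_apply, if_neg (by omega)]

theorem aevalMul_nilp_pow_mulVec_of_eq (a : ℕ) (w : Fin n → R) (i : Fin n) (h : σ.pos i = a) :
    ((Matrix.aevalMul f (σ.nilp R) ^ a) *ᵥ w) i =
      (f.coeff 0 : R) ^ a * w (σ.base (σ.blk i)) := by
  have h0 : (f ^ a).coeff 0 = f.coeff 0 ^ a := by
    simp only [coeff_zero_eq_eval_zero, eval_pow]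
  have h1 : aeval (σ.nilp R) (f ^ a) = σ.nilp R * aeval (σ.nilp R) (f ^ a).divX +
      ((f.coeff 0 : R) ^ a) • 1 := by
    conv_lhs => rw [← Polynomial.divX_mul_X_add (f ^ a), map_add, map_mul, aeval_X, aeval_C,
      ← (Matrix.commute_aeval (σ.nilp R) _).eq, h0]
    rw [Algebra.smul_def, mul_one]
    simp
  rw [commute_pow, h1, mul_add, ← mul_assoc, ← pow_succ, Matrix.add_mulVec,
    ← Matrix.mulVec_mulVec, Pi.add_apply, nilp_pow_mulVec_apply, if_neg (by omega), zero_add,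
    mul_smul_comm, mul_one, Matrix.smul_mulVec, Pi.smul_apply, nilp_pow_mulVec_apply, if_pos h.ge,
    smul_eq_mul]
  congr 2
  simp [base, h]

/-- The matrix `aevalMul f nilp` raises positions by at least one, with leading coefficient `f.coeff
0`. Hence the intertwiner is triangular with respect to the position, and diagonal on each set of
basis vectors of equal position. These matrices serve as test points of the parameter space. -/
theorem charpoly_cyc_single (β : Fin σ.parts → R) :
    (σ.cyc (Matrix.aevalMul f (σ.nilp R)) fun i => Pi.single (σ.base i) (β i)).charpoly =
      ∏ j, (X - C ((f.coeff 0 : R) ^ σ.pos j * β (σ.blk j))) := by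
  refine Matrix.BlockTriangular.charpoly_eq_prod (b := fun j => OrderDual.toDual (σ.pos j)) ?_ _ ?_
  · intro i j hij
    exact σ.aevalMul_nilp_pow_mulVec_of_lt f _ _ _ hij
  · intro a
    rw [← Matrix.charpoly_diagonal]
    congr 1
    ext ⟨i, hi⟩ ⟨j, hj⟩
    have hij : σ.pos i = σ.pos j := congrArg OrderDual.ofDual (hi.trans hj.symm)
    rw [Matrix.toSquareBlock_def, Matrix.of_apply, cyc, Matrix.of_apply,
      σ.aevalMul_nilp_pow_mulVec_of_eq f _ _ _ hij, Matrix.diagonal_apply]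
    by_cases h : i = j
    · subst h
      simp
    · rw [Pi.single_apply, if_neg, if_neg, mul_zero]
      · simpa using h
      · intro h1
        have h2 := congrArg σ.blk h1
        simp only [blk_base] at h2
        exact h ((ext_iff' (σ := σ)).2 ⟨h2, hij⟩)

theorem isUnit_det_cyc_single (hf : IsUnit (f.coeff 0 : R)) (β : Fin σ.parts → R)
    (hβ : ∀ i, IsUnit (β i)) :
    IsUnit (σ.cyc (Matrix.aevalMul f (σ.nilp R)) fun i => Pi.single (σ.base i) (β i)).det := by
  rw [Matrix.det_eq_sign_charpoly_coeff, charpoly_cyc_single, coeff_zero_eq_eval_zero, eval_prod]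
  refine ((isUnit_one.neg).pow _).mul ?_
  refine Finset.prod_induction _ IsUnit (fun _ _ => IsUnit.mul) isUnit_one fun j _ => ?_
  rw [eval_sub, eval_X, eval_C, zero_sub]
  exact ((hf.pow _).mul (hβ _)).neg

end JordanType

end Triangular

/-! ### The parameter ring of a stratum. -/

namespace JordanType

open Polynomial

variable {n : ℕ} (σ : JordanType n) (f : ℤ[X])

section ParamRing

variable (O : Type*) [CommRing O]

/-- The polynomial ring in the entries of a matrix and of one vector for each block of `σ`. -/
abbrev ParamPoly : Type _ := MvPolynomial ((Fin n × Fin n) ⊕ (Fin σ.parts × Fin n)) O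

/-- The generic base change. -/
def polyG : Matrix (Fin n) (Fin n) (σ.ParamPoly O) :=
  Matrix.of fun i j => MvPolynomial.X (Sum.inl (i, j))

/-- Generic vectors such that the `i`-th one is killed by the `size i`-th power of `nilp`. -/
def polyW (i : Fin σ.parts) (j : Fin n) : σ.ParamPoly O :=
  -- The kernel of `nilp ^ size i` is a coordinate subspace: it consists of the vectors supported on
  -- those `j` which a shift by `size i` pushes out of their block.
  if σ.size (σ.blk j) ≤ σ.pos j + σ.size i then MvPolynomial.X (Sum.inr (i, j)) else 0

/-- The generic matrix intertwining `nilp` and `aevalMul f nilp`. -/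
def polyP : Matrix (Fin n) (Fin n) (σ.ParamPoly O) :=
  σ.cyc (Matrix.aevalMul f (σ.nilp _)) (σ.polyW O)

/-- The coordinate ring of the space of pairs `(g, P)` of invertible matrices such that
`P * nilp = aevalMul f nilp * P`. -/
abbrev ParamRing : Type _ := Localization.Away ((σ.polyG O).det * (σ.polyP f O).det)

/-- The universal base change. -/
def paramG : Matrix (Fin n) (Fin n) (σ.ParamRing f O) :=
  (σ.polyG O).map (algebraMap (σ.ParamPoly O) (σ.ParamRing f O))

/-- The universal intertwining matrix. -/
def paramP : Matrix (Fin n) (Fin n) (σ.ParamRing f O) :=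
  (σ.polyP f O).map (algebraMap (σ.ParamPoly O) (σ.ParamRing f O))

variable {O}

theorem isUnit_det_paramG : IsUnit (σ.paramG f O).det := by
  have h := IsLocalization.Away.algebraMap_isUnit (S := σ.ParamRing f O)
    ((σ.polyG O).det * (σ.polyP f O).det)
  rw [map_mul, RingHom.map_det] at h
  exact isUnit_of_mul_isUnit_left h

theorem isUnit_det_paramP : IsUnit (σ.paramP f O).det := by
  have h := IsLocalization.Away.algebraMap_isUnit (S := σ.ParamRing f O)
    ((σ.polyG O).det * (σ.polyP f O).det)
  rw [map_mul, RingHom.map_det, RingHom.map_det] at h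
  exact isUnit_of_mul_isUnit_right h

theorem nilp_pow_mulVec_polyW (i : Fin σ.parts) :
    (σ.nilp (σ.ParamPoly O) ^ σ.size i) *ᵥ σ.polyW O i = 0 := by
  ext j
  rw [nilp_pow_mulVec_apply]
  split_ifs with h
  · rw [polyW, blk_vec, pos_vec, if_neg]
    · rfl
    · have := σ.pos_lt j
      omega
  · rfl

theorem polyP_mul_nilp :
    σ.polyP f O * σ.nilp _ = Matrix.aevalMul f (σ.nilp _) * σ.polyP f O := by
  refine (σ.mul_cyc _ _ fun i => ?_).symm
  rw [commute_pow, ((Matrix.commute_aeval _ _).pow_left _).eq, ← Matrix.mulVec_mulVec,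
    nilp_pow_mulVec_polyW, Matrix.mulVec_zero]

theorem paramP_mul_nilp :
    σ.paramP f O * σ.nilp _ = Matrix.aevalMul f (σ.nilp _) * σ.paramP f O := by
  have h := congrArg (fun M => Matrix.map M (algebraMap (σ.ParamPoly O) (σ.ParamRing f O)))
    (σ.polyP_mul_nilp f (O := O))
  simp only [Matrix.map_mul, Matrix.aevalMul_map, nilp_map] at h
  exact h

variable {R : Type*} [CommRing R] [Algebra O R]

theorem exists_paramRing_algHom_of_isUnit (g : Matrix (Fin n) (Fin n) R)
    (w : Fin σ.parts → Fin n → R)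
    (hw : ∀ i j, ¬ σ.size (σ.blk j) ≤ σ.pos j + σ.size i → w i j = 0) (hg : IsUnit g.det)
    (hP : IsUnit (σ.cyc (Matrix.aevalMul f (σ.nilp R)) w).det) :
    ∃ y : σ.ParamRing f O →ₐ[O] R, (σ.paramG f O).map y = g ∧
      (σ.paramP f O).map y = σ.cyc (Matrix.aevalMul f (σ.nilp R)) w := by
  let y₀ : σ.ParamPoly O →ₐ[O] R :=
    MvPolynomial.aeval (Sum.elim (fun ij => g ij.1 ij.2) (fun ij => w ij.1 ij.2))
  have yG : (σ.polyG O).map y₀ = g := by ext i j; simp [polyG, y₀]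
  have yW : ∀ i, (y₀ : σ.ParamPoly O →+* R) ∘ σ.polyW O i = w i := by
    intro i
    ext j
    rw [Function.comp_apply, polyW]
    split_ifs with h
    · simp [y₀]
    · rw [map_zero, hw i j h]
  have yP : (σ.polyP f O).map y₀ = σ.cyc (Matrix.aevalMul f (σ.nilp R)) w := by
    have h := σ.cyc_map (y₀ : σ.ParamPoly O →+* R) (Matrix.aevalMul f (σ.nilp _)) (σ.polyW O)
    rw [Matrix.aevalMul_map, nilp_map] at h
    simp only [yW] at h
    exact h
  have hu : IsUnit (y₀ ((σ.polyG O).det * (σ.polyP f O).det)) := by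
    rw [map_mul, AlgHom.map_det, AlgHom.map_det]
    change IsUnit (((σ.polyG O).map y₀).det * ((σ.polyP f O).map y₀).det)
    rw [yG, yP]
    exact hg.mul hP
  let y : σ.ParamRing f O →ₐ[O] R := IsLocalization.liftAlgHom
    (M := Submonoid.powers ((σ.polyG O).det * (σ.polyP f O).det)) (f := y₀) (by
      rintro ⟨_, m, rfl⟩
      rw [map_pow]
      exact hu.pow m)
  have hy : ∀ x, y (algebraMap _ _ x) = y₀ x := fun x => IsLocalization.lift_eq _ x
  refine ⟨y, ?_, ?_⟩
  · rw [← yG]; ext i j; simp [paramG, hy]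
  · rw [← yP]; ext i j; simp [paramP, hy]

/-- The first columns of `P` in each block are killed by `(N f(N)) ^ size i`. Since `f.coeff 0` is a
unit, `f(N)` is invertible and can be cancelled, so these columns satisfy the coordinate conditions
imposed on `polyW`. -/
theorem exists_paramRing_algHom (hf : IsUnit (f.coeff 0 : R)) (g P : Matrix (Fin n) (Fin n) R)
    (hg : IsUnit g.det) (hP : IsUnit P.det)
    (h : P * σ.nilp R = Matrix.aevalMul f (σ.nilp R) * P) :
    ∃ y : σ.ParamRing f O →ₐ[O] R, (σ.paramG f O).map y = g ∧ (σ.paramP f O).map y = P := by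
  have h1 := σ.eq_cyc h.symm
  have hw : ∀ i, (σ.nilp R ^ σ.size i) *ᵥ P.col (σ.base i) = 0 := fun i => by
    have h2 := σ.size_pow_mulVec_col h.symm i
    rw [commute_pow, ((Matrix.commute_aeval _ _).pow_left _).eq, ← Matrix.mulVec_mulVec] at h2
    have h3 : IsUnit (aeval (σ.nilp R) (f ^ σ.size i)) := by
      rw [map_pow]
      exact (Matrix.isUnit_aeval f ⟨n, σ.nilp_pow_eq_zero⟩ hf).pow _
    exact (Matrix.mulVec_injective_of_isUnit h3) (h2.trans (Matrix.mulVec_zero _).symm)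
  rw [h1] at hP
  have hw' : ∀ i j, ¬ σ.size (σ.blk j) ≤ σ.pos j + σ.size i → P.col (σ.base i) j = 0 := by
    intro i j hij
    have h2 := congrFun (hw i) (σ.vec (σ.blk j) (σ.pos j + σ.size i) (by omega))
    rw [nilp_pow_mulVec_apply, if_pos (by rw [pos_vec]; omega)] at h2
    simpa using h2
  obtain ⟨y, hy1, hy2⟩ := σ.exists_paramRing_algHom_of_isUnit (O := O) f g _ hw' hg hP
  exact ⟨y, hy1, hy2.trans h1.symm⟩

theorem exists_paramRing_algHom_single (hf : IsUnit (f.coeff 0 : R)) (β : Fin σ.parts → R)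
    (hβ : ∀ i, IsUnit (β i)) : ∃ y : σ.ParamRing f O →ₐ[O] R, (σ.paramG f O).map y = 1 ∧
      (σ.paramP f O).map y =
        σ.cyc (Matrix.aevalMul f (σ.nilp R)) fun i => Pi.single (σ.base i) (β i) := by
  refine σ.exists_paramRing_algHom_of_isUnit (O := O) f 1 _ ?_ (by simp)
    (σ.isUnit_det_cyc_single f hf β hβ)
  intro i j hij
  rw [Pi.single_apply, if_neg]
  rintro rfl
  simp at hij

/-- The localization has an `O`-valued point, at which the image of the denominator is a unit. -/
theorem den_ne_zero [Nontrivial O] (hf : IsUnit (f.coeff 0 : O)) :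
    (σ.polyG O).det * (σ.polyP f O).det ≠ 0 := by
  intro h0
  obtain ⟨y, -, -⟩ := σ.exists_paramRing_algHom_single (O := O) (R := O) f hf (fun _ => 1)
    fun _ => isUnit_one
  have h := IsLocalization.Away.algebraMap_isUnit (S := σ.ParamRing f O)
    ((σ.polyG O).det * (σ.polyP f O).det)
  have h1 := h.map y
  rw [(congrArg _ h0).trans (map_zero (algebraMap (σ.ParamPoly O) (σ.ParamRing f O))), map_zero]
    at h1
  exact not_isUnit_zero h1

theorem isDomain_paramRing [IsDomain O] (hf : IsUnit (f.coeff 0 : O)) :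
    IsDomain (σ.ParamRing f O) :=
  IsLocalization.isDomain_localization (powers_le_nonZeroDivisors_of_noZeroDivisors
    (σ.den_ne_zero f hf))

theorem algebraMap_paramRing_injective [IsDomain O] (hf : IsUnit (f.coeff 0 : O)) :
    Function.Injective (algebraMap (σ.ParamPoly O) (σ.ParamRing f O)) :=
  IsLocalization.injective (M := Submonoid.powers ((σ.polyG O).det * (σ.polyP f O).det)) _
    (powers_le_nonZeroDivisors_of_noZeroDivisors (σ.den_ne_zero f hf))

/-- In the polynomial ring `w` is prime, and the denominator is not divisible by `w` because the
localization has a point over `O ⧸ (w)`. -/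
theorem prime_algebraMap_paramRing [IsDomain O] {w : O} (hw : Prime w)
    (hf : IsUnit (f.coeff 0 : O)) : Prime (algebraMap O (σ.ParamRing f O) w) := by
  have : (Ideal.span {w}).IsPrime := (Ideal.span_singleton_prime hw.ne_zero).2 hw
  have hC : Prime (MvPolynomial.C w : σ.ParamPoly O) := (MvPolynomial.prime_C_iff _).2 hw
  obtain ⟨y, -, -⟩ := σ.exists_paramRing_algHom_single (O := O) (R := O ⧸ Ideal.span {w}) f
    (by simpa using hf.map (algebraMap O (O ⧸ Ideal.span {w}))) (fun _ => 1) fun _ => isUnit_one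
  have hp := (Ideal.span_singleton_prime hC.ne_zero).2 hC
  have hd : Disjoint (Submonoid.powers ((σ.polyG O).det * (σ.polyP f O).det) :
      Set (σ.ParamPoly O)) (Ideal.span {(MvPolynomial.C w : σ.ParamPoly O)}) := by
    rw [Set.disjoint_left]
    intro x hx1 hx2
    obtain ⟨z, rfl⟩ := Ideal.mem_span_singleton.1 hx2
    have h1 : IsUnit (algebraMap _ (σ.ParamRing f O) (MvPolynomial.C w * z)) :=
      IsLocalization.map_units (σ.ParamRing f O) (⟨_, hx1⟩ : Submonoid.powers _)
    have h2 := h1.map y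
    rw [map_mul, map_mul, ← MvPolynomial.algebraMap_eq, ← IsScalarTower.algebraMap_apply,
      AlgHom.commutes, Ideal.Quotient.algebraMap_eq, Ideal.Quotient.eq_zero_iff_mem.2
      (Ideal.mem_span_singleton_self w), zero_mul] at h2
    exact not_isUnit_zero h2
  have h3 := IsLocalization.isPrime_of_isPrime_disjoint _ (σ.ParamRing f O) _ hp hd
  rw [Ideal.map_span, Set.image_singleton] at h3
  have hinj := σ.algebraMap_paramRing_injective f hf
  rw [IsScalarTower.algebraMap_apply O (σ.ParamPoly O)]
  rw [← Ideal.span_singleton_prime]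
  · exact h3
  · intro h0
    exact hC.ne_zero (hinj (h0.trans (map_zero _).symm))

end ParamRing

end JordanType

/-! ### Passing from parameters to pairs and back. -/

section ModuliMaps

variable {O : Type*} [CommRing O] {n : ℕ} {α : Fin n → Oˣ} {q : ℤ}
  {R : Type*} [CommRing R] [Algebra O R] {T : Type*} [CommRing T] [Algebra O T]

theorem IsModuliPair.map {P S : Matrix (Fin n) (Fin n) R} (h : IsModuliPair α q P S)
    (y : R →ₐ[O] T) : IsModuliPair α q (P.map y) (S.map y) := by
  have hS : (S ^ q).map y = S.map y ^ q := matrix_map_zpow (y : R →+* T) h.isUnit_det_right q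
  refine ⟨?_, ?_, ?_⟩
  · have h1 := h.isUnit_det.map y
    rwa [AlgHom.map_det] at h1
  · have h1 := Matrix.charpoly_map S (y : R →+* T)
    rw [h.charpoly_eq, Polynomial.map_prod] at h1
    simpa using h1
  · have h1 := h.isUnit_det.map y
    rw [AlgHom.map_det] at h1
    change IsUnit (P.map y).det at h1
    rw [← hS, ← h.conj_eq, Matrix.conj_eq_iff h1]
    have h2 : P * S * P⁻¹ * P = P * S := by
      rw [Matrix.mul_assoc, Matrix.nonsing_inv_mul _ h.isUnit_det, Matrix.mul_one]
    have h3 := congrArg (fun M => Matrix.map M (y : R →+* T)) h2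
    have hm : ∀ A B : Matrix (Fin n) (Fin n) R, (A * B).map (y : R →+* T) =
        A.map (y : R →+* T) * B.map (y : R →+* T) := fun A B => Matrix.map_mul
    simp only [hm _ P, hm P S] at h3
    exact h3.symm

theorem ModuliRing.algHom_ext {x y : ModuliRing α q →ₐ[O] R}
    (h1 : (univΦ α q).map x = (univΦ α q).map y) (h2 : (univS α q).map x = (univS α q).map y) :
    x = y :=
  (existsUnique_moduliRing_lift ((isModuliPair_univ α q).map y)).unique ⟨h1, h2⟩ ⟨rfl, rfl⟩

end ModuliMaps

namespace JordanType

open Polynomial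

variable {n : ℕ} (σ : JordanType n) (f : ℤ[X]) (O : Type*) [CommRing O]

/-- The first matrix of the pair over the parameter ring. -/
def paramΦ : Matrix (Fin n) (Fin n) (σ.ParamRing f O) :=
  σ.paramG f O * σ.paramP f O * (σ.paramG f O)⁻¹

/-- The second matrix of the pair over the parameter ring. -/
def paramS : Matrix (Fin n) (Fin n) (σ.ParamRing f O) :=
  1 + σ.paramG f O * σ.nilp _ * (σ.paramG f O)⁻¹

variable {O}

theorem isUnit_det_paramΦ : IsUnit (σ.paramΦ f O).det := by
  rw [paramΦ, Matrix.det_mul, Matrix.det_mul]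
  exact ((σ.isUnit_det_paramG f).mul (σ.isUnit_det_paramP f)).mul
    (Matrix.isUnit_nonsing_inv_det _ (σ.isUnit_det_paramG f))

theorem paramS_sub_one_mul :
    (σ.paramS f O - 1) * σ.paramG f O = σ.paramG f O * σ.nilp _ := by
  rw [paramS, add_sub_cancel_left, Matrix.mul_assoc, Matrix.nonsing_inv_mul _
    (σ.isUnit_det_paramG f), Matrix.mul_one]

theorem paramΦ_mul : σ.paramΦ f O * σ.paramG f O = σ.paramG f O * σ.paramP f O := by
  rw [paramΦ, Matrix.mul_assoc, Matrix.nonsing_inv_mul _ (σ.isUnit_det_paramG f), Matrix.mul_one]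

theorem _root_.Matrix.map_sub_one {R T : Type*} [CommRing R] [CommRing T] (y : R →+* T)
    (A : Matrix (Fin n) (Fin n) R) : (A - 1).map y = A.map y - 1 := by
  rw [Matrix.map_sub _ (map_sub y), Matrix.map_one _ y.map_zero y.map_one]

theorem _root_.Matrix.mul_right_cancel_of_isUnit_det {R : Type*} [CommRing R]
    {A B g : Matrix (Fin n) (Fin n) R} (hg : IsUnit g.det) (h : A * g = B * g) : A = B := by
  have h1 := congrArg (fun M => M * g⁻¹) h
  simpa [Matrix.mul_assoc, Matrix.mul_nonsing_inv _ hg] using h1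

theorem paramΦ_mul_paramS_sub_one :
    σ.paramΦ f O * (σ.paramS f O - 1) = Matrix.aevalMul f (σ.paramS f O - 1) * σ.paramΦ f O := by
  apply Matrix.mul_right_cancel_of_isUnit_det (σ.isUnit_det_paramG f)
  rw [Matrix.mul_assoc, paramS_sub_one_mul, ← Matrix.mul_assoc, paramΦ_mul, Matrix.mul_assoc,
    paramP_mul_nilp, Matrix.mul_assoc, paramΦ_mul, ← Matrix.mul_assoc, ← Matrix.mul_assoc,
    Matrix.aevalMul_mul f (σ.paramS_sub_one_mul f)]

variable {R : Type*} [CommRing R] [Algebra O R]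

theorem exists_paramRing_algHom_eq (hf : IsUnit (f.coeff 0 : R))
    {P S g : Matrix (Fin n) (Fin n) R} (hP : IsUnit P.det)
    (h : P * (S - 1) = Matrix.aevalMul f (S - 1) * P) (hg : IsUnit g.det)
    (hS : (S - 1) * g = g * σ.nilp R) :
    ∃ y : σ.ParamRing f O →ₐ[O] R, (σ.paramΦ f O).map y = P ∧ (σ.paramS f O).map y = S := by
  have hgg := Matrix.mul_nonsing_inv _ hg
  have hgg' := Matrix.nonsing_inv_mul _ hg
  have h2 : g * (g⁻¹ * P * g * σ.nilp R) = g * (Matrix.aevalMul f (σ.nilp R) * (g⁻¹ * P * g)) :=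
    calc g * (g⁻¹ * P * g * σ.nilp R) = (g * g⁻¹) * P * (g * σ.nilp R) := by noncomm_ring
    _ = P * (S - 1) * g := by rw [hgg, ← hS, Matrix.one_mul, Matrix.mul_assoc]
    _ = Matrix.aevalMul f (S - 1) * (g * g⁻¹) * (P * g) := by
      rw [h, hgg, Matrix.mul_one, Matrix.mul_assoc]
    _ = Matrix.aevalMul f (S - 1) * g * (g⁻¹ * P * g) := by noncomm_ring
    _ = _ := by rw [Matrix.aevalMul_mul f hS]; noncomm_ring
  have h3 : g⁻¹ * P * g * σ.nilp R = Matrix.aevalMul f (σ.nilp R) * (g⁻¹ * P * g) := by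
    have := congrArg (fun M => g⁻¹ * M) h2
    simpa only [← Matrix.mul_assoc, hgg', Matrix.one_mul] using this
  obtain ⟨y, hy1, hy2⟩ := σ.exists_paramRing_algHom (O := O) f hf g (g⁻¹ * P * g) hg (by
    rw [Matrix.det_mul, Matrix.det_mul]
    exact ((Matrix.isUnit_nonsing_inv_det _ hg).mul hP).mul hg) h3
  have hmap : ∀ A B : Matrix (Fin n) (Fin n) (σ.ParamRing f O), (A * B).map y = A.map y * B.map y :=
    fun A B => Matrix.map_mul (f := (y : σ.ParamRing f O →+* R))
  have hnil : (σ.nilp (σ.ParamRing f O)).map y = σ.nilp R := σ.nilp_map (y : σ.ParamRing f O →+* R)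
  refine ⟨y, ?_, ?_⟩
  · have h4 := congrArg (fun M => Matrix.map M y) (σ.paramΦ_mul f (O := O))
    simp only [hmap, hy1, hy2] at h4
    apply Matrix.mul_right_cancel_of_isUnit_det hg
    rw [h4, ← Matrix.mul_assoc, ← Matrix.mul_assoc, hgg, Matrix.one_mul]
  · have h4 := congrArg (fun M => Matrix.map M y) (σ.paramS_sub_one_mul f (O := O))
    have h5 : (σ.paramS f O - 1).map y = (σ.paramS f O).map y - 1 :=
      Matrix.map_sub_one (y : σ.ParamRing f O →+* R) _
    simp only [hmap, hy1, hnil, h5, ← hS] at h4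
    have h6 := Matrix.mul_right_cancel_of_isUnit_det hg h4
    exact sub_left_injective h6

end JordanType

/-! ### The strata and their generic points. -/

section UnipotentModuli

open JordanType

variable {n : ℕ} (σ : JordanType n) (q : ℤ) {O : Type u} [CommRing O]

/-- The coordinate ring of the moduli scheme of pairs with unipotent second matrix. -/
abbrev UnipotentRing (n : ℕ) (q : ℤ) (O : Type u) [CommRing O] : Type u :=
  ModuliRing (fun _ : Fin n => (1 : Oˣ)) q

namespace JordanType

theorem isModuliPair_param :
    IsModuliPair (fun _ : Fin n => (1 : Oˣ)) q (σ.paramΦ (zpowPoly n q) O)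
      (σ.paramS (zpowPoly n q) O) :=
  isModuliPair_of_mul_eq σ (σ.isUnit_det_paramΦ _) (σ.isUnit_det_paramG _)
    (σ.paramS_sub_one_mul _) (σ.paramΦ_mul_paramS_sub_one _)

variable (O) in
/-- The parametrisation of the stratum of pairs whose second matrix is unipotent of
shape `σ`. -/
def paramMap : UnipotentRing n q O →ₐ[O] σ.ParamRing (zpowPoly n q) O :=
  (existsUnique_moduliRing_lift (σ.isModuliPair_param q)).choose

theorem univΦ_map_paramMap :
    (univΦ (fun _ : Fin n => (1 : Oˣ)) q).map (σ.paramMap q O) = σ.paramΦ (zpowPoly n q) O :=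
  (existsUnique_moduliRing_lift (σ.isModuliPair_param q)).choose_spec.1.1

theorem univS_map_paramMap :
    (univS (fun _ : Fin n => (1 : Oˣ)) q).map (σ.paramMap q O) = σ.paramS (zpowPoly n q) O :=
  (existsUnique_moduliRing_lift (σ.isModuliPair_param q)).choose_spec.1.2

variable {R : Type*} [CommRing R] [Algebra O R] {q}

/-- The criterion is a Jordan basis over `R` itself. Over a field it is supplied by the ranks, over
a local domain by constancy of the ranks (`exists_mul_eq_of_isLocalRing`). -/
theorem exists_comp_paramMap_eq (hq : IsUnit (q : R)) (x : UnipotentRing n q O →ₐ[O] R)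
    {g : Matrix (Fin n) (Fin n) R} (hg : IsUnit g.det)
    (hS : ((univS _ q).map x - 1) * g = g * σ.nilp R) :
    ∃ y : σ.ParamRing (zpowPoly n q) O →ₐ[O] R, y.comp (σ.paramMap q O) = x := by
  have hx := (isModuliPair_univ (fun _ : Fin n => (1 : Oˣ)) q).map x
  obtain ⟨y, hy1, hy2⟩ := σ.exists_paramRing_algHom_eq (O := O) (zpowPoly n q)
    (by rwa [coeff_zero_zpowPoly]) hx.isUnit_det hx.mul_sub_one hg hS
  refine ⟨y, ModuliRing.algHom_ext ?_ ?_⟩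
  · rw [← hy1, ← univΦ_map_paramMap]
    rfl
  · rw [← hy2, ← univS_map_paramMap]
    rfl

theorem rank_univS_map_comp {F : Type*} [Field F] [Algebra O F]
    (y : σ.ParamRing (zpowPoly n q) O →ₐ[O] F) (a : ℕ) :
    (((univS _ q).map (y.comp (σ.paramMap q O)) - 1) ^ a).rank = σ.rank a := by
  have h1 := congrArg (fun M => Matrix.map M (y : _ →+* F))
    (σ.paramS_sub_one_mul (zpowPoly n q) (O := O))
  simp only [Matrix.map_mul, nilp_map] at h1
  have h5 : (σ.paramS (zpowPoly n q) O - 1).map (y : _ →+* F) =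
      (univS _ q).map (y.comp (σ.paramMap q O)) - 1 := by
    refine (Matrix.map_sub_one (y : σ.ParamRing (zpowPoly n q) O →+* F) _).trans ?_
    rw [← univS_map_paramMap]
    rfl
  rw [h5] at h1
  refine rank_pow_of_mul_eq σ ?_ h1 a
  have h2 := (σ.isUnit_det_paramG (zpowPoly n q) (O := O)).map y
  rwa [AlgHom.map_det] at h2

theorem exists_comp_paramMap_eq_of_rank {F : Type u} [Field F] [Algebra O F]
    (hq : IsUnit (q : F)) (x : UnipotentRing n q O →ₐ[O] F)
    (h : ∀ a, (((univS _ q).map x - 1) ^ a).rank = σ.rank a) :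
    ∃ y : σ.ParamRing (zpowPoly n q) O →ₐ[O] F, y.comp (σ.paramMap q O) = x := by
  obtain ⟨g, hg, hS⟩ := σ.exists_mul_eq_of_rank_eq _ h
  exact σ.exists_comp_paramMap_eq hq x hg hS

theorem exists_rank_univS_eq {F : Type u} [Field F] [Algebra O F]
    (x : UnipotentRing n q O →ₐ[O] F) :
    ∃ σ : JordanType n, ∀ a, (((univS _ q).map x - 1) ^ a).rank = σ.rank a := by
  obtain ⟨σ, g, hg, h⟩ := exists_jordanType ((univS _ q).map x - 1)
    ⟨n, ((isModuliPair_univ (fun _ : Fin n => (1 : Oˣ)) q).map x).sub_one_pow⟩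
  exact ⟨σ, rank_pow_of_mul_eq σ hg h⟩

variable (q)

variable (O) in
/-- The generic point of the stratum of shape `σ`. -/
def genericPrime : Ideal (UnipotentRing n q O) := RingHom.ker (σ.paramMap q O)

/-- The generic point of the fibre at `w` of the stratum of shape `σ`. -/
def specialPrime (w : O) : Ideal (UnipotentRing n q O) :=
  (Ideal.span {algebraMap O (σ.ParamRing (zpowPoly n q) O) w}).comap (σ.paramMap q O)

theorem genericPrime_le_specialPrime (w : O) : σ.genericPrime q O ≤ σ.specialPrime q w := by
  intro x hx
  rw [genericPrime, RingHom.mem_ker] at hx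
  rw [specialPrime, Ideal.mem_comap, hx]
  exact Ideal.zero_mem _

theorem algebraMap_mem_specialPrime (w : O) : algebraMap O _ w ∈ σ.specialPrime q w := by
  rw [specialPrime, Ideal.mem_comap, AlgHom.commutes]
  exact Ideal.mem_span_singleton_self _

variable {q}

theorem isPrime_genericPrime [IsDomain O] (hq : IsUnit (q : O)) :
    (σ.genericPrime q O).IsPrime := by
  have := σ.isDomain_paramRing (O := O) (zpowPoly n q) (by rwa [coeff_zero_zpowPoly])
  exact RingHom.ker_isPrime _

theorem isPrime_specialPrime [IsDomain O] (hq : IsUnit (q : O)) {w : O} (hw : Prime w) :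
    (σ.specialPrime q w).IsPrime := by
  have h := σ.prime_algebraMap_paramRing (O := O) (zpowPoly n q) hw (by rwa [coeff_zero_zpowPoly])
  have := (Ideal.span_singleton_prime h.ne_zero).2 h
  exact Ideal.comap_isPrime _ _

theorem genericPrime_le_ker {T : Type*} [CommRing T] [Algebra O T]
    (y : σ.ParamRing (zpowPoly n q) O →ₐ[O] T) :
    σ.genericPrime q O ≤ RingHom.ker (y.comp (σ.paramMap q O)) := by
  intro a ha
  rw [genericPrime, RingHom.mem_ker] at ha
  rw [RingHom.mem_ker, AlgHom.comp_apply, ha, map_zero]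

theorem specialPrime_le_ker {T : Type*} [CommRing T] [Algebra O T]
    (y : σ.ParamRing (zpowPoly n q) O →ₐ[O] T) {w : O} (hw : algebraMap O T w = 0) :
    σ.specialPrime q w ≤ RingHom.ker (y.comp (σ.paramMap q O)) := by
  intro a ha
  rw [specialPrime, Ideal.mem_comap, Ideal.mem_span_singleton] at ha
  obtain ⟨b, hb⟩ := ha
  rw [RingHom.mem_ker, AlgHom.comp_apply, hb, map_mul, AlgHom.commutes, hw, zero_mul]

/-- The point with values in the residue field at a prime ideal. -/
def _root_.Ideal.residuePoint {A : Type*} [CommRing A] [Algebra O A] (p : Ideal A) [p.IsPrime] :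
    A →ₐ[O] FractionRing (A ⧸ p) :=
  (IsScalarTower.toAlgHom O (A ⧸ p) (FractionRing (A ⧸ p))).comp (Ideal.Quotient.mkₐ O p)

theorem _root_.Ideal.ker_residuePoint {A : Type*} [CommRing A] [Algebra O A] (p : Ideal A)
    [p.IsPrime] : RingHom.ker (p.residuePoint (O := O)) = p := by
  ext a
  rw [RingHom.mem_ker, Ideal.residuePoint, AlgHom.comp_apply, IsScalarTower.coe_toAlgHom',
    Ideal.Quotient.mkₐ_eq_mk, FaithfulSMul.algebraMap_eq_zero_iff, Ideal.Quotient.eq_zero_iff_mem]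

/-- The strata cover the scheme: the point with values in the fraction field of the quotient by `p`
factors through the parametrisation for the Jordan type found there. If `w` vanishes at the point,
the factorization also kills the multiples of `w`. -/
theorem exists_genericPrime_le (hq : IsUnit (q : O)) (p : Ideal (UnipotentRing n q O))
    [p.IsPrime] : ∃ σ : JordanType n, σ.genericPrime q O ≤ p ∧
      ∀ w : O, algebraMap O _ w ∈ p → σ.specialPrime q w ≤ p := by
  obtain ⟨σ, hσ⟩ := exists_rank_univS_eq (p.residuePoint (O := O))
  obtain ⟨y, hy⟩ := σ.exists_comp_paramMap_eq_of_rank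
    (by simpa using hq.map (algebraMap O (FractionRing (UnipotentRing n q O ⧸ p)))) _ hσ
  rw [← Ideal.ker_residuePoint (O := O) p, ← hy]
  refine ⟨σ, σ.genericPrime_le_ker y, fun w hw => σ.specialPrime_le_ker y ?_⟩
  rwa [RingHom.mem_ker, AlgHom.commutes] at hw

end JordanType

end UnipotentModuli

/-! ### Eigenvalues of general intertwiners, and merging of Jordan blocks. -/

section CharpolyFactors

open Polynomial

theorem Matrix.exists_charpoly_eq_prod {ι F : Type*} [Fintype ι] [DecidableEq ι] [Field F]
    [IsAlgClosed F] (M : Matrix ι ι F) : ∃ γ : ι → F, M.charpoly = ∏ i, (X - C (γ i)) := by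
  have hs := IsAlgClosed.splits M.charpoly
  have hc : M.charpoly.roots.toList.length = Fintype.card ι := by
    rw [Multiset.length_toList, ← hs.natDegree_eq_card_roots, Matrix.charpoly_natDegree_eq_dim]
  let e := (Fintype.equivFin ι).trans (finCongr hc.symm)
  refine ⟨fun i => M.charpoly.roots.toList.get (e i), ?_⟩
  rw [Equiv.prod_comp e fun k => X - C (M.charpoly.roots.toList.get k), ← List.prod_ofFn]
  have h1 : List.ofFn (fun k => X - C (M.charpoly.roots.toList.get k)) =
      M.charpoly.roots.toList.map fun z => X - C z := by
    rw [← List.ofFn_get (l := M.charpoly.roots.toList), List.map_ofFn]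
    simp
  conv_lhs => rw [hs.eq_prod_roots_of_monic M.charpoly_monic]
  rw [h1, ← Multiset.prod_coe, ← Multiset.map_coe, Multiset.coe_toList]

theorem Matrix.charpoly_smul_eq_prod {ι F : Type*} [Fintype ι] [DecidableEq ι] [Field F]
    [Infinite F] {M : Matrix ι ι F} {γ : ι → F} (h : M.charpoly = ∏ i, (X - C (γ i))) {c : F}
    (hc : c ≠ 0) : (c • M).charpoly = ∏ i, (X - C (c * γ i)) := by
  refine Polynomial.funext fun t => ?_
  have h1 : scalar ι t - c • M = c • (scalar ι (t / c) - M) := by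
    rw [smul_sub, Matrix.scalar_apply, Matrix.scalar_apply, ← Matrix.diagonal_smul]
    congr 2
    ext
    simp [mul_div_cancel₀ _ hc]
  rw [Matrix.eval_charpoly, h1, Matrix.det_smul, ← Matrix.eval_charpoly, h, eval_prod, eval_prod,
    Fintype.card, ← Finset.prod_const, ← Finset.prod_mul_distrib]
  refine Finset.prod_congr rfl fun i _ => ?_
  simp only [eval_sub, eval_X, eval_C]
  field_simp

namespace JordanType

variable {n : ℕ} (σ : JordanType n) (f : ℤ[X])

/-- Order the basis by position and then by block size. The condition on `w` makes the matrix block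
triangular, with diagonal blocks `(f.coeff 0) ^ a • W s`, where `W s` records how the generators of
the blocks of size `s` map to each other. As `W s` does not involve the position `a`, its
eigenvalues can be attached to the blocks. -/
theorem exists_charpoly_cyc_eq {F : Type*} [Field F] [IsAlgClosed F]
    (hf : (f.coeff 0 : F) ≠ 0) (w : Fin σ.parts → Fin n → F)
    (hw : ∀ i j, ¬ σ.size (σ.blk j) ≤ σ.pos j + σ.size i → w i j = 0) :
    ∃ γ : Fin σ.parts → F, (σ.cyc (Matrix.aevalMul f (σ.nilp F)) w).charpoly =
      ∏ j, (X - C ((f.coeff 0 : F) ^ σ.pos j * γ (σ.blk j))) := by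
  have := IsAlgClosed.instInfinite (K := F)
  let W (s : ℕ) : Matrix {i // σ.size i = s} {i // σ.size i = s} F :=
    Matrix.of fun i j => w j (σ.base i)
  choose γ hγ using fun s => (W s).exists_charpoly_eq_prod
  refine ⟨fun i => γ (σ.size i) ⟨i, rfl⟩, ?_⟩
  refine Matrix.BlockTriangular.charpoly_eq_prod
    (b := fun j => toLex (OrderDual.toDual (σ.pos j), σ.size (σ.blk j))) ?_ _ ?_
  · intro i j hij
    rw [Prod.Lex.toLex_lt_toLex] at hij
    rcases hij with hij | ⟨hij, hs⟩
    · exact σ.aevalMul_nilp_pow_mulVec_of_lt f _ _ _ hij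
    · have hij' : σ.pos i = σ.pos j := (congrArg OrderDual.ofDual hij).symm
      rw [cyc, Matrix.of_apply, σ.aevalMul_nilp_pow_mulVec_of_eq f _ _ _ hij', hw, mul_zero]
      rw [blk_base, pos_base]
      dsimp only at hs
      omega
  · intro c
    obtain ⟨a, s, rfl⟩ : ∃ a s, c = toLex (OrderDual.toDual a, s) :=
      ⟨OrderDual.ofDual (ofLex c).1, (ofLex c).2, rfl⟩
    rcases isEmpty_or_nonempty
      {i // toLex (OrderDual.toDual (σ.pos i), σ.size (σ.blk i)) = toLex (OrderDual.toDual a, s)} with h | ⟨⟨j₀, hj₀⟩⟩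
    · rw [Matrix.charpoly_isEmpty, Finset.univ_eq_empty, Finset.prod_empty]
    · have hb : ∀ j, toLex (OrderDual.toDual (σ.pos j), σ.size (σ.blk j)) = toLex (OrderDual.toDual a, s) →
          σ.pos j = a ∧ σ.size (σ.blk j) = s := fun j hj =>
        ⟨congrArg (fun z => OrderDual.ofDual (ofLex z).1) hj,
          congrArg (fun z => (ofLex z).2) hj⟩
      have has : a < s := by
        rw [← (hb _ hj₀).1, ← (hb _ hj₀).2]
        exact σ.pos_lt _
      let e : {i // σ.size i = s} ≃
          {j // toLex (OrderDual.toDual (σ.pos j), σ.size (σ.blk j)) = toLex (OrderDual.toDual a, s)} :=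
        { toFun := fun i => ⟨σ.vec i a (by rw [i.2]; exact has), by
            rw [pos_vec, blk_vec, i.2]⟩
          invFun := fun j => ⟨σ.blk j, (hb _ j.2).2⟩
          left_inv := fun i => Subtype.ext (σ.blk_vec _ _ _)
          right_inv := fun j => Subtype.ext ((ext_iff' (σ := σ)).2
            ⟨σ.blk_vec _ _ _, (σ.pos_vec _ _ _).trans (hb _ j.2).1.symm⟩) }
      have h1 : (σ.cyc (Matrix.aevalMul f (σ.nilp F)) w).toSquareBlock
          (fun j => toLex (OrderDual.toDual (σ.pos j), σ.size (σ.blk j))) (toLex (OrderDual.toDual a, s)) =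
          Matrix.reindex e e ((f.coeff 0 : F) ^ a • W s) := by
        ext ⟨i, hi⟩ ⟨j, hj⟩
        rw [Matrix.toSquareBlock_def, Matrix.of_apply, cyc, Matrix.of_apply,
          σ.aevalMul_nilp_pow_mulVec_of_eq f _ _ _ ((hb i hi).1.trans (hb j hj).1.symm),
          (hb j hj).1]
        rfl
      rw [h1, Matrix.charpoly_reindex, Matrix.charpoly_smul_eq_prod (hγ s) (pow_ne_zero _ hf),
        ← Equiv.prod_comp e]
      refine Finset.prod_congr rfl fun i _ => ?_
      have h2 : ∀ k, k = i.1 → γ (σ.size k) ⟨k, rfl⟩ = γ s i := by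
        rintro k rfl
        obtain ⟨i, rfl⟩ := i
        rfl
      have h3 : σ.pos (e i) = a := σ.pos_vec _ _ _
      beta_reduce
      rw [h3, h2 (σ.blk (e i)) (σ.blk_vec _ _ _)]

theorem sum_tsub_le {ι : Type*} (s : Finset ι) (a : ι → ℕ) (c : ℕ) :
    ∑ i ∈ s, (a i - c) ≤ (∑ i ∈ s, a i) - c := by
  classical
  induction s using Finset.induction_on with
  | empty => simp
  | insert i s hi ih =>
    rw [Finset.sum_insert hi, Finset.sum_insert hi]
    omega

/-- The labels `b` separate the blocks of `τ`. Comparing multiplicities, each block of `τ` has as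
length the sum of the lengths of the blocks of `σ` with its label. Merging blocks does not lower
ranks, since the sum of the truncated differences `a i - c` is at most the truncated difference of
the sum. -/
theorem rank_le_rank_of_map_eq {σ τ : JordanType n} {X : Type*} {a : Fin σ.parts → X}
    {b : Fin τ.parts → X} (hb : Function.Injective b)
    (h : Finset.univ.val.map (fun j => a (σ.blk j)) = Finset.univ.val.map fun j => b (τ.blk j))
    (c : ℕ) : σ.rank c ≤ τ.rank c := by
  classical
  have h1 : ∀ i, ∃ i', a i = b i' := by
    intro i
    have h2 : a i ∈ Finset.univ.val.map fun j => a (σ.blk j) :=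
      Multiset.mem_map.2 ⟨σ.base i, Finset.mem_univ (σ.base i), by rw [blk_base]⟩
    rw [h, Multiset.mem_map] at h2
    obtain ⟨j, -, hj⟩ := h2
    exact ⟨_, hj.symm⟩
  choose φ hφ using h1
  have h3 : ∀ i', ∑ i with φ i = i', σ.size i = τ.size i' := by
    intro i'
    have h4 := congrArg (Multiset.count (b i')) h
    simp only [Multiset.count_map, ← Finset.filter_val, Finset.card_val] at h4
    rw [Finset.card_filter, Finset.card_filter,
      σ.sum_index fun i _ => if b i' = a i then 1 else 0,
      τ.sum_index fun i _ => if b i' = b i then 1 else 0] at h4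
    simp only [hφ, hb.eq_iff, Finset.sum_const, Finset.card_range, smul_eq_mul, mul_ite, mul_one,
      mul_zero] at h4
    rw [Finset.sum_ite_eq, if_pos (Finset.mem_univ _)] at h4
    rw [Finset.sum_filter, ← h4]
    refine Finset.sum_congr rfl fun i _ => if_congr eq_comm rfl rfl
  rw [rank, rank, ← Finset.sum_fiberwise_of_maps_to (g := φ) (t := Finset.univ)
    fun _ _ => Finset.mem_univ _]
  refine Finset.sum_le_sum fun i' _ => ?_
  rw [← h3]
  exact sum_tsub_le _ _ _

end JordanType

end CharpolyFactors

/-! ### Specializing eigenvalues, and the comparison of strata. -/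

section Integral

theorem nonempty_algHom_of_isIntegral {A C E : Type*} [CommRing A] [IsDomain A] [CommRing C]
    [IsDomain C] [Algebra A C] [FaithfulSMul A C] [Algebra.IsIntegral A C] [Field E]
    [IsAlgClosed E] [Algebra A E] [FaithfulSMul A E] : Nonempty (C →ₐ[A] E) :=
  ⟨IsAlgClosed.lift⟩

/-- Lying over gives a prime above the kernel of `x`, and the resulting integral extension of
domains embeds into the algebraically closed field. This extends a specialization of a matrix to its
eigenvalues. -/
theorem exists_ringHom_integralClosure_comp_eq {B Ω E : Type*} [CommRing B] [Field Ω]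
    [Algebra B Ω] [FaithfulSMul B Ω] [Field E] [IsAlgClosed E] (x : B →+* E) :
    ∃ x' : integralClosure B Ω →+* E, x'.comp (algebraMap B _) = x := by
  have hinj : Function.Injective (algebraMap B (integralClosure B Ω)) := by
    refine Function.Injective.of_comp (f := algebraMap (integralClosure B Ω) Ω) ?_
    rw [← RingHom.coe_comp, ← IsScalarTower.algebraMap_eq]
    exact FaithfulSMul.algebraMap_injective B Ω
  have hp : (RingHom.ker x).IsPrime := RingHom.ker_isPrime x
  obtain ⟨Q, -, hQ, hQp⟩ := Ideal.exists_ideal_over_prime_of_isIntegral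
    (S := integralClosure B Ω) (RingHom.ker x) ⊥ (by
      rw [← RingHom.ker_eq_comap_bot, (RingHom.injective_iff_ker_eq_bot _).1 hinj]
      exact bot_le)
  have : Q.LiesOver (RingHom.ker x) := ⟨hQp.symm⟩
  let _ : Algebra (B ⧸ RingHom.ker x) E := (RingHom.kerLift x).toAlgebra
  have : FaithfulSMul (B ⧸ RingHom.ker x) E :=
    (faithfulSMul_iff_algebraMap_injective _ _).2 (RingHom.kerLift_injective x)
  obtain ⟨z⟩ : Nonempty ((integralClosure B Ω ⧸ Q) →ₐ[B ⧸ RingHom.ker x] E) :=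
    nonempty_algHom_of_isIntegral
  refine ⟨(z : _ →+* E).comp (Ideal.Quotient.mk Q), ?_⟩
  ext b
  have h := z.commutes (Ideal.Quotient.mk _ b)
  exact h

end Integral

section Comparison

open Polynomial

theorem IsAlgClosed.exists_pow_injective (E ι : Type*) [Field E] [IsAlgClosed E] [Finite ι]
    {m : ℕ} (hm : 0 < m) : ∃ β : ι → E, (∀ i, β i ≠ 0) ∧ Function.Injective fun i => β i ^ m := by
  have := IsAlgClosed.instInfinite (K := E)
  have : Infinite ({0}ᶜ : Set E) := (Set.finite_singleton (0 : E)).infinite_compl.to_subtype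
  obtain ⟨u⟩ : Nonempty (ι ↪ ({0}ᶜ : Set E)) := by
    have := Fintype.ofFinite ι
    exact ⟨(Fintype.equivFin ι).toEmbedding.trans (Fin.valEmbedding.trans (Infinite.natEmbedding _))⟩
  choose β hβ using fun i => IsAlgClosed.exists_pow_nat_eq (u i : E) hm
  refine ⟨β, fun i h0 => (u i).2 ?_, fun i j hij => u.injective (Subtype.ext ?_)⟩
  · rw [Set.mem_singleton_iff, ← hβ, h0, zero_pow hm.ne']
  · simpa only [hβ] using hij

namespace JordanType

variable {n : ℕ} {q : ℤ} {O : Type u} [CommRing O]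

theorem _root_.Matrix.map_sub_one_pow_map {A B T : Type*} [CommRing A] [CommRing B] [CommRing T]
    (M : Matrix (Fin n) (Fin n) A) (π : A →+* B) (y : B →+* T) (a : ℕ) :
    ((M.map π - 1) ^ a).map y = (M.map (y.comp π) - 1) ^ a := by
  rw [← RingHom.mapMatrix_apply, map_pow, RingHom.mapMatrix_apply, Matrix.map_sub_one,
    Matrix.map_map]
  rfl

/-- The semicontinuity half of the comparison: ranks at a point of the closure of the stratum of `σ`
are at most those at its generic point. -/
theorem rank_le_of_genericPrime_le_ker [IsDomain O] (hq : IsUnit (q : O)) {σ τ : JordanType n}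
    {E : Type*} [Field E] [Algebra O E] (x : UnipotentRing n q O →ₐ[O] E)
    (hx : ∀ a, (((univS _ q).map x - 1) ^ a).rank = τ.rank a)
    (h : σ.genericPrime q O ≤ RingHom.ker x) (a : ℕ) : τ.rank a ≤ σ.rank a := by
  have := σ.isDomain_paramRing (O := O) (zpowPoly n q) (by rwa [coeff_zero_zpowPoly])
  let g := IsScalarTower.toAlgHom O (σ.ParamRing (zpowPoly n q) O)
    (FractionRing (σ.ParamRing (zpowPoly n q) O))
  have hg : Function.Injective g := IsFractionRing.injective _ _
  rw [← hx, ← σ.rank_univS_map_comp g]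
  have hker : RingHom.ker (g.comp (σ.paramMap q O)) = σ.genericPrime q O := by
    ext b
    rw [genericPrime, RingHom.mem_ker, RingHom.mem_ker, AlgHom.comp_apply,
      map_eq_zero_iff g hg]
  let B := UnipotentRing n q O ⧸ σ.genericPrime q O
  let x₁ : B →+* E := Ideal.Quotient.lift _ x.toRingHom h
  let g₁ : B →+* FractionRing (σ.ParamRing (zpowPoly n q) O) :=
    Ideal.Quotient.lift _ (g.comp (σ.paramMap q O)).toRingHom hker.ge
  have hg₁ : Function.Injective g₁ := Ideal.injective_lift_iff hker.ge |>.2 hker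
  have h1 := rank_map_le_rank_map x₁ g₁ hg₁
    ((((univS (fun _ : Fin n => (1 : Oˣ)) q).map (Ideal.Quotient.mk (σ.genericPrime q O)) - 1)
        ^ a))
  rw [Matrix.map_sub_one_pow_map, Matrix.map_sub_one_pow_map] at h1
  exact h1

theorem charpoly_univΦ_map_comp {T : Type*} [CommRing T] [Algebra O T] (σ : JordanType n)
    (y : σ.ParamRing (zpowPoly n q) O →ₐ[O] T) :
    ((univΦ _ q).map (y.comp (σ.paramMap q O))).charpoly =
      ((σ.paramP (zpowPoly n q) O).map y).charpoly := by
  have h1 : (σ.paramΦ (zpowPoly n q) O).charpoly = (σ.paramP (zpowPoly n q) O).charpoly :=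
    Matrix.charpoly_eq_of_mul_eq (σ.isUnit_det_paramG _) (σ.paramΦ_mul _)
  rw [← univΦ_map_paramMap] at h1
  have h2 := congrArg (Polynomial.map (y : _ →+* T)) h1
  rw [← Matrix.charpoly_map, ← Matrix.charpoly_map, Matrix.map_map] at h2
  exact h2

end JordanType

end Comparison

open Polynomial

namespace JordanType

variable {n : ℕ} {q : ℤ} {O : Type u} [CommRing O]

theorem exists_charpoly_paramP_map_eq {F : Type*} [Field F] [IsAlgClosed F] [Algebra O F]
    (hq : (q : F) ≠ 0) (σ : JordanType n) (y : σ.ParamRing (zpowPoly n q) O →ₐ[O] F) :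
    ∃ γ : Fin σ.parts → F, ((σ.paramP (zpowPoly n q) O).map y).charpoly =
      ∏ j, (X - C ((q : F) ^ σ.pos j * γ (σ.blk j))) := by
  let y₀ := (y : σ.ParamRing (zpowPoly n q) O →+* F).comp
    (algebraMap (σ.ParamPoly O) (σ.ParamRing (zpowPoly n q) O))
  have h1 : (σ.paramP (zpowPoly n q) O).map y = σ.cyc (Matrix.aevalMul (zpowPoly n q) (σ.nilp F))
      fun i => y₀ ∘ σ.polyW O i := by
    rw [paramP, Matrix.map_map, ← σ.nilp_map y₀, ← Matrix.aevalMul_map, ← cyc_map]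
    rfl
  rw [h1]
  have h2 := σ.exists_charpoly_cyc_eq (zpowPoly n q) (F := F) (by rwa [coeff_zero_zpowPoly])
    (fun i => y₀ ∘ σ.polyW O i) (fun i j hij => by
      rw [Function.comp_apply, polyW, if_neg hij, map_zero])
  rwa [coeff_zero_zpowPoly] at h2

theorem _root_.Polynomial.roots_prod_X_sub_C_univ {ι F : Type*} [Field F] [Fintype ι]
    (g : ι → F) : (∏ i, (X - C (g i))).roots = Finset.univ.val.map g := by
  rw [← Polynomial.roots_multiset_prod_X_sub_C (Finset.univ.val.map g), Multiset.map_map]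
  rfl

theorem _root_.Polynomial.map_prod_X_sub_C_univ {ι R T : Type*} [CommRing R] [CommRing T]
    [Fintype ι] (φ : R →+* T) (g : ι → R) :
    (∏ i, (X - C (g i))).map φ = ∏ i, (X - C (φ (g i))) := by
  simp [Polynomial.map_prod]

theorem intCast_pow_sub_one_eq_one {l : ℕ} [hl : Fact l.Prime] {F : Type*} [Field F] [CharP F l]
    (hq : (q : F) ≠ 0) : (q : F) ^ (l - 1) = 1 := by
  have h1 : (q : ZMod l) ≠ 0 := by
    rw [Ne, ZMod.intCast_zmod_eq_zero_iff_dvd]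
    rwa [Ne, CharP.intCast_eq_zero_iff F l] at hq
  have h2 := congrArg (ZMod.castHom dvd_rfl F) (ZMod.pow_card_sub_one_eq_one h1)
  simpa using h2

/-- If the special point of `τ` lies in the closure of the stratum of `σ`, the two shapes have the
same ranks. -/
theorem rank_eq_of_genericPrime_le_specialPrime [IsDomain O] (hq : IsUnit (q : O)) {w : O}
    (hw : Prime w) {l : ℕ} [hl : Fact l.Prime] [CharP (O ⧸ Ideal.span {w}) l]
    {σ τ : JordanType n} (h : σ.genericPrime q O ≤ τ.specialPrime q w) : σ.rank = τ.rank := by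
  have hwp : (Ideal.span {w}).IsPrime := (Ideal.span_singleton_prime hw.ne_zero).2 hw
  let E := AlgebraicClosure (FractionRing (O ⧸ Ideal.span {w}))
  have hE0 : algebraMap O E w = 0 := by
    rw [IsScalarTower.algebraMap_apply O (O ⧸ Ideal.span {w}) E, Ideal.Quotient.algebraMap_eq,
      Ideal.Quotient.eq_zero_iff_mem.2 (Ideal.mem_span_singleton_self w), map_zero]
  have hqE : IsUnit (q : E) := by simpa using hq.map (algebraMap O E)
  have hinjE : Function.Injective (algebraMap (O ⧸ Ideal.span {w}) E) := by
    rw [IsScalarTower.algebraMap_eq _ (FractionRing (O ⧸ Ideal.span {w})) E]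
    exact (algebraMap (FractionRing (O ⧸ Ideal.span {w})) E).injective.comp
      (IsFractionRing.injective _ _)
  have : CharP E l := charP_of_injective_ringHom hinjE l
  -- The exponent `l - 1` is chosen because `q ^ (l - 1) = 1` in characteristic `l`: the powers `β i
  -- ^ (l - 1)` label the blocks of `τ` without regard to the factors `q ^ pos`.
  obtain ⟨β, hβ0, hβ⟩ := IsAlgClosed.exists_pow_injective E (Fin τ.parts) (m := l - 1)
    (Nat.sub_pos_of_lt hl.out.one_lt)
  obtain ⟨y, -, hy⟩ := τ.exists_paramRing_algHom_single (O := O) (R := E) (zpowPoly n q)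
    (by rwa [coeff_zero_zpowPoly]) β fun i => (hβ0 i).isUnit
  let x := y.comp (τ.paramMap q O)
  have hx : σ.genericPrime q O ≤ RingHom.ker x := h.trans (τ.specialPrime_le_ker y hE0)
  -- One inequality is semicontinuity; the other comes from the eigenvalues of the first matrix.
  refine funext fun a => le_antisymm ?_
    (rank_le_of_genericPrime_le_ker hq x (τ.rank_univS_map_comp y) hx a)
  have := σ.isDomain_paramRing (O := O) (zpowPoly n q) (by rwa [coeff_zero_zpowPoly])
  let D := σ.ParamRing (zpowPoly n q) O
  let Ω := AlgebraicClosure (FractionRing D)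
  let g : D →ₐ[O] Ω := IsScalarTower.toAlgHom O D Ω
  have hg : Function.Injective g := by
    change Function.Injective (algebraMap D Ω)
    rw [IsScalarTower.algebraMap_eq D (FractionRing D) Ω]
    exact (algebraMap (FractionRing D) Ω).injective.comp (IsFractionRing.injective _ _)
  have hker : RingHom.ker (g.comp (σ.paramMap q O)) = σ.genericPrime q O := by
    ext b
    rw [genericPrime, RingHom.mem_ker, RingHom.mem_ker, AlgHom.comp_apply,
      map_eq_zero_iff g hg]
  obtain ⟨γ, hγ⟩ := σ.exists_charpoly_paramP_map_eq
    (by simpa using (hq.map (algebraMap O Ω)).ne_zero) g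
  rw [← charpoly_univΦ_map_comp] at hγ
  have hτ := τ.charpoly_univΦ_map_comp y
  rw [hy, charpoly_cyc_single, coeff_zero_zpowPoly] at hτ
  let B := UnipotentRing n q O ⧸ σ.genericPrime q O
  let x₁ : B →+* E := Ideal.Quotient.lift _ x.toRingHom hx
  let g₁ : B →+* Ω := Ideal.Quotient.lift _ (g.comp (σ.paramMap q O)).toRingHom hker.ge
  have hg₁ : Function.Injective g₁ := Ideal.injective_lift_iff hker.ge |>.2 hker
  let _ : Algebra B Ω := g₁.toAlgebra
  have : FaithfulSMul B Ω := (faithfulSMul_iff_algebraMap_injective _ _).2 hg₁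
  let Φ := (univΦ (fun _ : Fin n => (1 : Oˣ)) q).map (Ideal.Quotient.mk (σ.genericPrime q O))
  have hΦx : Φ.charpoly.map x₁ = ∏ j, (X - C ((q : E) ^ τ.pos j * β (τ.blk j))) := by
    rw [← hτ, ← Matrix.charpoly_map, Matrix.map_map]
    rfl
  have hΦg : Φ.charpoly.map g₁ = ∏ j, (X - C ((q : Ω) ^ σ.pos j * γ (σ.blk j))) := by
    rw [← hγ, ← Matrix.charpoly_map, Matrix.map_map]
    rfl
  have hint : ∀ i, IsIntegral B (γ i) := by
    intro i
    refine ⟨Φ.charpoly, Matrix.charpoly_monic _, ?_⟩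
    rw [← Polynomial.eval_map]
    change eval (γ i) (Φ.charpoly.map g₁) = 0
    rw [hΦg, eval_prod, Finset.prod_eq_zero (Finset.mem_univ (σ.base i))]
    simp
  -- The eigenvalues at the geometric generic point of `σ` are not in `B`, but they are integral
  -- over it, so the specialization can be extended to them and to the factorization of the
  -- characteristic polynomial.
  obtain ⟨x', hx'⟩ := exists_ringHom_integralClosure_comp_eq (Ω := Ω) x₁
  let γ' : Fin σ.parts → integralClosure B Ω := fun i => ⟨γ i, hint i⟩
  have hfac : Φ.charpoly.map (algebraMap B (integralClosure B Ω)) =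
      ∏ j, (X - C ((q : integralClosure B Ω) ^ σ.pos j * γ' (σ.blk j))) := by
    apply Polynomial.map_injective (algebraMap (integralClosure B Ω) Ω) Subtype.val_injective
    rw [Polynomial.map_map, ← IsScalarTower.algebraMap_eq, map_prod_X_sub_C_univ]
    refine hΦg.trans (Finset.prod_congr rfl fun j _ => ?_)
    have h1 : algebraMap (integralClosure B Ω) Ω ((q : integralClosure B Ω) ^ σ.pos j *
        γ' (σ.blk j)) = (q : Ω) ^ σ.pos j * γ (σ.blk j) := by
      rw [map_mul, map_pow, map_intCast]
      rfl
    rw [h1]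
  have hfacE := congrArg (Polynomial.map x') hfac
  rw [Polynomial.map_map, hx', hΦx, map_prod_X_sub_C_univ] at hfacE
  have hroots := congrArg Polynomial.roots hfacE
  rw [roots_prod_X_sub_C_univ, roots_prod_X_sub_C_univ] at hroots
  -- Taking `(l - 1)`-st powers erases the powers of `q`, so the roots become labels of blocks,
  -- counted with the lengths of the blocks.
  have hmap := congrArg (Multiset.map fun z => z ^ (l - 1)) hroots
  have h1 : ∀ (a : ℕ) (z : E), ((q : E) ^ a * z) ^ (l - 1) = z ^ (l - 1) := fun a z => by
    rw [mul_pow, ← pow_mul, mul_comm a, pow_mul, intCast_pow_sub_one_eq_one hqE.ne_zero, one_pow,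
      one_mul]
  simp only [Multiset.map_map, Function.comp_def, map_mul, map_pow, map_intCast, h1] at hmap
  exact rank_le_rank_of_map_eq (a := fun i => x' (γ' i) ^ (l - 1)) hβ hmap.symm a

end JordanType

/-! ### Fields of definition, and the dimension of the strata. -/

section Entries

variable {n : ℕ} {F L : Type*} [Field F] [Field L] [Algebra F L]

/-- All entries of a matrix lie in an intermediate field. -/
def Matrix.EntriesIn (M : IntermediateField F L) (X : Matrix (Fin n) (Fin n) L) : Prop :=
  ∀ i j, X i j ∈ M

namespace Matrix.EntriesIn

variable {M : IntermediateField F L} {X Y : Matrix (Fin n) (Fin n) L}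

theorem exists_map_eq (h : EntriesIn M X) :
    ∃ X' : Matrix (Fin n) (Fin n) M, X'.map (algebraMap M L) = X :=
  ⟨Matrix.of fun i j => ⟨X i j, h i j⟩, rfl⟩

theorem of_map (X' : Matrix (Fin n) (Fin n) M) : EntriesIn M (X'.map (algebraMap M L)) :=
  fun i j => (X' i j).2

theorem mul (hX : EntriesIn M X) (hY : EntriesIn M Y) : EntriesIn M (X * Y) := by
  obtain ⟨X, rfl⟩ := hX.exists_map_eq
  obtain ⟨Y, rfl⟩ := hY.exists_map_eq
  rw [← Matrix.map_mul]
  exact of_map _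

theorem inv (hX : EntriesIn M X) : EntriesIn M X⁻¹ := by
  by_cases hdet : IsUnit X.det
  · obtain ⟨X, rfl⟩ := hX.exists_map_eq
    rw [← RingHom.mapMatrix_apply, ← RingHom.map_det, isUnit_iff_ne_zero,
      map_ne_zero_iff _ (algebraMap M L).injective] at hdet
    rw [← matrix_map_inv _ hdet.isUnit]
    exact of_map _
  · rw [Matrix.nonsing_inv_apply_not_isUnit _ hdet]
    exact fun _ _ => M.zero_mem

theorem mono {M' : IntermediateField F L} (h : M ≤ M') (hX : EntriesIn M X) : EntriesIn M' X :=
  fun i j => h (hX i j)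

theorem nilp (σ : JordanType n) : EntriesIn M (σ.nilp L) := by
  rw [← σ.nilp_map (algebraMap M L)]
  exact of_map _

end Matrix.EntriesIn

theorem isUnit_det_of_map {R T : Type*} [Field R] [Field T] (φ : R →+* T)
    {X : Matrix (Fin n) (Fin n) R} (h : IsUnit (X.map φ).det) : IsUnit X.det := by
  rw [← RingHom.mapMatrix_apply, ← RingHom.map_det, isUnit_iff_ne_zero,
    map_ne_zero_iff _ φ.injective] at h
  exact h.isUnit

theorem isUnit_det_map {R T : Type*} [CommRing R] [CommRing T] (φ : R →+* T)
    {X : Matrix (Fin n) (Fin n) R} (h : IsUnit X.det) : IsUnit (X.map φ).det := by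
  rw [← RingHom.mapMatrix_apply, ← RingHom.map_det]
  exact h.map φ

theorem IsModuliPair.of_map {O : Type*} [CommRing O] {α : Fin n → Oˣ} {q : ℤ} {R T : Type*}
    [Field R] [Algebra O R] [Field T] [Algebra O T] (φ : R →ₐ[O] T)
    {P S : Matrix (Fin n) (Fin n) R} (h : IsModuliPair α q (P.map φ) (S.map φ)) :
    IsModuliPair α q P S := by
  have hφ : Function.Injective φ := (φ : R →+* T).injective
  have hP : IsUnit P.det := isUnit_det_of_map (φ : R →+* T) h.isUnit_det
  have hS : IsUnit S.det := isUnit_det_of_map (φ : R →+* T) h.isUnit_det_right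
  refine ⟨hP, ?_, ?_⟩
  · apply Polynomial.map_injective (φ : R →+* T) hφ
    rw [← Matrix.charpoly_map]
    refine h.charpoly_eq.trans ?_
    simp [Polynomial.map_prod]
  · rw [Matrix.conj_eq_iff hP]
    have h1 := (Matrix.conj_eq_iff h.isUnit_det).1 h.conj_eq
    have h2 : (S ^ q).map φ = S.map φ ^ q := matrix_map_zpow (φ : R →+* T) hS q
    have hm : ∀ A B : Matrix (Fin n) (Fin n) R, (A * B).map φ = A.map φ * B.map φ :=
      fun A B => Matrix.map_mul (f := (φ : R →+* T))
    rw [← h2, ← hm, ← hm] at h1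
    exact Matrix.map_injective hφ h1

theorem ModuliRing.forall_mem_of_entriesIn {O : Type*} [CommRing O] {α : Fin n → Oˣ} {q : ℤ}
    [Algebra O F] [Algebra O L] [IsScalarTower O F L] {M : IntermediateField F L}
    (x : ModuliRing α q →ₐ[O] L) (hΦ : Matrix.EntriesIn M ((univΦ α q).map x))
    (hS : Matrix.EntriesIn M ((univS α q).map x)) (a : ModuliRing α q) : x a ∈ M := by
  obtain ⟨P, hP⟩ := hΦ.exists_map_eq
  obtain ⟨S, hS⟩ := hS.exists_map_eq
  have : IsScalarTower O M L := .of_algebraMap_eq fun r => rfl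
  let ι : M →ₐ[O] L := IsScalarTower.toAlgHom O M L
  have h := (isModuliPair_univ α q).map x
  rw [← hP, ← hS] at h
  obtain ⟨x', ⟨h1, h2⟩, -⟩ := existsUnique_moduliRing_lift (IsModuliPair.of_map ι h)
  have h3 : ι.comp x' = x := by
    refine ModuliRing.algHom_ext ?_ ?_
    · rw [← hP, ← h1]
      rfl
    · rw [← hS, ← h2]
      rfl
  rw [← h3]
  exact (x' a).2

end Entries

namespace JordanType

open Polynomial

variable {n : ℕ}

/-- The matrix `N f(N)` has the same shape as `N`, because on `nilp` the first basis vectors of the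
blocks remain cyclic generators. The point is that `s` has entries in any field containing those of
`N`. -/
theorem exists_aevalMul_mul_eq {F : Type u} [Field F] (σ : JordanType n) (f : ℤ[X])
    (hf : IsUnit (f.coeff 0 : F)) (N : Matrix (Fin n) (Fin n) F)
    (h : ∀ a, (N ^ a).rank = σ.rank a) :
    ∃ s : Matrix (Fin n) (Fin n) F, IsUnit s.det ∧ Matrix.aevalMul f N * s = s * σ.nilp F := by
  obtain ⟨g, hg, hN⟩ := σ.exists_mul_eq_of_rank_eq N h
  let c := σ.cyc (Matrix.aevalMul f (σ.nilp F)) fun i => Pi.single (σ.base i) 1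
  have hc : IsUnit c.det := σ.isUnit_det_cyc_single f hf (fun _ => 1) fun _ => isUnit_one
  have hc2 : Matrix.aevalMul f (σ.nilp F) * c = c * σ.nilp F := by
    refine σ.mul_cyc _ _ fun i => ?_
    have h1 : (σ.nilp F ^ σ.size i) *ᵥ Pi.single (σ.base i) 1 = 0 := by
      ext j
      rw [nilp_pow_mulVec_apply]
      split_ifs with hj
      · rw [Pi.single_apply, if_neg, Pi.zero_apply]
        intro h2
        have h3 := congrArg σ.blk h2
        simp only [blk_vec, blk_base] at h3
        have := σ.pos_lt j
        rw [h3] at this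
        omega
      · rfl
    rw [commute_pow, ((Matrix.commute_aeval _ _).pow_left _).eq, ← Matrix.mulVec_mulVec, h1,
      Matrix.mulVec_zero]
  refine ⟨g * c, ?_, ?_⟩
  · rw [Matrix.det_mul]
    exact hg.mul hc
  · rw [← Matrix.mul_assoc, Matrix.aevalMul_mul f hN, Matrix.mul_assoc, hc2, Matrix.mul_assoc]

variable {q : ℤ} {O : Type u} [CommRing O]

/-- A point whose second matrix has shape `σ` is defined over a field generated by `n ^ 2`
elements. -/
theorem exists_forall_mem_adjoin (σ : JordanType n) {F L : Type u} [Field F] [Field L]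
    [Algebra O F] [Algebra F L] [Algebra O L] [IsScalarTower O F L] (hq : (q : F) ≠ 0)
    (x : UnipotentRing n q O →ₐ[O] L)
    (hx : ∀ a, (((univS _ q).map x - 1) ^ a).rank = σ.rank a) :
    ∃ v : Fin n × Fin n → L, ∀ a, x a ∈ IntermediateField.adjoin F (Set.range v) := by
  set S := (univS (fun _ : Fin n => (1 : Oˣ)) q).map x
  set Φ := (univΦ (fun _ : Fin n => (1 : Oˣ)) q).map x
  have hpair : IsModuliPair (fun _ : Fin n => (1 : Oˣ)) q Φ S := (isModuliPair_univ _ q).map x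
  have hΦ := hpair.isUnit_det
  let F₁ := IntermediateField.adjoin F (Set.range fun ij : Fin n × Fin n => (S - 1) ij.1 ij.2)
  have hN₁ : Matrix.EntriesIn F₁ (S - 1) := fun i j =>
    IntermediateField.subset_adjoin _ _ ⟨(i, j), rfl⟩
  obtain ⟨N₁, hN₁⟩ := hN₁.exists_map_eq
  obtain ⟨s₁, hs₁, hs₁N⟩ := σ.exists_aevalMul_mul_eq (zpowPoly n q)
    (by
      rw [coeff_zero_zpowPoly]
      have h1 := hq.isUnit.map (algebraMap F F₁)
      rwa [map_intCast] at h1) N₁ fun a => by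
    rw [← hx, ← hN₁, ← RingHom.mapMatrix_apply, ← map_pow, RingHom.mapMatrix_apply,
      Matrix.rank_map_ringHom]
  let s := s₁.map (algebraMap F₁ L)
  have hs : IsUnit s.det := isUnit_det_map _ hs₁
  have hsN : Matrix.aevalMul (zpowPoly n q) (S - 1) * s = s * σ.nilp L := by
    have h1 := congrArg (fun X => Matrix.map X (algebraMap F₁ L)) hs₁N
    simpa only [Matrix.map_mul, Matrix.aevalMul_map, hN₁, σ.nilp_map] using h1
  -- As `Φ` conjugates `N = S - 1` to `N f(N)` and `s` brings the latter to the form `nilp`, the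
  -- matrix `g` is a Jordan basis of `N`. Its entries determine `N = g nilp g⁻¹`, hence the field
  -- `F₁` and `s`, hence also `Φ = s g⁻¹`: the `n ^ 2` entries of `g` suffice.
  let g := Φ⁻¹ * s
  have hg : IsUnit g.det := by
    rw [Matrix.det_mul]
    exact (Matrix.isUnit_nonsing_inv_det _ hΦ).mul hs
  have hΦΦ := Matrix.mul_nonsing_inv _ hΦ
  have hΦΦ' := Matrix.nonsing_inv_mul _ hΦ
  have hgg := Matrix.mul_nonsing_inv _ hg
  have hgN : (S - 1) * g = g * σ.nilp L :=
    calc (S - 1) * g = Φ⁻¹ * (Φ * (S - 1)) * g := by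
          rw [← Matrix.mul_assoc Φ⁻¹, hΦΦ', Matrix.one_mul]
    _ = Φ⁻¹ * (Matrix.aevalMul (zpowPoly n q) (S - 1) * Φ * (Φ⁻¹ * s)) := by
      rw [hpair.mul_sub_one, Matrix.mul_assoc]
    _ = Φ⁻¹ * (Matrix.aevalMul (zpowPoly n q) (S - 1) * s) := by
      rw [Matrix.mul_assoc _ Φ, ← Matrix.mul_assoc Φ, hΦΦ, Matrix.one_mul]
    _ = _ := by rw [hsN, Matrix.mul_assoc]
  let v : Fin n × Fin n → L := fun ij => g ij.1 ij.2
  let M := IntermediateField.adjoin F (Set.range v)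
  have hgM : Matrix.EntriesIn M g := fun i j =>
    IntermediateField.subset_adjoin _ _ ⟨(i, j), rfl⟩
  have hSM : Matrix.EntriesIn M (S - 1) := by
    have h1 : S - 1 = g * σ.nilp L * g⁻¹ := by
      rw [← hgN, Matrix.mul_assoc, hgg, Matrix.mul_one]
    rw [h1]
    exact (hgM.mul (.nilp σ)).mul hgM.inv
  have hF₁ : F₁ ≤ M := by
    rw [IntermediateField.adjoin_le_iff]
    rintro _ ⟨ij, rfl⟩
    exact hSM _ _
  have hsM : Matrix.EntriesIn M s := (Matrix.EntriesIn.of_map s₁).mono hF₁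
  refine ⟨v, ModuliRing.forall_mem_of_entriesIn (M := M) x ?_ ?_⟩
  · have h1 : Φ = s * g⁻¹ := by
      have h2 : Φ * g = s := by
        change Φ * (Φ⁻¹ * s) = s
        rw [← Matrix.mul_assoc, hΦΦ, Matrix.one_mul]
      rw [← h2, Matrix.mul_assoc, hgg, Matrix.mul_one]
    change Matrix.EntriesIn M Φ
    rw [h1]
    exact hsM.mul hgM.inv
  · intro i j
    have h1 := M.add_mem (hSM i j) (show (1 : Matrix (Fin n) (Fin n) L) i j ∈ M by
      rw [Matrix.one_apply]
      split_ifs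
      · exact M.one_mem
      · exact M.zero_mem)
    rwa [← Matrix.add_apply, sub_add_cancel] at h1

end JordanType

section Trdeg

theorem trdeg_intermediateField_adjoin_range_le {F L ι : Type*} [Field F] [Field L] [Algebra F L]
    [Fintype ι] (v : ι → L) :
    Algebra.trdeg F (IntermediateField.adjoin F (Set.range v)) ≤ Fintype.card ι := by
  classical
  let M := IntermediateField.adjoin F (Set.range v)
  let v' : ι → M := fun i => ⟨v i, IntermediateField.subset_adjoin _ _ ⟨i, rfl⟩⟩
  have : Algebra.IsAlgebraic (Algebra.adjoin F (Set.range v')) M := by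
    refine ⟨fun ⟨x, hx⟩ => ?_⟩
    induction hx using IntermediateField.adjoin_induction with
    | mem x hx =>
      obtain ⟨i, rfl⟩ := hx
      exact isAlgebraic_algebraMap
        (⟨v' i, Algebra.subset_adjoin ⟨i, rfl⟩⟩ : Algebra.adjoin F (Set.range v'))
    | algebraMap x => exact isAlgebraic_algebraMap (algebraMap F (Algebra.adjoin F (Set.range v')) x)
    | add x y hx hy hx' hy' => exact hx'.add hy'
    | inv x hx hx' => exact hx'.inv
    | mul x y hx hy hx' hy' => exact hx'.mul hy'
  refine (Algebra.IsAlgebraic.trdeg_le_cardinalMk F (Set.range v')).trans ?_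
  rw [Cardinal.mk_fintype, Nat.cast_le]
  exact Fintype.card_range_le v'

theorem IntermediateField.isAlgebraic_of_mem_adjoin {R F L : Type*} [CommRing R] [NoZeroDivisors R]
    [Field F] [Field L] [Algebra F L] [Algebra R L] {T : Set L}
    (hF : ∀ x : F, IsAlgebraic R (algebraMap F L x)) (hT : ∀ x ∈ T, IsAlgebraic R x) {x : L}
    (hx : x ∈ IntermediateField.adjoin F T) : IsAlgebraic R x := by
  induction hx using IntermediateField.adjoin_induction with
  | mem x hx => exact hT x hx
  | algebraMap x => exact hF x
  | add x y hx hy hx' hy' => exact hx'.add hy'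
  | inv x hx hx' => exact hx'.inv
  | mul x y hx hy hx' hy' => exact hx'.mul hy'

end Trdeg

section Finiteness

variable {O : Type*} [CommRing O] {n : ℕ} (α : Fin n → Oˣ) (q : ℤ)

instance : Algebra.FiniteType O (GLPairRing O n) :=
  have : Algebra.FiniteType (PairPoly O n) (GLPairRing O n) :=
    IsLocalization.finiteType_of_monoid_fg
      (Submonoid.powers ((polyΦ O n).det * (polyS O n).det)) _
  Algebra.FiniteType.trans (S := PairPoly O n) inferInstance inferInstance

instance : Algebra.FiniteType O (ModuliRing α q) :=
  Algebra.FiniteType.of_surjective (ModuliRing.mk α q) (Ideal.Quotient.mkₐ_surjective O _)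

instance [IsNoetherianRing O] : IsNoetherianRing (ModuliRing α q) :=
  Algebra.FiniteType.isNoetherianRing O _

end Finiteness

namespace JordanType

open Polynomial

variable {n : ℕ} {q : ℤ} {O : Type u} [CommRing O]

/-- The image of the coordinate ring generates `B` over `F`, so all of `B` lies in the field
generated by `n ^ 2` elements. -/
theorem trdeg_le_of_rank_univS_eq (σ : JordanType n) {F B L : Type u} [Field F] [CommRing B]
    [IsDomain B] [Field L] [Algebra B L] [FaithfulSMul B L] [Algebra F B] [Algebra O F]
    [Algebra O B] [IsScalarTower O F B] [Algebra O L] [Algebra F L] [IsScalarTower O B L]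
    [IsScalarTower F B L] [IsScalarTower O F L] (hq : (q : F) ≠ 0)
    (x : UnipotentRing n q O →ₐ[O] B) (hgen : Algebra.adjoin F (Set.range x) = ⊤)
    (hx : ∀ a, (((univS _ q).map ((IsScalarTower.toAlgHom O B L).comp x) - 1) ^ a).rank = σ.rank a) :
    Algebra.trdeg F B ≤ (n ^ 2 : ℕ) := by
  obtain ⟨v, hv⟩ := σ.exists_forall_mem_adjoin (F := F) hq
    ((IsScalarTower.toAlgHom O B L).comp x) hx
  let M := IntermediateField.adjoin F (Set.range v)
  have hB : ∀ b : B, algebraMap B L b ∈ M := by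
    have h1 : Algebra.adjoin F (Set.range x) ≤
        M.toSubalgebra.comap (IsScalarTower.toAlgHom F B L) := by
      rw [Algebra.adjoin_le_iff]
      rintro _ ⟨a, rfl⟩
      exact hv a
    intro b
    exact h1 (by rw [hgen]; trivial)
  let φ : B →ₐ[F] M := (IsScalarTower.toAlgHom F B L).codRestrict M.toSubalgebra hB
  have hφ : Function.Injective φ := fun a b hab =>
    FaithfulSMul.algebraMap_injective B L (congrArg Subtype.val hab)
  refine (trdeg_le_of_injective φ hφ).trans ((trdeg_intermediateField_adjoin_range_le v).trans ?_)
  rw [Fintype.card_prod, Fintype.card_fin, sq]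

/-- The construction of `exists_forall_mem_adjoin` run backwards. From `X` form `N = X nilp X⁻¹`,
then `s` over the field generated by `N`, and `Φ = s X⁻¹`. The pair `(Φ, 1 + N)` lies in the stratum
and recovers `X = Φ⁻¹ s`, so `L` is algebraic over the image of the coordinate ring. -/
theorem trdeg_le_trdeg_quotient_genericPrime [IsDomain O] (hq : IsUnit (q : O))
    (σ : JordanType n) {F L : Type u} [Field F] [Field L] [Algebra O F] [IsFractionRing O F]
    [Algebra F L] [Algebra O L] [IsScalarTower O F L] (X : Matrix (Fin n) (Fin n) L)
    (hX : IsUnit X.det) (htop : ∀ M : IntermediateField F L, Matrix.EntriesIn M X → M = ⊤) :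
    Algebra.trdeg O L ≤ Algebra.trdeg O (UnipotentRing n q O ⧸ σ.genericPrime q O) := by
  have hqF : (q : F) ≠ 0 := by simpa using (hq.map (algebraMap O F)).ne_zero
  have hqL : IsUnit (q : L) := by simpa using hq.map (algebraMap O L)
  have hXX := Matrix.mul_nonsing_inv _ hX
  have hXX' := Matrix.nonsing_inv_mul _ hX
  let N := X * σ.nilp L * X⁻¹
  have hNX : N * X = X * σ.nilp L := by
    rw [Matrix.mul_assoc, hXX', Matrix.mul_one]
  let F₁ := IntermediateField.adjoin F (Set.range fun ij : Fin n × Fin n => N ij.1 ij.2)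
  have hN₁ : Matrix.EntriesIn F₁ N := fun i j =>
    IntermediateField.subset_adjoin _ _ ⟨(i, j), rfl⟩
  obtain ⟨N₁, hN₁⟩ := hN₁.exists_map_eq
  obtain ⟨s₁, hs₁, hs₁N⟩ := σ.exists_aevalMul_mul_eq (zpowPoly n q)
    (by
      rw [coeff_zero_zpowPoly]
      have h1 := hqF.isUnit.map (algebraMap F F₁)
      rwa [map_intCast] at h1) N₁ fun a => by
    rw [← rank_pow_of_mul_eq σ hX hNX, ← hN₁, ← RingHom.mapMatrix_apply, ← map_pow,
      RingHom.mapMatrix_apply, Matrix.rank_map_ringHom]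
  let s := s₁.map (algebraMap F₁ L)
  have hs : IsUnit s.det := isUnit_det_map _ hs₁
  have hsN : Matrix.aevalMul (zpowPoly n q) N * s = s * σ.nilp L := by
    have h1 := congrArg (fun X => Matrix.map X (algebraMap F₁ L)) hs₁N
    simpa only [Matrix.map_mul, Matrix.aevalMul_map, hN₁, σ.nilp_map] using h1
  let Φ := s * X⁻¹
  have hΦX : Φ * X = s := by
    change s * X⁻¹ * X = s
    rw [Matrix.mul_assoc, hXX', Matrix.mul_one]
  have hΦ : IsUnit Φ.det := by
    rw [Matrix.det_mul]
    exact hs.mul (Matrix.isUnit_nonsing_inv_det _ hX)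
  have hS1 : 1 + N - 1 = N := add_sub_cancel_left _ _
  have hpair : IsModuliPair (fun _ : Fin n => (1 : Oˣ)) q Φ (1 + N) := by
    refine isModuliPair_of_mul_eq σ hΦ hX (by rw [hS1, hNX]) ?_
    rw [hS1]
    apply Matrix.mul_right_cancel_of_isUnit_det hX
    rw [Matrix.mul_assoc, hNX, ← Matrix.mul_assoc, hΦX, Matrix.mul_assoc, hΦX, hsN]
  obtain ⟨y, ⟨hyΦ, hyS⟩, -⟩ := existsUnique_moduliRing_lift hpair
  obtain ⟨z, hz⟩ := σ.exists_comp_paramMap_eq hqL y hX (by rw [hyS, hS1, hNX])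
  have hOL : Function.Injective (algebraMap O L) := by
    rw [IsScalarTower.algebraMap_eq O F L]
    exact (algebraMap F L).injective.comp (IsFractionRing.injective O F)
  let R := y.range
  have : FaithfulSMul O R := (faithfulSMul_iff_algebraMap_injective _ _).2 <|
    Function.Injective.of_comp (f := algebraMap R L) hOL
  have hL : Algebra.IsAlgebraic R L := by
    let M := IntermediateField.adjoin F (R : Set L)
    have hSM : Matrix.EntriesIn M N := fun i j => by
      have h1 : N i j = y (univS _ q i j - (1 : Matrix (Fin n) (Fin n) _) i j) := by
        rw [map_sub]
        have h2 : y (univS _ q i j) = (1 + N) i j := congrFun (congrFun hyS i) j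
        rw [h2, Matrix.add_apply, Matrix.one_apply, Matrix.one_apply]
        split_ifs <;> simp
      rw [h1]
      exact IntermediateField.subset_adjoin _ _ ⟨_, rfl⟩
    have hF₁ : F₁ ≤ M := by
      rw [IntermediateField.adjoin_le_iff]
      rintro _ ⟨ij, rfl⟩
      exact hSM _ _
    have hsM : Matrix.EntriesIn M s := (Matrix.EntriesIn.of_map s₁).mono hF₁
    have hΦM : Matrix.EntriesIn M Φ := fun i j => by
      rw [← hyΦ]
      exact IntermediateField.subset_adjoin _ _ ⟨_, rfl⟩
    have hXM : Matrix.EntriesIn M X := by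
      have h1 : X = Φ⁻¹ * s := by
        rw [← hΦX, ← Matrix.mul_assoc, Matrix.nonsing_inv_mul _ hΦ, Matrix.one_mul]
      rw [h1]
      exact hΦM.inv.mul hsM
    have hFR : ∀ x : F, IsAlgebraic R (algebraMap F L x) := fun x => by
      have h1 : IsAlgebraic O (algebraMap F L x) :=
        ((IsFractionRing.isAlgebraic_iff O F F).2 (isAlgebraic_algebraMap x)).algebraMap
      exact h1.extendScalars (FaithfulSMul.algebraMap_injective O R)
    refine ⟨fun x => IntermediateField.isAlgebraic_of_mem_adjoin (T := (R : Set L)) hFR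
      (fun x hx => isAlgebraic_algebraMap (⟨x, hx⟩ : R)) (x := x) ?_⟩
    change x ∈ M
    rw [htop M hXM]
    exact IntermediateField.mem_top
  have h1 := trdeg_add_eq O R (A := L)
  rw [trdeg_eq_zero (R := R), add_zero] at h1
  rw [← h1]
  have hle : σ.genericPrime q O ≤ RingHom.ker y := by
    rw [← hz]
    exact σ.genericPrime_le_ker z
  let y' : (UnipotentRing n q O ⧸ σ.genericPrime q O) →ₐ[O] R :=
    Ideal.Quotient.liftₐ _ y.rangeRestrict fun a ha => Subtype.ext (hle ha)
  refine trdeg_le_of_surjective y' ?_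
  rintro ⟨_, a, rfl⟩
  exact ⟨Ideal.Quotient.mk _ a, rfl⟩

/-- The stratum of a given shape has dimension at least `n ^ 2`. -/
theorem le_trdeg_quotient_genericPrime [IsDomain O] (hq : IsUnit (q : O)) (σ : JordanType n) :
    ((n ^ 2 : ℕ) : Cardinal) ≤ Algebra.trdeg O (UnipotentRing n q O ⧸ σ.genericPrime q O) := by
  let F := FractionRing O
  -- The matrix `X` is taken to be the generic one, with `n ^ 2` independent entries.
  let L := FractionRing (MvPolynomial (Fin n × Fin n) F)
  let ι := algebraMap (MvPolynomial (Fin n × Fin n) F) L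
  have hι : Function.Injective ι := IsFractionRing.injective _ _
  have hX : IsUnit ((Matrix.mvPolynomialX (Fin n) (Fin n) F).map ι).det := by
    rw [← RingHom.mapMatrix_apply, ← RingHom.map_det, isUnit_iff_ne_zero,
      map_ne_zero_iff _ hι]
    exact Matrix.det_mvPolynomialX_ne_zero _ _
  refine le_trans ?_ (σ.trdeg_le_trdeg_quotient_genericPrime hq (F := F) (L := L) _ hX ?_)
  · have h3 := MvPolynomial.trdeg_of_isDomain (ι := Fin n × Fin n) (S := O)
    have h4 : Algebra.trdeg O (MvPolynomial (Fin n × Fin n) O) ≤ Algebra.trdeg O L := by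
      refine trdeg_le_of_injective
        ((IsScalarTower.toAlgHom O (MvPolynomial (Fin n × Fin n) F) L).comp
          (MvPolynomial.mapAlgHom (Algebra.ofId O F))) ?_
      exact hι.comp (MvPolynomial.map_injective _ (IsFractionRing.injective O F))
    rw [h3] at h4
    simpa [sq] using h4
  · intro M hM
    have hpoly : ∀ p, ι p ∈ M := by
      intro p
      induction p using MvPolynomial.induction_on with
      | C a => exact M.algebraMap_mem a
      | add p q hp hq =>
        rw [map_add]
        exact M.add_mem hp hq
      | mul_X p ij hp =>
        rw [map_mul]
        exact M.mul_mem hp (hM ij.1 ij.2)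
    rw [eq_top_iff]
    rintro x -
    obtain ⟨a, b, -, rfl⟩ := IsFractionRing.div_surjective (MvPolynomial (Fin n × Fin n) F) x
    exact M.div_mem (hpoly a) (hpoly b)

end JordanType

/-! ### Components of the moduli scheme and of its special fibre. -/

section ResidueTrdeg

theorem Algebra.adjoin_quotient_eq {O C : Type*} [CommRing O] [CommRing C] {I : Ideal O}
    [Algebra O C] [Algebra (O ⧸ I) C] [IsScalarTower O (O ⧸ I) C] (T : Set C) :
    (Algebra.adjoin (O ⧸ I) T).restrictScalars O = Algebra.adjoin O T := by
  apply le_antisymm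
  · intro z hz
    rw [Subalgebra.mem_restrictScalars] at hz
    induction hz using Algebra.adjoin_induction with
    | mem z hz => exact Algebra.subset_adjoin hz
    | algebraMap r =>
      obtain ⟨r, rfl⟩ := Ideal.Quotient.mk_surjective r
      rw [← Ideal.Quotient.algebraMap_eq, ← IsScalarTower.algebraMap_apply]
      exact Subalgebra.algebraMap_mem _ _
    | add x y _ _ hx hy => exact add_mem hx hy
    | mul x y _ _ hx hy => exact mul_mem hx hy
  · rw [Algebra.adjoin_le_iff]
    exact Algebra.subset_adjoin

/-- A transcendence basis of `B ⧸ p` is lifted to `B` and fed into `trdeg_le_of_mem_minimalPrimes`.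
With `s` empty it says that no component of the fibre over `m` has smaller dimension than expected.
-/
theorem trdeg_le_trdeg_quotient_add_of_mem_minimalPrimes {O B : Type u} [CommRing O] [CommRing B]
    [IsDomain B] [IsNoetherianRing B] [Algebra O B] [Algebra.FiniteType O B] (m : Ideal O)
    (s : Finset B) (p : Ideal B) [p.IsPrime] [p.LiesOver m]
    (hp : p ∈ (Ideal.span (s : Set B) ⊔ m.map (algebraMap O B)).minimalPrimes) :
    Algebra.trdeg O B ≤ Algebra.trdeg (O ⧸ m) (B ⧸ p) + s.card := by
  have : Nontrivial (O ⧸ m) := (FaithfulSMul.algebraMap_injective (O ⧸ m) (B ⧸ p)).isDomain _ |>.toNontrivial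
  obtain ⟨ι, x, hx⟩ := exists_isTranscendenceBasis' (O ⧸ m) (B ⧸ p)
  choose x' hx' using fun i => Ideal.Quotient.mk_surjective (x i)
  rw [← hx.cardinalMk_eq_trdeg]
  refine trdeg_le_of_mem_minimalPrimes x' s p (by rwa [← p.over_def m]) ?_
  have h1 : Ideal.Quotient.mk p ∘ x' = x := funext hx'
  rw [h1, ← Algebra.adjoin_quotient_eq (I := m)]
  exact hx.isAlgebraic

end ResidueTrdeg

section Ranks

variable {n : ℕ}

theorem rank_map_sub_one_pow_le_of_ker_le {A E E' : Type*} [CommRing A] [Field E] [Field E']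
    (x : A →+* E) (x' : A →+* E') (h : RingHom.ker x ≤ RingHom.ker x')
    (M : Matrix (Fin n) (Fin n) A) (a : ℕ) :
    ((M.map x' - 1) ^ a).rank ≤ ((M.map x - 1) ^ a).rank := by
  have h1 := rank_map_le_rank_map (Ideal.Quotient.lift (RingHom.ker x) x' h) (RingHom.kerLift x)
    (RingHom.kerLift_injective x) ((M.map (Ideal.Quotient.mk (RingHom.ker x)) - 1) ^ a)
  rw [Matrix.map_sub_one_pow_map, Matrix.map_sub_one_pow_map] at h1
  exact h1

end Ranks

namespace JordanType

variable {n : ℕ} {q : ℤ} {O : Type u} [CommRing O] [IsDomain O]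

theorem ker_residuePoint_bot_comp (hq : IsUnit (q : O)) (σ : JordanType n) :
    ∃ (L : Type u) (_ : Field L) (_ : Algebra O L)
      (y : σ.ParamRing (zpowPoly n q) O →ₐ[O] L),
      RingHom.ker (y.comp (σ.paramMap q O)) = σ.genericPrime q O := by
  have := σ.isDomain_paramRing (O := O) (zpowPoly n q) (by rwa [coeff_zero_zpowPoly])
  refine ⟨_, inferInstance, inferInstance,
    (⊥ : Ideal (σ.ParamRing (zpowPoly n q) O)).residuePoint, ?_⟩
  ext a
  rw [RingHom.mem_ker, AlgHom.comp_apply, ← RingHom.mem_ker, Ideal.ker_residuePoint,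
    Ideal.mem_bot]
  rfl

theorem ker_residuePoint_span_comp (hq : IsUnit (q : O)) {w : O} (hw : Prime w)
    (σ : JordanType n) : ∃ (L : Type u) (_ : Field L) (_ : Algebra O L)
      (y : σ.ParamRing (zpowPoly n q) O →ₐ[O] L),
      RingHom.ker (y.comp (σ.paramMap q O)) = σ.specialPrime q w := by
  have h := σ.prime_algebraMap_paramRing (O := O) (zpowPoly n q) hw (by rwa [coeff_zero_zpowPoly])
  have := (Ideal.span_singleton_prime h.ne_zero).2 h
  refine ⟨_, inferInstance, inferInstance,
    (Ideal.span {algebraMap O (σ.ParamRing (zpowPoly n q) O) w}).residuePoint, ?_⟩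
  ext a
  rw [RingHom.mem_ker, AlgHom.comp_apply, ← RingHom.mem_ker, Ideal.ker_residuePoint]
  rfl

/-- By semicontinuity in both directions, the ranks at a point depend only on its kernel. So they
may be computed on the parameter space, where the matrix is conjugate to `nilp`. -/
theorem rank_of_ker_eq_genericPrime (hq : IsUnit (q : O)) (σ : JordanType n) {E : Type*}
    [Field E] (x : UnipotentRing n q O →+* E) (hx : RingHom.ker x = σ.genericPrime q O) (a : ℕ) :
    (((univS _ q).map x - 1) ^ a).rank = σ.rank a := by
  obtain ⟨L, _, _, y, hy⟩ := σ.ker_residuePoint_bot_comp hq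
  rw [← σ.rank_univS_map_comp y]
  exact le_antisymm
    (rank_map_sub_one_pow_le_of_ker_le (y.comp (σ.paramMap q O)).toRingHom x (hy.trans hx.symm).le _ _)
    (rank_map_sub_one_pow_le_of_ker_le x (y.comp (σ.paramMap q O)).toRingHom (hx.trans hy.symm).le _ _)

theorem rank_of_ker_eq_specialPrime (hq : IsUnit (q : O)) {w : O} (hw : Prime w)
    (σ : JordanType n) {E : Type*} [Field E] (x : UnipotentRing n q O →+* E)
    (hx : RingHom.ker x = σ.specialPrime q w) (a : ℕ) :
    (((univS _ q).map x - 1) ^ a).rank = σ.rank a := by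
  obtain ⟨L, _, _, y, hy⟩ := σ.ker_residuePoint_span_comp hq hw
  rw [← σ.rank_univS_map_comp y]
  exact le_antisymm
    (rank_map_sub_one_pow_le_of_ker_le (y.comp (σ.paramMap q O)).toRingHom x (hy.trans hx.symm).le _ _)
    (rank_map_sub_one_pow_le_of_ker_le x (y.comp (σ.paramMap q O)).toRingHom (hx.trans hy.symm).le _ _)

/-- Shapes with equal ranks may differ as labelled shapes; the generic point of one parameter space
factors through the parametrisation by the other. -/
theorem genericPrime_eq_of_rank_eq (hq : IsUnit (q : O)) {σ τ : JordanType n}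
    (h : σ.rank = τ.rank) : σ.genericPrime q O = τ.genericPrime q O := by
  suffices key : ∀ {σ τ : JordanType n}, σ.rank = τ.rank →
      σ.genericPrime q O ≤ τ.genericPrime q O from le_antisymm (key h) (key h.symm)
  intro σ τ h
  obtain ⟨L, _, _, y, hy⟩ := τ.ker_residuePoint_bot_comp hq
  obtain ⟨z, hz⟩ := σ.exists_comp_paramMap_eq_of_rank
    (by simpa using hq.map (algebraMap O L)) (y.comp (τ.paramMap q O)) fun a => by
      rw [h, τ.rank_univS_map_comp]
  rw [← hy, ← hz]
  exact σ.genericPrime_le_ker z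

theorem specialPrime_eq_of_rank_eq (hq : IsUnit (q : O)) {w : O} (hw : Prime w)
    {σ τ : JordanType n} (h : σ.rank = τ.rank) : σ.specialPrime q w = τ.specialPrime q w := by
  suffices key : ∀ {σ τ : JordanType n}, σ.rank = τ.rank →
      σ.specialPrime q w ≤ τ.specialPrime q w from le_antisymm (key h) (key h.symm)
  intro σ τ h
  obtain ⟨L, _, _, y, hy⟩ := τ.ker_residuePoint_span_comp hq hw
  obtain ⟨z, hz⟩ := σ.exists_comp_paramMap_eq_of_rank
    (by simpa using hq.map (algebraMap O L)) (y.comp (τ.paramMap q O)) fun a => by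
      rw [h, τ.rank_univS_map_comp]
  have hw0 : algebraMap O L w = 0 := by
    have h1 := τ.algebraMap_mem_specialPrime q w
    rwa [← hy, RingHom.mem_ker, AlgHom.commutes] at h1
  rw [← hy, ← hz]
  exact σ.specialPrime_le_ker z hw0

variable {w : O}

theorem specialPrime_eq_of_genericPrime_le (l : ℕ) [Fact l.Prime] [CharP (O ⧸ Ideal.span {w}) l]
    (hq : IsUnit (q : O)) (hw : Prime w)
    {σ τ : JordanType n} (h : σ.genericPrime q O ≤ τ.specialPrime q w) :
    σ.specialPrime q w = τ.specialPrime q w :=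
  specialPrime_eq_of_rank_eq hq hw (rank_eq_of_genericPrime_le_specialPrime hq hw (l := l) h)

/-- The irreducible components of the moduli scheme are the closures of the strata. -/
theorem mem_minimalPrimes_iff (l : ℕ) [Fact l.Prime] [CharP (O ⧸ Ideal.span {w}) l]
    (hq : IsUnit (q : O)) (hw : Prime w)
    {p : Ideal (UnipotentRing n q O)} :
    p ∈ minimalPrimes (UnipotentRing n q O) ↔ ∃ σ : JordanType n, p = σ.genericPrime q O := by
  constructor
  · rintro ⟨⟨hp, -⟩, hmin⟩
    obtain ⟨σ, hσ, -⟩ := exists_genericPrime_le hq p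
    exact ⟨σ, le_antisymm (hmin ⟨σ.isPrime_genericPrime hq, bot_le⟩ hσ) hσ⟩
  · rintro ⟨σ, rfl⟩
    refine ⟨⟨σ.isPrime_genericPrime hq, bot_le⟩, ?_⟩
    rintro p ⟨hp, -⟩ hle
    obtain ⟨τ, hτ, -⟩ := exists_genericPrime_le hq p
    -- The inclusion of generic primes is weakened to one into a special prime, because the
    -- comparison of eigenvalues takes place in characteristic `l`.
    have h1 := rank_eq_of_genericPrime_le_specialPrime hq hw (l := l)
      ((hτ.trans hle).trans (σ.genericPrime_le_specialPrime q w))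
    rwa [genericPrime_eq_of_rank_eq hq h1] at hτ

/-- The irreducible components of the fibre are the closures of the strata of the fibre. -/
theorem mem_minimalPrimes_span_iff (l : ℕ) [Fact l.Prime] [CharP (O ⧸ Ideal.span {w}) l]
    (hq : IsUnit (q : O)) (hw : Prime w)
    {p : Ideal (UnipotentRing n q O)} :
    p ∈ (Ideal.span {algebraMap O (UnipotentRing n q O) w}).minimalPrimes ↔
      ∃ σ : JordanType n, p = σ.specialPrime q w := by
  have hle : ∀ σ : JordanType n, Ideal.span {algebraMap O _ w} ≤ σ.specialPrime q w := fun σ => by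
    rw [Ideal.span_singleton_le_iff_mem]
    exact σ.algebraMap_mem_specialPrime q w
  constructor
  · rintro ⟨⟨hp, hwp⟩, hmin⟩
    rw [Ideal.span_singleton_le_iff_mem] at hwp
    obtain ⟨σ, -, hσ⟩ := exists_genericPrime_le hq p
    exact ⟨σ, le_antisymm (hmin ⟨σ.isPrime_specialPrime hq hw, hle σ⟩ (hσ w hwp)) (hσ w hwp)⟩
  · rintro ⟨σ, rfl⟩
    refine ⟨⟨σ.isPrime_specialPrime hq hw, hle σ⟩, ?_⟩
    rintro p ⟨hp, hwp⟩ hpσ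
    rw [Ideal.span_singleton_le_iff_mem] at hwp
    obtain ⟨τ, hτ, hτ'⟩ := exists_genericPrime_le hq p
    have h1 := specialPrime_eq_of_genericPrime_le l hq hw (hτ.trans hpσ)
    rw [← h1]
    exact hτ' w hwp

end JordanType

theorem Ideal.liesOver_span_singleton {O A : Type*} [CommRing O] [CommRing A] [Algebra O A] {w : O}
    (hm : (Ideal.span {w}).IsMaximal) (p : Ideal A) [hp : p.IsPrime]
    (hw : algebraMap O A w ∈ p) : p.LiesOver (Ideal.span {w}) := by
  refine ⟨hm.eq_of_le (Ideal.IsPrime.under O p).ne_top ?_⟩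
  rw [Ideal.span_singleton_le_iff_mem]
  exact hw

theorem exists_field_ringHom_injective (R : Type u) [CommRing R] [IsDomain R] :
    ∃ (K : Type u) (_ : Field K) (ι : R →+* K), Function.Injective ι :=
  ⟨FractionRing R, inferInstance, algebraMap _ _, IsFractionRing.injective _ _⟩

namespace JordanType

variable {n : ℕ} {q : ℤ} {O : Type u} [CommRing O] [IsDomain O] {w : O}

theorem trdeg_quotient_specialPrime_le (hq : IsUnit (q : O)) (hw : Prime w)
    (hm : (Ideal.span {w}).IsMaximal) (σ : JordanType n)
    [h : (σ.specialPrime q w).LiesOver (Ideal.span {w})] :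
    Algebra.trdeg (O ⧸ Ideal.span {w}) (UnipotentRing n q O ⧸ σ.specialPrime q w) ≤
      (n ^ 2 : ℕ) := by
  have := σ.isPrime_specialPrime hq hw
  let _ := Ideal.Quotient.field (Ideal.span {w})
  let L := FractionRing (UnipotentRing n q O ⧸ σ.specialPrime q w)
  have : IsScalarTower O (O ⧸ Ideal.span {w}) L := .of_algebraMap_eq fun r => by
    rw [IsScalarTower.algebraMap_apply (O ⧸ Ideal.span {w})
      (UnipotentRing n q O ⧸ σ.specialPrime q w) L, ← IsScalarTower.algebraMap_apply O
      (O ⧸ Ideal.span {w}), ← IsScalarTower.algebraMap_apply]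
  have hqF : ((q : ℤ) : O ⧸ Ideal.span {w}) ≠ 0 := by
    simpa using (hq.map (algebraMap O (O ⧸ Ideal.span {w}))).ne_zero
  refine σ.trdeg_le_of_rank_univS_eq (F := O ⧸ Ideal.span {w}) (L := L) hqF
    (Ideal.Quotient.mkₐ O _) ?_ ?_
  · rw [(Ideal.Quotient.mkₐ_surjective O _).range_eq, Algebra.adjoin_univ]
  · exact σ.rank_of_ker_eq_specialPrime hq hw ((σ.specialPrime q w).residuePoint (O := O)).toRingHom
      (Ideal.ker_residuePoint (O := O) _)

theorem ringKrullDim_quotient_specialPrime_le (hq : IsUnit (q : O)) (hw : Prime w)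
    (hm : (Ideal.span {w}).IsMaximal) (σ : JordanType n) :
    ringKrullDim (UnipotentRing n q O ⧸ σ.specialPrime q w) ≤ (n ^ 2 : ℕ) := by
  have hp := σ.isPrime_specialPrime hq hw
  have := Ideal.liesOver_span_singleton hm _ (σ.algebraMap_mem_specialPrime q w)
  have h := σ.trdeg_quotient_specialPrime_le hq hw hm
  let _ := Ideal.Quotient.field (Ideal.span {w})
  have : Algebra.FiniteType (O ⧸ Ideal.span {w}) (UnipotentRing n q O ⧸ σ.specialPrime q w) :=
    Algebra.FiniteType.of_restrictScalars_finiteType O _ _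
  obtain ⟨m, hm1, hm2⟩ := exists_trdeg_eq_and_ringKrullDim_eq (O ⧸ Ideal.span {w})
    (UnipotentRing n q O ⧸ σ.specialPrime q w)
  rw [hm1, Nat.cast_le] at h
  rw [hm2]
  exact_mod_cast h

/-- The fibre of an irreducible component of the moduli scheme is irreducible. -/
theorem eq_specialPrime_of_mem_minimalPrimes [IsNoetherianRing O] (l : ℕ) [Fact l.Prime]
    [CharP (O ⧸ Ideal.span {w}) l] (hq : IsUnit (q : O)) (hw : Prime w)
    (hm : (Ideal.span {w}).IsMaximal) (σ : JordanType n) {p : Ideal (UnipotentRing n q O)}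
    (hp : p ∈ (σ.genericPrime q O ⊔ Ideal.span {algebraMap O _ w}).minimalPrimes) :
    p = σ.specialPrime q w := by
  have hP := σ.isPrime_genericPrime (O := O) hq
  let B := UnipotentRing n q O ⧸ σ.genericPrime q O
  let π := Ideal.Quotient.mk (σ.genericPrime q O)
  have hπ : Function.Surjective π := Ideal.Quotient.mk_surjective
  have hcomap : (((Ideal.span {w}).map (algebraMap O B)).comap π) =
      σ.genericPrime q O ⊔ Ideal.span {algebraMap O _ w} := by
    have h1 : (Ideal.span {w}).map (algebraMap O B) =
        (Ideal.span {algebraMap O (UnipotentRing n q O) w}).map π := by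
      rw [Ideal.map_span, Ideal.map_span, Set.image_singleton, Set.image_singleton]
      rfl
    rw [h1, Ideal.comap_map_of_surjective' _ hπ, Ideal.mk_ker, sup_comm]
  rw [← hcomap, Ideal.comap_minimalPrimes_eq_of_surjective hπ] at hp
  obtain ⟨p, hp, rfl⟩ := hp
  have hpp : p.IsPrime := hp.1.1
  have hwp : algebraMap O B w ∈ p :=
    hp.1.2 (Ideal.mem_map_of_mem _ (Ideal.mem_span_singleton_self w))
  have := Ideal.liesOver_span_singleton hm p hwp
  -- Only `w` is imposed, so the set of further equations is empty and the component of the fibre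
  -- keeps dimension at least `n ^ 2`.
  have h1 := trdeg_le_trdeg_quotient_add_of_mem_minimalPrimes (Ideal.span {w}) ∅ p
    (by rwa [Finset.coe_empty, Ideal.span_empty, bot_sup_eq])
  rw [Finset.card_empty, Nat.cast_zero, add_zero] at h1
  replace h1 := (σ.le_trdeg_quotient_genericPrime hq).trans h1
  have h2 : ((n ^ 2 : ℕ) : WithBot ℕ∞) ≤ ringKrullDim (B ⧸ p) := by
    let _ := Ideal.Quotient.field (Ideal.span {w})
    have : Algebra.FiniteType (O ⧸ Ideal.span {w}) (B ⧸ p) :=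
      Algebra.FiniteType.of_restrictScalars_finiteType O _ _
    obtain ⟨m, hm1, hm2⟩ := exists_trdeg_eq_and_ringKrullDim_eq (O ⧸ Ideal.span {w}) (B ⧸ p)
    rw [hm1, Nat.cast_le] at h1
    rw [hm2]
    exact_mod_cast h1
  obtain ⟨τ, -, hτ⟩ := exists_genericPrime_le hq (p.comap π)
  have hτp := hτ w hwp
  have hτprime := τ.isPrime_specialPrime hq hw
  -- The component lies in the closure of a special stratum, which is irreducible of dimension at
  -- most `n ^ 2`, so the two coincide.
  have hinj := injective_of_ringKrullDim_le
    (Ideal.Quotient.lift (τ.specialPrime q w) ((Ideal.Quotient.mk p).comp π) fun a ha =>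
      Ideal.Quotient.eq_zero_iff_mem.2 (hτp ha))
    (Ideal.Quotient.lift_surjective_of_surjective _ _ (Ideal.Quotient.mk_surjective.comp hπ))
    (τ.ringKrullDim_quotient_specialPrime_le hq hw hm) h2
  have hpτ : p.comap π = τ.specialPrime q w := by
    refine le_antisymm (fun a ha => ?_) hτp
    rw [← Ideal.Quotient.eq_zero_iff_mem]
    apply hinj
    rw [map_zero]
    exact Ideal.Quotient.eq_zero_iff_mem.2 ha
  rw [hpτ]
  refine (specialPrime_eq_of_genericPrime_le l hq hw ?_).symm
  rw [← hpτ]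
  intro a ha
  rw [Ideal.mem_comap, Ideal.Quotient.eq_zero_iff_mem.2 ha]
  exact Ideal.zero_mem _

theorem minimalPrimes_genericPrime_sup [IsNoetherianRing O] (l : ℕ) [Fact l.Prime]
    [CharP (O ⧸ Ideal.span {w}) l] (hq : IsUnit (q : O)) (hw : Prime w)
    (hm : (Ideal.span {w}).IsMaximal) (σ : JordanType n) :
    (σ.genericPrime q O ⊔ Ideal.span {algebraMap O _ w}).minimalPrimes =
      {σ.specialPrime q w} := by
  have := σ.isPrime_specialPrime hq hw
  have hle : σ.genericPrime q O ⊔ Ideal.span {algebraMap O _ w} ≤ σ.specialPrime q w := by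
    rw [sup_le_iff, Ideal.span_singleton_le_iff_mem]
    exact ⟨σ.genericPrime_le_specialPrime q w, σ.algebraMap_mem_specialPrime q w⟩
  obtain ⟨p, hp, -⟩ := Ideal.exists_minimalPrimes_le hle
  refine Set.Subset.antisymm (fun p hp =>
    σ.eq_specialPrime_of_mem_minimalPrimes l hq hw hm hp) ?_
  rw [Set.singleton_subset_iff, ← σ.eq_specialPrime_of_mem_minimalPrimes l hq hw hm hp]
  exact hp

/-- The fibre of an irreducible component of the moduli scheme is generically reduced. -/
theorem exists_mul_mem_genericPrime_sup (hq : IsUnit (q : O)) (hw : Prime w) (σ : JordanType n)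
    {x : UnipotentRing n q O} (hx : x ∈ σ.specialPrime q w) :
    ∃ u ∉ σ.specialPrime q w, u * x ∈ σ.genericPrime q O ⊔ Ideal.span {algebraMap O _ w} := by
  have hP := σ.isPrime_genericPrime (O := O) hq
  have hPk := σ.isPrime_specialPrime hq hw
  let B := UnipotentRing n q O ⧸ σ.genericPrime q O
  let π := Ideal.Quotient.mkₐ O (σ.genericPrime q O)
  have hπ : Function.Surjective π := Ideal.Quotient.mkₐ_surjective O _
  let p := (σ.specialPrime q w).map π
  have hker : RingHom.ker π = σ.genericPrime q O := Ideal.Quotient.mkₐ_ker O _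
  have hle := σ.genericPrime_le_specialPrime q w
  have hp : p.IsPrime := Ideal.map_isPrime_of_surjective hπ (hker.trans_le hle)
  have hpc : p.comap π = σ.specialPrime q w := by
    rw [Ideal.comap_map_of_surjective' _ hπ, hker, sup_eq_left.2 hle]
  -- The local ring of the component at the generic point of its fibre. At both its fraction field
  -- and its residue field the ranks of the powers of `N` are those of `σ`, so `N` has a Jordan form
  -- over `R` and `ψ` factors through the parameter ring.
  let R := Localization.AtPrime p
  let ψ : UnipotentRing n q O →ₐ[O] R := (IsScalarTower.toAlgHom O B R).comp π
  have : IsDomain R := IsLocalization.isDomain_localization p.primeCompl_le_nonZeroDivisors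
  have hBR : Function.Injective (algebraMap B R) :=
    IsLocalization.injective R p.primeCompl_le_nonZeroDivisors
  have hψker : ∀ a, ψ a = 0 ↔ a ∈ σ.genericPrime q O := fun a => by
    refine Iff.trans ?_ (Ideal.Quotient.eq_zero_iff_mem (I := σ.genericPrime q O))
    exact map_eq_zero_iff (algebraMap B R) hBR
  have hψmax : ∀ a, ψ a ∈ IsLocalRing.maximalIdeal R ↔ a ∈ σ.specialPrime q w := fun a => by
    rw [← hpc, Ideal.mem_comap]
    exact IsLocalization.AtPrime.to_map_mem_maximal_iff R p (π a)
  let N := (univS (fun _ : Fin n => (1 : Oˣ)) q).map ψ - 1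
  have hmap : ∀ {E : Type u} [Field E] (φ : R →+* E),
      N.map φ = (univS (fun _ : Fin n => (1 : Oˣ)) q).map (φ.comp (ψ : _ →+* R)) - 1 := fun φ => by
    rw [Matrix.map_sub_one, Matrix.map_map]
    rfl
  obtain ⟨K, _, ι, hι⟩ := exists_field_ringHom_injective R
  obtain ⟨g, hg, hN⟩ := exists_mul_eq_of_isLocalRing ι hι σ N
    (fun a => by
      rw [hmap]
      refine σ.rank_of_ker_eq_genericPrime hq _ ?_ a
      ext b
      rw [RingHom.mem_ker, RingHom.comp_apply, map_eq_zero_iff ι hι]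
      exact hψker b)
    (fun a => by
      rw [hmap]
      refine σ.rank_of_ker_eq_specialPrime hq hw _ ?_ a
      ext b
      rw [RingHom.mem_ker, RingHom.comp_apply, IsLocalRing.residue_eq_zero_iff]
      exact hψmax b)
  obtain ⟨y, hy⟩ := σ.exists_comp_paramMap_eq (by simpa using hq.map (algebraMap O R)) ψ hg hN
  rw [specialPrime, Ideal.mem_comap, Ideal.mem_span_singleton] at hx
  obtain ⟨d, hd⟩ := hx
  -- In the parameter ring the special prime consists of multiples of `w`, and this persists in `R`.
  -- Clearing the denominator of `y d` gives the required `u`.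
  have h1 : ψ x = algebraMap O R w * y d := by
    rw [← hy, AlgHom.comp_apply, hd, map_mul, AlgHom.commutes]
  obtain ⟨⟨b, u⟩, hbu⟩ := IsLocalization.mk'_surjective p.primeCompl (y d)
  obtain ⟨b, rfl⟩ := hπ b
  obtain ⟨u', hu'⟩ := hπ u
  have h2 : y d * ψ u' = ψ b := by
    change y d * algebraMap B R (π u') = algebraMap B R (π b)
    rw [← hbu, hu']
    exact IsLocalization.mk'_spec R _ _
  refine ⟨u', fun hu => u.2 ?_, ?_⟩
  · rw [← hu']
    rw [← hpc] at hu
    exact hu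
  · have h3 : u' * x - b * algebraMap O _ w ∈ σ.genericPrime q O := by
      rw [← hψker, map_sub, map_mul, map_mul, h1, ← h2, AlgHom.commutes]
      ring
    have h4 := Ideal.add_mem _ (Ideal.mem_sup_left (S := σ.genericPrime q O)
      (T := Ideal.span {algebraMap O (UnipotentRing n q O) w}) h3)
      (Ideal.mem_sup_right (Ideal.mul_mem_left _ b (Ideal.mem_span_singleton_self _)))
    rwa [sub_add_cancel] at h4

end JordanType

/-! ### Special fibres as quotients by a uniformizer. -/

section SpecialFibre

variable {O k : Type*} [CommRing O] [Field k] [Algebra O k] {w : O}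

theorem Algebra.TensorProduct.includeRight_surjective_of_surjective (C : Type*) [CommRing C]
    [Algebra O C] (hk : Function.Surjective (algebraMap O k)) :
    Function.Surjective (Algebra.TensorProduct.includeRight : C →ₐ[O] k ⊗[O] C) := by
  intro z
  induction z using TensorProduct.induction_on with
  | zero => exact ⟨0, map_zero _⟩
  | add x y hx hy =>
    obtain ⟨a, rfl⟩ := hx
    obtain ⟨b, rfl⟩ := hy
    exact ⟨a + b, map_add _ _ _⟩
  | tmul c x =>
    obtain ⟨r, rfl⟩ := hk c
    refine ⟨r • x, ?_⟩
    rw [Algebra.TensorProduct.includeRight_apply, TensorProduct.tmul_smul,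
      TensorProduct.smul_tmul', Algebra.smul_def, mul_one]

theorem Algebra.TensorProduct.ker_includeRight_of_surjective (C : Type*) [CommRing C]
    [Algebra O C] (hk : Function.Surjective (algebraMap O k))
    (hw : RingHom.ker (algebraMap O k) = Ideal.span {w}) :
    RingHom.ker (Algebra.TensorProduct.includeRight : C →ₐ[O] k ⊗[O] C) =
      Ideal.span {algebraMap O C w} := by
  have h := Algebra.TensorProduct.rTensor_ker (R := O) (S := O) (C := C) (Algebra.ofId O k) hk
  ext c
  have h1 : (Algebra.TensorProduct.includeRight : C →ₐ[O] k ⊗[O] C) c =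
      Algebra.TensorProduct.map (Algebra.ofId O k) (AlgHom.id O C)
        ((Algebra.TensorProduct.lid O C).symm c) := by
    simp
  have h2 : RingHom.ker (Algebra.ofId O k) = Ideal.span {w} := hw
  rw [RingHom.mem_ker, h1, ← RingHom.mem_ker, h, h2, Ideal.map_span, Set.image_singleton]
  have h3 := Ideal.mem_map_of_equiv (Algebra.TensorProduct.lid O C)
    (I := Ideal.span {Algebra.TensorProduct.includeLeft (S := O) (B := C) w}) c
  rw [Ideal.map_span, Set.image_singleton] at h3
  have h4 : Algebra.TensorProduct.lid O C (Algebra.TensorProduct.includeLeft (S := O) w) =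
      algebraMap O C w := by
    simp [Algebra.algebraMap_eq_smul_one]
  rw [h4] at h3
  rw [h3]
  constructor
  · intro hc
    exact ⟨_, hc, by simp⟩
  · rintro ⟨x, hx, rfl⟩
    simpa using hx

end SpecialFibre

/-- The hypothesis makes the maximal ideal of the local ring vanish, and nilpotents lie in it. -/
theorem isReduced_localization_of_forall_exists_mul_eq_zero {R : Type*} [CommRing R] (p : Ideal R)
    [hp : p.IsPrime] (h : ∀ x ∈ p, ∃ u ∉ p, u * x = 0) : IsReduced (Localization.AtPrime p) := by
  refine ⟨fun z hz => ?_⟩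
  obtain ⟨⟨x, s⟩, rfl⟩ := IsLocalization.mk'_surjective p.primeCompl z
  obtain ⟨m, hm⟩ := hz
  have hx : x ∈ p := by
    dsimp only at hm
    rw [← IsLocalization.mk'_pow, IsLocalization.mk'_eq_zero_iff] at hm
    obtain ⟨c, hc⟩ := hm
    have h1 : (c : R) * x ^ m ∈ p := by
      rw [hc]
      exact p.zero_mem
    exact hp.mem_of_pow_mem m ((hp.mem_or_mem h1).resolve_left c.2)
  obtain ⟨u, hu, hux⟩ := h x hx
  exact (IsLocalization.mk'_eq_zero_iff _ _).2 ⟨⟨u, hu⟩, hux⟩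

theorem PrimeSpectrum.irreducibleComponents_eq_image (R : Type*) [CommRing R] :
    irreducibleComponents (PrimeSpectrum R) =
      (fun p : Ideal R => PrimeSpectrum.zeroLocus (p : Set R)) '' minimalPrimes R :=
  (PrimeSpectrum.zeroLocus_minimalPrimes R).symm

section Fibre

variable {O k A : Type*} [CommRing O] [Field k] [Algebra O k] {w : O} [CommRing A] [Algebra O A]

theorem minimalPrimes_span_eq_image_comap (hk : Function.Surjective (algebraMap O k))
    (hw : RingHom.ker (algebraMap O k) = Ideal.span {w}) :
    (Ideal.span {algebraMap O A w}).minimalPrimes =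
      Ideal.comap (Algebra.TensorProduct.includeRight : A →ₐ[O] k ⊗[O] A).toRingHom ''
        minimalPrimes (k ⊗[O] A) := by
  rw [← Algebra.TensorProduct.ker_includeRight_of_surjective A hk hw]
  exact Ideal.comap_minimalPrimes_eq_of_surjective
    (Algebra.TensorProduct.includeRight_surjective_of_surjective A hk) ⊥

theorem ker_includeRight_comp_mk (hk : Function.Surjective (algebraMap O k))
    (hw : RingHom.ker (algebraMap O k) = Ideal.span {w}) (P : Ideal A) :
    RingHom.ker ((Algebra.TensorProduct.includeRight : (A ⧸ P) →ₐ[O] k ⊗[O] (A ⧸ P)).comp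
      (Ideal.Quotient.mkₐ O P)) = P ⊔ Ideal.span {algebraMap O A w} := by
  have h1 : Ideal.span {algebraMap O (A ⧸ P) w} =
      (Ideal.span {algebraMap O A w}).map (Ideal.Quotient.mk P) := by
    rw [Ideal.map_span, Set.image_singleton]
    rfl
  have h2 := Ideal.comap_map_of_surjective' (Ideal.Quotient.mk P) Ideal.Quotient.mk_surjective
    (Ideal.span {algebraMap O A w})
  rw [← h1, ← Algebra.TensorProduct.ker_includeRight_of_surjective (A ⧸ P) hk hw, Ideal.mk_ker,
    sup_comm] at h2
  rw [← h2]
  rfl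

theorem nonempty_and_isGenericallyReduced (hk : Function.Surjective (algebraMap O k))
    (hw : RingHom.ker (algebraMap O k) = Ideal.span {w}) {P p : Ideal A}
    (hmin : (P ⊔ Ideal.span {algebraMap O A w}).minimalPrimes = {p})
    (hred : ∀ x ∈ p, ∃ u ∉ p, u * x ∈ P ⊔ Ideal.span {algebraMap O A w}) :
    Nonempty (PrimeSpectrum (k ⊗[O] (A ⧸ P))) ∧ IsGenericallyReduced (k ⊗[O] (A ⧸ P)) := by
  let κ := (Algebra.TensorProduct.includeRight : (A ⧸ P) →ₐ[O] k ⊗[O] (A ⧸ P)).comp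
    (Ideal.Quotient.mkₐ O P)
  have hκ : Function.Surjective κ :=
    (Algebra.TensorProduct.includeRight_surjective_of_surjective (A ⧸ P) hk).comp
      (Ideal.Quotient.mkₐ_surjective O P)
  have hker := ker_includeRight_comp_mk hk hw P
  have hp : p ∈ (P ⊔ Ideal.span {algebraMap O A w}).minimalPrimes := by
    rw [hmin]
    rfl
  have hpp := hp.1.1
  constructor
  · have : Nontrivial (k ⊗[O] (A ⧸ P)) := by
      by_contra hs
      rw [not_nontrivial_iff_subsingleton] at hs
      refine hpp.ne_top ((Ideal.eq_top_iff_one _).2 (hp.1.2 ?_))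
      rw [← hker]
      exact Subsingleton.elim _ _
    infer_instance
  · intro Q hQ hQmin
    have h1 : Q.comap κ.toRingHom = p := by
      have h2 : Q.comap κ.toRingHom ∈ (P ⊔ Ideal.span {algebraMap O A w}).minimalPrimes := by
        rw [← hker]
        exact Ideal.minimalPrimes_comap_of_surjective (f := κ.toRingHom) hκ hQmin
      rwa [hmin] at h2
    refine isReduced_localization_of_forall_exists_mul_eq_zero Q fun x hx => ?_
    obtain ⟨a, rfl⟩ := hκ x
    obtain ⟨u, hu, hua⟩ := hred a (by rw [← h1]; exact hx)
    refine ⟨κ u, fun h => hu (by rw [← h1]; exact h), ?_⟩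
    rw [← map_mul, ← RingHom.mem_ker, hker]
    exact hua

/-- The fibre is cut out in the spectrum of `k ⊗ A` by an ideal whose preimage in `A` is the
vanishing ideal plus `(w)`. A prime contains that ideal exactly when it contains its only minimal
prime `p`. -/
theorem reducedFibre_eq_zeroLocus (hk : Function.Surjective (algebraMap O k))
    (hw : RingHom.ker (algebraMap O k) = Ideal.span {w}) {Z : Set (PrimeSpectrum A)} {p : Ideal A}
    (hmin : (PrimeSpectrum.vanishingIdeal Z ⊔ Ideal.span {algebraMap O A w}).minimalPrimes = {p})
    {Q : Ideal (k ⊗[O] A)}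
    (hQ : Q.comap (Algebra.TensorProduct.includeRight : A →ₐ[O] k ⊗[O] A).toRingHom = p) :
    reducedFibre O k Z = PrimeSpectrum.zeroLocus (Q : Set (k ⊗[O] A)) := by
  set P := PrimeSpectrum.vanishingIdeal Z
  let ψ := (Algebra.TensorProduct.map (AlgHom.id O k) (Ideal.Quotient.mkₐ O P)).toRingHom
  let κ := (Algebra.TensorProduct.includeRight : A →ₐ[O] k ⊗[O] A).toRingHom
  have hκ : Function.Surjective κ :=
    Algebra.TensorProduct.includeRight_surjective_of_surjective A hk
  have hψκ : ψ.comp κ = ((Algebra.TensorProduct.includeRight :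
      (A ⧸ P) →ₐ[O] k ⊗[O] (A ⧸ P)).comp (Ideal.Quotient.mkₐ O P)).toRingHom := by
    ext a
    simp [ψ, κ]
  have hψ : Function.Surjective ψ := by
    refine Function.Surjective.of_comp (g := κ) ?_
    rw [← RingHom.coe_comp, hψκ]
    exact (Algebra.TensorProduct.includeRight_surjective_of_surjective (A ⧸ P) hk).comp
      (Ideal.Quotient.mkₐ_surjective O P)
  have hkerψ : (RingHom.ker ψ).comap κ = P ⊔ Ideal.span {algebraMap O A w} := by
    rw [RingHom.comap_ker, hψκ]
    exact ker_includeRight_comp_mk hk hw P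
  have hle : ∀ I J : Ideal (k ⊗[O] A), I ≤ J ↔ I.comap κ ≤ J.comap κ := fun I J =>
    ⟨Ideal.comap_mono, fun h x hx => by
      obtain ⟨a, rfl⟩ := hκ x
      exact h hx⟩
  refine (range_comap_of_surjective _ ψ hψ).trans ?_
  ext x
  rw [PrimeSpectrum.mem_zeroLocus, PrimeSpectrum.mem_zeroLocus, SetLike.coe_subset_coe,
    SetLike.coe_subset_coe, hle, hle, hkerψ, hQ]
  have hx : (x.asIdeal.comap κ).IsPrime := Ideal.comap_isPrime _ _
  constructor
  · intro h
    obtain ⟨p', hp', hp'x⟩ := Ideal.exists_minimalPrimes_le h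
    rw [hmin] at hp'
    rwa [← Set.mem_singleton_iff.1 hp']
  · intro h
    have hp : p ∈ (P ⊔ Ideal.span {algebraMap O A w}).minimalPrimes := by
      rw [hmin]
      rfl
    exact hp.1.2.trans h

end Fibre

/-! ### Dimension of the generic fibre, and the statement on components. -/

section GenericFibre

open JordanType

variable {O : Type u} [CommRing O] [IsDomain O] {n : ℕ} {q : ℤ}

theorem JordanType.faithfulSMul_quotient_genericPrime (hq : IsUnit (q : O)) (σ : JordanType n) :
    FaithfulSMul O (UnipotentRing n q O ⧸ σ.genericPrime q O) := by
  rw [faithfulSMul_iff_algebraMap_injective, injective_iff_map_eq_zero]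
  intro r hr
  have h1 : algebraMap O (UnipotentRing n q O) r ∈ σ.genericPrime q O :=
    Ideal.Quotient.eq_zero_iff_mem.1 hr
  rw [genericPrime, RingHom.mem_ker, AlgHom.commutes,
    IsScalarTower.algebraMap_apply O (σ.ParamPoly O)] at h1
  have h2 := σ.algebraMap_paramRing_injective (zpowPoly n q) (by rwa [coeff_zero_zpowPoly])
    (h1.trans (map_zero _).symm)
  exact MvPolynomial.C_injective _ _ (h2.trans (map_zero _).symm)

/-- The generic fibre of an irreducible component of the moduli scheme has dimension `n ^ 2`. -/
theorem JordanType.ringKrullDim_tensor_quotient_genericPrime [IsNoetherianRing O]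
    (hq : IsUnit (q : O)) (σ : JordanType n) (K : Type u) [Field K] [Algebra O K]
    [IsFractionRing O K] :
    Nontrivial (K ⊗[O] (UnipotentRing n q O ⧸ σ.genericPrime q O)) ∧
    ringKrullDim (K ⊗[O] (UnipotentRing n q O ⧸ σ.genericPrime q O)) = (n ^ 2 : ℕ) := by
  have hP := σ.isPrime_genericPrime (O := O) hq
  let B := UnipotentRing n q O ⧸ σ.genericPrime q O
  have hOB : FaithfulSMul O B := σ.faithfulSMul_quotient_genericPrime hq
  let T := K ⊗[O] B
  let _ : Algebra B T := Algebra.TensorProduct.rightAlgebra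
  -- The generic fibre is the localization of `B` at the nonzero elements of `O`. So it is algebraic
  -- over `B`, and its transcendence degree over `K` is that of `B` over `O`.
  have hloc : IsLocalization (Algebra.algebraMapSubmonoid B (nonZeroDivisors O)) T :=
    IsLocalization.tensorRight K (nonZeroDivisors O)
  have hM : Algebra.algebraMapSubmonoid B (nonZeroDivisors O) ≤ nonZeroDivisors B :=
    algebraMapSubmonoid_le_nonZeroDivisors_of_faithfulSMul B le_rfl
  have hT : IsDomain T := IsLocalization.isDomain_of_le_nonZeroDivisors T hM
  have hBT : Function.Injective (algebraMap B T) := IsLocalization.injective T hM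
  have : FaithfulSMul B T := (faithfulSMul_iff_algebraMap_injective _ _).2 hBT
  have : IsScalarTower O B T := .of_algebraMap_eq fun r =>
    ((Algebra.TensorProduct.includeRight : B →ₐ[O] K ⊗[O] B).commutes r).symm
  have : Algebra.IsAlgebraic B T :=
    IsLocalization.isAlgebraic T (Algebra.algebraMapSubmonoid B (nonZeroDivisors O))
  have : FaithfulSMul K T := (faithfulSMul_iff_algebraMap_injective _ _).2 (algebraMap K T).injective
  have : Algebra.IsAlgebraic O K := IsLocalization.isAlgebraic K (nonZeroDivisors O)
  have h1 := trdeg_add_eq O K (A := T)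
  have h2 := trdeg_add_eq O B (A := T)
  rw [trdeg_eq_zero (R := O) (A := K), zero_add] at h1
  rw [trdeg_eq_zero (R := B) (A := T), add_zero] at h2
  have hlow : ((n ^ 2 : ℕ) : Cardinal) ≤ Algebra.trdeg K T := by
    rw [h1, ← h2]
    exact σ.le_trdeg_quotient_genericPrime hq
  refine ⟨inferInstance, ?_⟩
  have hup : Algebra.trdeg K T ≤ (n ^ 2 : ℕ) := by
    let x : UnipotentRing n q O →ₐ[O] T :=
      (Algebra.TensorProduct.includeRight : B →ₐ[O] K ⊗[O] B).comp (Ideal.Quotient.mkₐ O _)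
    have hqK : (q : K) ≠ 0 := by simpa using (hq.map (algebraMap O K)).ne_zero
    refine σ.trdeg_le_of_rank_univS_eq (F := K) (B := T) (L := FractionRing T) hqK x ?_ ?_
    · rw [eq_top_iff]
      rintro z -
      induction z using TensorProduct.induction_on with
      | zero => exact zero_mem _
      | add x y hx hy => exact add_mem hx hy
      | tmul c b =>
        obtain ⟨a, rfl⟩ := Ideal.Quotient.mk_surjective b
        have h3 : c ⊗ₜ[O] (Ideal.Quotient.mk (σ.genericPrime q O) a) = c • x a := by
          change _ = c • ((1 : K) ⊗ₜ[O] (Ideal.Quotient.mk (σ.genericPrime q O) a))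
          rw [TensorProduct.smul_tmul', smul_eq_mul, mul_one]
        rw [h3]
        exact Subalgebra.smul_mem _ (Algebra.subset_adjoin (Set.mem_range_self a)) c
    · refine σ.rank_of_ker_eq_genericPrime hq
        ((IsScalarTower.toAlgHom O T (FractionRing T)).comp x).toRingHom ?_
      ext a
      rw [RingHom.mem_ker]
      change algebraMap T (FractionRing T) (algebraMap B T (Ideal.Quotient.mk _ a)) = 0 ↔ _
      rw [FaithfulSMul.algebraMap_eq_zero_iff, map_eq_zero_iff _ hBT,
        Ideal.Quotient.eq_zero_iff_mem]
  obtain ⟨m, hm1, hm2⟩ := exists_trdeg_eq_and_ringKrullDim_eq K T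
  rw [hm1, Nat.cast_le] at hlow hup
  rw [hm2, le_antisymm hup hlow]

end GenericFibre

section UnipotentComponents

open JordanType

variable {O : Type u} [CommRing O] [IsDomain O] {n : ℕ} {q : ℤ} {w : O}

theorem exists_vanishingIdeal_eq_genericPrime (l : ℕ) [Fact l.Prime]
    [CharP (O ⧸ Ideal.span {w}) l] (hq : IsUnit (q : O)) (hw : Prime w)
    {Z : Set (PrimeSpectrum (UnipotentRing n q O))} (hZ : Z ∈ irreducibleComponents _) :
    ∃ σ : JordanType n, PrimeSpectrum.vanishingIdeal Z = σ.genericPrime q O := by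
  rw [← mem_minimalPrimes_iff l hq hw, ← PrimeSpectrum.vanishingIdeal_irreducibleComponents]
  exact ⟨Z, hZ, rfl⟩

/-- On both sides the components are closures of strata, and the fibre of the closure of the generic
point of type `σ` is the closure of the special point of type `σ`. Injectivity is the comparison of
ranks. -/
theorem bijOn_reducedFibre [IsNoetherianRing O] (l : ℕ) [Fact l.Prime]
    [CharP (O ⧸ Ideal.span {w}) l] (hq : IsUnit (q : O)) (hw : Prime w)
    (hm : (Ideal.span {w}).IsMaximal) {k : Type u} [Field k] [Algebra O k]
    (hk : Function.Surjective (algebraMap O k))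
    (hker : RingHom.ker (algebraMap O k) = Ideal.span {w}) :
    Set.BijOn (fun Z : Set (PrimeSpectrum (UnipotentRing n q O)) => reducedFibre O k Z)
      (irreducibleComponents (PrimeSpectrum (UnipotentRing n q O)))
      (irreducibleComponents (PrimeSpectrum (k ⊗[O] UnipotentRing n q O))) := by
  have hfibre : ∀ (σ : JordanType n) (Z : Set (PrimeSpectrum (UnipotentRing n q O))),
      PrimeSpectrum.vanishingIdeal Z = σ.genericPrime q O →
      ∃ Q ∈ minimalPrimes (k ⊗[O] UnipotentRing n q O),
        Q.comap (Algebra.TensorProduct.includeRight :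
          UnipotentRing n q O →ₐ[O] k ⊗[O] UnipotentRing n q O).toRingHom = σ.specialPrime q w ∧
        reducedFibre O k Z = PrimeSpectrum.zeroLocus (Q : Set (k ⊗[O] UnipotentRing n q O)) := by
    intro σ Z hZ
    have h1 := (mem_minimalPrimes_span_iff l hq hw).2 ⟨σ, rfl⟩
    rw [minimalPrimes_span_eq_image_comap hk hker] at h1
    obtain ⟨Q, hQ, hQσ⟩ := h1
    refine ⟨Q, hQ, hQσ, reducedFibre_eq_zeroLocus hk hker ?_ hQσ⟩
    rw [hZ]
    exact minimalPrimes_genericPrime_sup l hq hw hm σ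
  have hzero : ∀ Q Q' : Ideal (k ⊗[O] UnipotentRing n q O), Q.IsPrime → Q'.IsPrime →
      PrimeSpectrum.zeroLocus (Q : Set (k ⊗[O] UnipotentRing n q O)) =
        PrimeSpectrum.zeroLocus Q' → Q = Q' := by
    intro Q Q' hQ hQ' h
    have h1 := congrArg PrimeSpectrum.vanishingIdeal h
    rwa [PrimeSpectrum.vanishingIdeal_zeroLocus_eq_radical,
      PrimeSpectrum.vanishingIdeal_zeroLocus_eq_radical, hQ.radical, hQ'.radical] at h1
  refine ⟨?_, ?_, ?_⟩
  · intro Z hZ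
    obtain ⟨σ, hσ⟩ := exists_vanishingIdeal_eq_genericPrime l hq hw hZ
    obtain ⟨Q, hQ, -, h⟩ := hfibre σ Z hσ
    rw [PrimeSpectrum.irreducibleComponents_eq_image]
    exact ⟨Q, hQ, h.symm⟩
  · intro Z hZ Z' hZ' hZZ'
    obtain ⟨σ, hσ⟩ := exists_vanishingIdeal_eq_genericPrime l hq hw hZ
    obtain ⟨τ, hτ⟩ := exists_vanishingIdeal_eq_genericPrime l hq hw hZ'
    obtain ⟨Q, hQ, hQσ, h⟩ := hfibre σ Z hσ
    obtain ⟨Q', hQ', hQτ, h'⟩ := hfibre τ Z' hτ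
    have h1 : Q = Q' := hzero Q Q' hQ.1.1 hQ'.1.1 (h.symm.trans (hZZ'.trans h'))
    have h2 : σ.genericPrime q O = τ.genericPrime q O := by
      refine genericPrime_eq_of_rank_eq hq
        (rank_eq_of_genericPrime_le_specialPrime (l := l) hq hw ?_)
      rw [← hQτ, ← h1, hQσ]
      exact σ.genericPrime_le_specialPrime q w
    rw [← (isClosed_of_mem_irreducibleComponents Z hZ).closure_eq,
      ← (isClosed_of_mem_irreducibleComponents Z' hZ').closure_eq,
      ← PrimeSpectrum.zeroLocus_vanishingIdeal_eq_closure,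
      ← PrimeSpectrum.zeroLocus_vanishingIdeal_eq_closure, hσ, hτ, h2]
  · intro Y hY
    rw [PrimeSpectrum.irreducibleComponents_eq_image] at hY
    obtain ⟨Q, hQ, rfl⟩ := hY
    have h1 := Set.mem_image_of_mem (Ideal.comap (Algebra.TensorProduct.includeRight :
      UnipotentRing n q O →ₐ[O] k ⊗[O] UnipotentRing n q O).toRingHom) hQ
    rw [← minimalPrimes_span_eq_image_comap hk hker, mem_minimalPrimes_span_iff l hq hw] at h1
    obtain ⟨σ, hσ⟩ := h1
    have hP := σ.isPrime_genericPrime (O := O) hq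
    have hZσ : PrimeSpectrum.vanishingIdeal (PrimeSpectrum.zeroLocus
        (σ.genericPrime q O : Set (UnipotentRing n q O))) = σ.genericPrime q O := by
      rw [PrimeSpectrum.vanishingIdeal_zeroLocus_eq_radical, hP.radical]
    refine ⟨PrimeSpectrum.zeroLocus (σ.genericPrime q O), ?_, ?_⟩
    · rw [PrimeSpectrum.irreducibleComponents_eq_image]
      exact ⟨_, (mem_minimalPrimes_iff l hq hw).2 ⟨σ, rfl⟩, rfl⟩
    · refine reducedFibre_eq_zeroLocus hk hker ?_ hσ
      rw [hZσ]
      exact minimalPrimes_genericPrime_sup l hq hw hm σ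

/-- The components of the moduli scheme of pairs `(Φ, Σ)` with `Σ` unipotent and their fibres. -/
theorem unipotentRing_components [IsNoetherianRing O] (l : ℕ) [Fact l.Prime]
    [CharP (O ⧸ Ideal.span {w}) l] (hq : IsUnit (q : O)) (hw : Prime w)
    (hm : (Ideal.span {w}).IsMaximal) (K : Type u) [Field K] [Algebra O K] [IsFractionRing O K]
    (k : Type u) [Field k] [Algebra O k] (hk : Function.Surjective (algebraMap O k))
    (hker : RingHom.ker (algebraMap O k) = Ideal.span {w}) :
    (∀ Z ∈ irreducibleComponents (PrimeSpectrum (UnipotentRing n q O)),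
      Nonempty (PrimeSpectrum (ReducedFibreRing O K Z)) ∧
      ringKrullDim (ReducedFibreRing O K Z) = ((n ^ 2 : ℕ) : WithBot ℕ∞)) ∧
    Set.BijOn (fun Z : Set (PrimeSpectrum (UnipotentRing n q O)) => reducedFibre O k Z)
      (irreducibleComponents (PrimeSpectrum (UnipotentRing n q O)))
      (irreducibleComponents (PrimeSpectrum (k ⊗[O] UnipotentRing n q O))) ∧
    ∀ Z ∈ irreducibleComponents (PrimeSpectrum (UnipotentRing n q O)),
      Nonempty (PrimeSpectrum (ReducedFibreRing O k Z)) ∧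
      IsGenericallyReduced (ReducedFibreRing O k Z) := by
  refine ⟨fun Z hZ => ?_, bijOn_reducedFibre l hq hw hm hk hker, fun Z hZ => ?_⟩
  · obtain ⟨σ, hσ⟩ := exists_vanishingIdeal_eq_genericPrime l hq hw hZ
    obtain ⟨h1, h2⟩ := σ.ringKrullDim_tensor_quotient_genericPrime hq K
    unfold ReducedFibreRing
    rw [hσ]
    exact ⟨inferInstance, h2⟩
  · obtain ⟨σ, hσ⟩ := exists_vanishingIdeal_eq_genericPrime l hq hw hZ
    unfold ReducedFibreRing
    rw [hσ]
    exact nonempty_and_isGenericallyReduced hk hker (minimalPrimes_genericPrime_sup l hq hw hm σ)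
      fun x hx => exists_mul_mem_genericPrime_sup hq hw σ hx

end UnipotentComponents

/-! ### Commuting pairs: splitting into cyclic blocks. -/

section CyclicDecomposition

variable {E V : Type*} [Field E] [AddCommGroup V] [Module E V]

/-- If `v` were a combination of the later vectors, `N` to the power one below the vanishing
exponent would already kill it. -/
theorem linearIndependent_pow_apply (N : Module.End E V) {v : V} {s : ℕ}
    (h0 : ∀ a < s, (N ^ a) v ≠ 0) (h1 : (N ^ s) v = 0) :
    LinearIndependent E fun a : Fin s => (N ^ (a : ℕ)) v := by
  induction s generalizing v with
  | zero => exact linearIndependent_empty_type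
  | succ s ih =>
    have h2 : LinearIndependent E fun a : Fin s => (N ^ (a : ℕ)) (N v) := by
      refine ih (fun a ha => ?_) ?_
      · rw [← Module.End.mul_apply, ← pow_succ]
        exact h0 _ (Nat.succ_lt_succ ha)
      · rw [← Module.End.mul_apply, ← pow_succ]
        exact h1
    have h3 : (fun a : Fin (s + 1) => (N ^ (a : ℕ)) v) =
        Fin.cons v fun a : Fin s => (N ^ (a : ℕ)) (N v) := by
      funext a
      refine Fin.cases ?_ (fun a => ?_) a
      · simp
      · rw [Fin.cons_succ, Fin.val_succ, pow_succ, Module.End.mul_apply]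
    rw [h3, linearIndependent_finCons]
    refine ⟨h2, fun hv => h0 s (Nat.lt_succ_self s) ?_⟩
    have h4 : Submodule.span E (Set.range fun a : Fin s => (N ^ (a : ℕ)) (N v)) ≤
        LinearMap.ker (N ^ s) := by
      rw [Submodule.span_le]
      rintro _ ⟨a, rfl⟩
      rw [SetLike.mem_coe, LinearMap.mem_ker, ← Module.End.mul_apply, ← Module.End.mul_apply,
        mul_assoc, ← pow_succ, ← pow_add, show s + (a + 1) = a + (s + 1) by omega, pow_add,
        Module.End.mul_apply, h1, map_zero]
    exact h4 hv

/-- If the cokernel of a nilpotent endomorphism `N` is spanned by generalized eigenvectors with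
distinct eigenvalues of an endomorphism commuting with `N`, the space is a direct sum of cyclic
`N`-submodules generated by them. -/
theorem exists_basis_pow_apply {P N : Module.End E V} (hPN : Commute P N) {m : ℕ}
    (hN : N ^ m = 0) {r : ℕ} {t : Fin r → E} (ht : Function.Injective t) {v : Fin r → V}
    (hv0 : ∀ i, v i ≠ 0) (hv : ∀ i, v i ∈ P.maxGenEigenspace (t i))
    (htop : Submodule.span E (Set.range v) ⊔ LinearMap.range N = ⊤) :
    ∃ (s : Fin r → ℕ) (b : Module.Basis (Σ i, Fin (s i)) E V), (∀ i, 0 < s i) ∧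
      (∀ i a, b ⟨i, a⟩ = (N ^ (a : ℕ)) (v i)) ∧ (∀ i, (N ^ s i) (v i) = 0) ∧
      ∀ i, ∀ u ∈ P.maxGenEigenspace (t i), ∃ c : ℕ → E,
        u = ∑ a ∈ Finset.range (s i), c a • (N ^ a) (v i) := by
  classical
  have hex : ∀ i, ∃ s, (N ^ s) (v i) = 0 := fun i => ⟨m, by rw [hN]; rfl⟩
  let s : Fin r → ℕ := fun i => Nat.find (hex i)
  have hs : ∀ i, (N ^ s i) (v i) = 0 := fun i => Nat.find_spec (hex i)
  have hs' : ∀ i, ∀ a < s i, (N ^ a) (v i) ≠ 0 := fun i a ha => Nat.find_min (hex i) ha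
  have hmem : ∀ i (a : ℕ), (N ^ a) (v i) ∈ P.maxGenEigenspace (t i) := fun i a =>
    P.mapsTo_maxGenEigenspace_of_comm (hPN.pow_right a) (t i) (hv i)
  have hind : iSupIndep fun i => P.maxGenEigenspace (t i) :=
    P.independent_maxGenEigenspace.comp ht
  have hle : ∀ i, Submodule.span E (Set.range fun a : Fin (s i) => (N ^ (a : ℕ)) (v i)) ≤
      P.maxGenEigenspace (t i) := fun i => by
    rw [Submodule.span_le]
    rintro _ ⟨a, rfl⟩
    exact hmem i a
  -- Within one `i` this is independence of the powers; across different `i` it is independence of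
  -- generalized eigenspaces for distinct eigenvalues.
  have hli : LinearIndependent E fun x : Σ i, Fin (s i) => (N ^ (x.2 : ℕ)) (v x.1) := by
    refine linearIndependent_iUnion_finite
      (f := fun i (a : Fin (s i)) => (N ^ (a : ℕ)) (v i))
      (fun i => linearIndependent_pow_apply N (hs' i) (hs i)) fun i T _ hiT => ?_
    refine (hind i).mono (hle i) ?_
    refine iSup₂_le fun j hj => (hle j).trans ?_
    exact le_iSup₂_of_le j (fun h => hiT (h ▸ hj)) le_rfl
  have hspan : ⊤ ≤ Submodule.span E
      (Set.range fun x : Σ i, Fin (s i) => (N ^ (x.2 : ℕ)) (v x.1)) := by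
    set W := Submodule.span E (Set.range fun x : Σ i, Fin (s i) => (N ^ (x.2 : ℕ)) (v x.1))
    have hW : ∀ i (a : ℕ), (N ^ a) (v i) ∈ W := by
      intro i a
      rcases lt_or_ge a (s i) with h | h
      · exact Submodule.subset_span ⟨⟨i, ⟨a, h⟩⟩, rfl⟩
      · obtain ⟨d, rfl⟩ := Nat.exists_eq_add_of_le h
        rw [add_comm, pow_add, Module.End.mul_apply, hs, map_zero]
        exact W.zero_mem
    have hNW : W ≤ W.comap N := by
      rw [Submodule.span_le]
      rintro _ ⟨⟨i, a⟩, rfl⟩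
      change N ((N ^ (a : ℕ)) (v i)) ∈ W
      rw [← Module.End.mul_apply, ← pow_succ']
      exact hW i _
    -- Nakayama's argument: `W` and the image of `N` span, so `W` and the image of any power of `N`
    -- span, and some power is zero.
    have hstep : ∀ a, W ⊔ LinearMap.range (N ^ a) = ⊤ := by
      intro a
      induction a with
      | zero => rw [pow_zero, Module.End.one_eq_id, LinearMap.range_id, sup_top_eq]
      | succ a ih =>
        rw [eq_top_iff, ← htop, sup_le_iff, Submodule.span_le]
        constructor
        · rintro _ ⟨i, rfl⟩
          exact Submodule.mem_sup_left (hW i 0)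
        · rintro _ ⟨x, rfl⟩
          obtain ⟨y, hy, _, ⟨z, rfl⟩, rfl⟩ := Submodule.mem_sup.1 (ih ▸ Submodule.mem_top : x ∈ _)
          rw [map_add]
          refine Submodule.add_mem_sup (hNW hy) ⟨z, ?_⟩
          rw [pow_succ', Module.End.mul_apply]
    have h1 := hstep m
    rw [hN, LinearMap.range_zero, sup_bot_eq] at h1
    exact h1.ge
  let b := Module.Basis.mk hli hspan
  have hb : ∀ i a, b ⟨i, a⟩ = (N ^ (a : ℕ)) (v i) := fun i a => Module.Basis.mk_apply hli hspan _
  refine ⟨s, b, fun i => ?_, hb, hs, fun i u hu => ?_⟩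
  · by_contra h
    have h1 := hs i
    rw [Nat.eq_zero_of_not_pos h, pow_zero] at h1
    exact hv0 i h1
  · let w : Fin r → V := fun k => ∑ a, b.repr u ⟨k, a⟩ • (N ^ (a : ℕ)) (v k)
    have hw : ∀ k, w k ∈ P.maxGenEigenspace (t k) := fun k =>
      Submodule.sum_mem _ fun a _ => Submodule.smul_mem _ _ (hmem k a)
    have hu' : u = ∑ k, w k := by
      conv_lhs => rw [← b.sum_repr u, Fintype.sum_sigma]
      simp only [hb, w]
    -- The difference `u - w i` lies in the `i`-th generalized eigenspace and in the sum of the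
    -- others, so it vanishes.
    have h1 : u - w i ∈ ⨆ k, ⨆ (_ : k ≠ i), P.maxGenEigenspace (t k) := by
      rw [hu', ← Finset.add_sum_erase _ _ (Finset.mem_univ i), add_sub_cancel_left]
      refine Submodule.sum_mem _ fun k hk => ?_
      exact Submodule.mem_iSup_of_mem k
        (Submodule.mem_iSup_of_mem (Finset.ne_of_mem_erase hk) (hw k))
    have h2 := Submodule.disjoint_def.1 (hind i) _ (Submodule.sub_mem _ hu (hw i)) h1
    refine ⟨fun a => if h : a < s i then b.repr u ⟨i, ⟨a, h⟩⟩ else 0, ?_⟩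
    refine (sub_eq_zero.1 h2).trans ?_
    rw [← Fin.sum_univ_eq_sum_range
      (fun a => (if h : a < s i then b.repr u ⟨i, ⟨a, h⟩⟩ else 0) • (N ^ a) (v i))]
    simp [w]

end CyclicDecomposition

namespace JordanType

variable {n : ℕ} (σ : JordanType n)

section Head

variable {R : Type*} [CommRing R]

/-- The action of a matrix commuting with `nilp` on the cokernel of `nilp`. -/
def head (P : Matrix (Fin n) (Fin n) R) : Matrix (Fin σ.parts) (Fin σ.parts) R :=
  P.submatrix σ.base σ.base

variable {σ} {P : Matrix (Fin n) (Fin n) R}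

/-- The rows of `nilp` at the block starts are zero, hence so are those of `nilp * P`; on the other
side right multiplication by `nilp` shifts columns. It follows that `head P` describes the action on
the cokernel. -/
theorem apply_base_eq_zero (hP : P * σ.nilp R = σ.nilp R * P) (i : Fin σ.parts) {j : Fin n}
    (hj : σ.pos j ≠ 0) : P (σ.base i) j = 0 := by
  have hlt := σ.pos_lt j
  have h1 := congrFun (congrFun hP (σ.base i)) (σ.vec (σ.blk j) (σ.pos j - 1) (by omega))
  rw [mul_nilp_apply, dif_pos (by rw [pos_vec, blk_vec]; omega)] at h1
  have h2 : σ.vec (σ.blk (σ.vec (σ.blk j) (σ.pos j - 1) (by omega)))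
      (σ.pos (σ.vec (σ.blk j) (σ.pos j - 1) (by omega)) + 1)
      (by rw [pos_vec, blk_vec]; omega) = j := by
    rw [eq_comm, eq_vec_iff, blk_vec, pos_vec]
    exact ⟨rfl, by omega⟩
  rw [h2] at h1
  rw [h1, Matrix.mul_apply]
  refine Finset.sum_eq_zero fun k _ => ?_
  rw [nilp, Matrix.of_apply, if_neg, zero_mul]
  rintro ⟨-, h3⟩
  rw [pos_base] at h3
  omega

theorem sum_eq_sum_base {M : Type*} [AddCommMonoid M] (F : Fin n → M)
    (hF : ∀ j, σ.pos j ≠ 0 → F j = 0) : ∑ j, F j = ∑ i, F (σ.base i) := by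
  have h1 : ∀ j, F j = if σ.pos j = 0 then F (σ.base (σ.blk j)) else 0 := by
    intro j
    split_ifs with h
    · congr 1
      exact σ.eq_vec_iff.2 ⟨rfl, h⟩
    · exact hF j h
  rw [Finset.sum_congr rfl fun j _ => h1 j,
    σ.sum_index fun i a => if a = 0 then F (σ.base i) else 0]
  refine Finset.sum_congr rfl fun i _ => ?_
  rw [Finset.sum_ite_eq', if_pos (Finset.mem_range.2 (σ.size_pos i))]

theorem mulVec_comp_base (hP : P * σ.nilp R = σ.nilp R * P) (v : Fin n → R) :
    (P *ᵥ v) ∘ σ.base = σ.head P *ᵥ (v ∘ σ.base) := by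
  ext i
  rw [Function.comp_apply, Matrix.mulVec, dotProduct, sum_eq_sum_base (σ := σ)]
  · rfl
  · intro j hj
    rw [apply_base_eq_zero hP i hj, zero_mul]

theorem exists_nilp_mulVec_eq {v : Fin n → R} (hv : v ∘ σ.base = 0) :
    ∃ u, σ.nilp R *ᵥ u = v := by
  refine ⟨fun j => if h : σ.pos j + 1 < σ.size (σ.blk j) then v (σ.vec (σ.blk j) (σ.pos j + 1) h)
    else 0, ?_⟩
  ext j
  have h1 := σ.nilp_pow_mulVec_apply (R := R) 1 (fun j => if h : σ.pos j + 1 < σ.size (σ.blk j) then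
    v (σ.vec (σ.blk j) (σ.pos j + 1) h) else 0) j
  rw [pow_one] at h1
  rw [h1]
  have hlt := σ.pos_lt j
  by_cases h : 1 ≤ σ.pos j
  · rw [if_pos h, dif_pos (by rw [pos_vec, blk_vec]; omega)]
    congr 1
    rw [eq_comm, eq_vec_iff, blk_vec, pos_vec]
    exact ⟨rfl, by omega⟩
  · have h2 : j = σ.base (σ.blk j) := σ.eq_vec_iff.2 ⟨rfl, by omega⟩
    rw [if_neg h, h2]
    exact (congrFun hv _).symm

end Head

section BlockPoly

variable {R : Type*} [CommRing R]

/-- The block diagonal matrix whose `i`-th block is the value at the corresponding block of `M` of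
the polynomial with coefficients `c i`. -/
def blockPoly (c : Fin σ.parts → ℕ → R) (M : Matrix (Fin n) (Fin n) R) :
    Matrix (Fin n) (Fin n) R :=
  ∑ a ∈ Finset.range n, M ^ a * Matrix.diagonal fun j => c (σ.blk j) a

theorem blockPoly_map {T : Type*} [CommRing T] (φ : R →+* T) (c : Fin σ.parts → ℕ → R)
    (M : Matrix (Fin n) (Fin n) R) :
    (σ.blockPoly c M).map φ = σ.blockPoly (fun i a => φ (c i a)) (M.map φ) := by
  rw [blockPoly, ← RingHom.mapMatrix_apply, map_sum, blockPoly]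
  refine Finset.sum_congr rfl fun a _ => ?_
  rw [map_mul, map_pow, RingHom.mapMatrix_apply, RingHom.mapMatrix_apply,
    Matrix.diagonal_map (map_zero φ)]

theorem commute_nilp_diagonal (d : Fin σ.parts → R) :
    Commute (σ.nilp R) (Matrix.diagonal fun j => d (σ.blk j)) := by
  ext i j
  rw [Matrix.mul_diagonal, Matrix.diagonal_mul, nilp, Matrix.of_apply]
  split_ifs with h
  · rw [h.1, mul_comm]
  · simp

theorem commute_blockPoly {M : Matrix (Fin n) (Fin n) R}
    (hM : ∀ d : Fin σ.parts → R, Commute M (Matrix.diagonal fun j => d (σ.blk j)))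
    (c : Fin σ.parts → ℕ → R) : Commute M (σ.blockPoly c M) :=
  Commute.sum_right _ _ _ fun a _ => ((Commute.refl M).pow_right a).mul_right (hM fun i => c i a)

/-- A deformation of `nilp` with prescribed diagonal. -/
theorem charpoly_nilp_add_diagonal (d : Fin n → R) :
    (σ.nilp R + Matrix.diagonal d).charpoly = ∏ j, (Polynomial.X - Polynomial.C (d j)) := by
  refine Matrix.BlockTriangular.charpoly_eq_prod (b := fun j => OrderDual.toDual (σ.pos j)) ?_ _ ?_
  · intro i j hij
    have hij : σ.pos i < σ.pos j := hij
    rw [Matrix.add_apply, Matrix.diagonal_apply_ne, nilp, Matrix.of_apply, if_neg, add_zero]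
    · omega
    · rintro rfl
      exact lt_irrefl _ hij
  · intro a
    rw [← Matrix.charpoly_diagonal]
    congr 1
    ext ⟨i, hi⟩ ⟨j, hj⟩
    have hij : σ.pos i = σ.pos j := congrArg OrderDual.ofDual (hi.trans hj.symm)
    have hne : ¬ (σ.blk i = σ.blk j ∧ σ.pos i = σ.pos j + 1) := by omega
    rw [Matrix.toSquareBlock_def, Matrix.of_apply, Matrix.add_apply, nilp, Matrix.of_apply,
      if_neg hne, zero_add, Matrix.diagonal_apply, Matrix.diagonal_apply]
    simp only [Subtype.mk.injEq]

end BlockPoly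

end JordanType

section Splitting

open Polynomial

variable {n : ℕ}

theorem Matrix.mulVecLin_pow {R : Type*} [CommRing R] (N : Matrix (Fin n) (Fin n) R) (a : ℕ) :
    N.mulVecLin ^ a = (N ^ a).mulVecLin :=
  (map_pow (Matrix.toLinAlgEquiv' (R := R) (n := Fin n)) N a).symm

theorem Matrix.aeval_mulVec_of_mulVec_eq {ι R : Type*} [Fintype ι] [DecidableEq ι] [CommRing R]
    {M : Matrix ι ι R} {x : ι → R} {t : R} (h : M *ᵥ x = t • x) (f : R[X]) :
    aeval M f *ᵥ x = f.eval t • x := by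
  induction f using Polynomial.induction_on' with
  | add p q hp hq => rw [map_add, Matrix.add_mulVec, hp, hq, eval_add, add_smul]
  | monomial a c =>
    have h1 : M ^ a *ᵥ x = t ^ a • x := by
      induction a with
      | zero => simp
      | succ a ih =>
        rw [pow_succ, ← Matrix.mulVec_mulVec, h, Matrix.mulVec_smul, ih, smul_smul, pow_succ']
    rw [aeval_monomial, eval_monomial, ← Algebra.smul_def, Matrix.smul_mulVec, h1, smul_smul]

theorem Matrix.exists_eigenvectors {r : ℕ} {E : Type*} [Field E] {M : Matrix (Fin r) (Fin r) E}
    {t : Fin r → E} (ht : Function.Injective t) (hM : M.charpoly = ∏ i, (X - C (t i))) :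
    ∃ x : Fin r → Fin r → E, (∀ i, x i ≠ 0) ∧ (∀ i, M *ᵥ x i = t i • x i) ∧
      Submodule.span E (Set.range x) = ⊤ := by
  have h1 : ∀ i, ∃ x ≠ 0, (Matrix.scalar (Fin r) (t i) - M) *ᵥ x = 0 := by
    intro i
    rw [Matrix.exists_mulVec_eq_zero_iff, ← Matrix.eval_charpoly, hM, eval_prod]
    exact Finset.prod_eq_zero (Finset.mem_univ i) (by simp)
  choose x hx0 hx using h1
  have hx' : ∀ i, M *ᵥ x i = t i • x i := by
    intro i
    have h2 := hx i
    rw [Matrix.sub_mulVec, sub_eq_zero] at h2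
    rw [← h2]
    ext k
    simp [Matrix.mulVec_diagonal]
  refine ⟨x, hx0, hx', ?_⟩
  have hli : LinearIndependent E x :=
    Module.End.eigenvectors_linearIndependent' M.mulVecLin t ht x fun i =>
      ⟨Module.End.mem_eigenspace_iff.2 (hx' i), hx0 i⟩
  exact hli.span_eq_top_of_card_eq_finrank' (by simp)

namespace JordanType

variable {σ : JordanType n}

theorem aeval_mulVec_comp_base {E : Type*} [Field E] {P : Matrix (Fin n) (Fin n) E}
    (hP : P * σ.nilp E = σ.nilp E * P) (f : E[X]) (v : Fin n → E) :
    (aeval P f *ᵥ v) ∘ σ.base = aeval (σ.head P) f *ᵥ (v ∘ σ.base) := by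
  induction f using Polynomial.induction_on' with
  | add p q hp hq =>
    rw [map_add, map_add, Matrix.add_mulVec, Matrix.add_mulVec, ← hp, ← hq]
    rfl
  | monomial a c =>
    have h1 : (P ^ a *ᵥ v) ∘ σ.base = σ.head P ^ a *ᵥ (v ∘ σ.base) := by
      induction a with
      | zero => simp
      | succ a ih =>
        rw [pow_succ', ← Matrix.mulVec_mulVec, mulVec_comp_base hP, ih, pow_succ',
          ← Matrix.mulVec_mulVec]
    rw [aeval_monomial, aeval_monomial, ← Algebra.smul_def, ← Algebra.smul_def,
      Matrix.smul_mulVec, Matrix.smul_mulVec, ← h1]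
    rfl

theorem commute_aeval_nilp {E : Type*} [Field E] {P : Matrix (Fin n) (Fin n) E}
    (hP : P * σ.nilp E = σ.nilp E * P) (f : E[X]) : Commute (σ.nilp E) (aeval P f) := by
  induction f using Polynomial.induction_on' with
  | add p q hp hq => rw [map_add]; exact hp.add_right hq
  | monomial a c =>
    rw [aeval_monomial]
    exact Commute.mul_right (Algebra.commutes c _).symm (Commute.pow_right hP.symm a)

/-- As `f(P)` kills the cokernel of `nilp`, it maps into the image of `nilp`. It commutes with
`nilp`, so its `m`-th power maps into the image of `nilp ^ m`, which is zero for `m = n`. -/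
theorem pow_mulVec_eq_zero_of_aeval_head {E : Type*} [Field E] {P : Matrix (Fin n) (Fin n) E}
    (hP : P * σ.nilp E = σ.nilp E * P) {f : E[X]} (hf : aeval (σ.head P) f = 0) (v : Fin n → E) :
    aeval P (f ^ n) *ᵥ v = 0 := by
  have hcomm := commute_aeval_nilp hP f
  have h1 : ∀ m, ∃ u, aeval P (f ^ m) *ᵥ v = (σ.nilp E ^ m) *ᵥ u := by
    intro m
    induction m with
    | zero => exact ⟨v, by simp⟩
    | succ m ih =>
      obtain ⟨u, hu⟩ := ih
      obtain ⟨u', hu'⟩ := exists_nilp_mulVec_eq (σ := σ) (v := aeval P f *ᵥ u) (by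
        rw [aeval_mulVec_comp_base hP, hf, Matrix.zero_mulVec])
      refine ⟨u', ?_⟩
      rw [pow_succ', map_mul, ← Matrix.mulVec_mulVec, hu, Matrix.mulVec_mulVec,
        ← (hcomm.pow_left m).eq, ← Matrix.mulVec_mulVec, ← hu', Matrix.mulVec_mulVec, ← pow_succ]
  obtain ⟨u, hu⟩ := h1 n
  rw [hu, nilp_pow_eq_zero, Matrix.zero_mulVec]

/-- A matrix commuting with `nilp` which has distinct eigenvalues on the cokernel of `nilp` can be
brought into block form simultaneously with `nilp`. -/
theorem exists_mul_eq_blockPoly {E : Type*} [Field E] {P : Matrix (Fin n) (Fin n) E}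
    (hP : P * σ.nilp E = σ.nilp E * P) {t : Fin σ.parts → E} (ht : Function.Injective t)
    (hchar : (σ.head P).charpoly = ∏ i, (X - C (t i))) :
    ∃ (τ : JordanType n) (h : Matrix (Fin n) (Fin n) E) (c : Fin τ.parts → ℕ → E), IsUnit h.det ∧
      σ.nilp E * h = h * τ.nilp E ∧ P * h = h * τ.blockPoly c (τ.nilp E) := by
  classical
  obtain ⟨x, hx0, hx, hxtop⟩ := Matrix.exists_eigenvectors ht hchar
  let x' : Fin σ.parts → Fin n → E := fun i j => if σ.pos j = 0 then x i (σ.blk j) else 0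
  have hx' : ∀ i, x' i ∘ σ.base = x i := fun i => by
    ext k
    simp [x']
  -- Applying `L i` to `P` pushes a lift `x' i` of the eigenvector `x i` into the generalized
  -- eigenspace for `t i`. In the cokernel it only rescales `x i` by `L i (t i)`, which is nonzero
  -- as the eigenvalues are distinct.
  let L : Fin σ.parts → E[X] := fun i => (∏ k ∈ Finset.univ.erase i, (X - C (t k))) ^ n
  have hL : ∀ i, (L i).eval (t i) ≠ 0 := by
    intro i
    rw [eval_pow, eval_prod]
    refine pow_ne_zero _ (Finset.prod_ne_zero_iff.2 fun k hk => ?_)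
    rw [eval_sub, eval_X, eval_C, sub_ne_zero]
    exact fun h => Finset.ne_of_mem_erase hk (ht h.symm)
  let v : Fin σ.parts → Fin n → E := fun i => aeval P (L i) *ᵥ x' i
  have hvb : ∀ i, v i ∘ σ.base = (L i).eval (t i) • x i := by
    intro i
    rw [aeval_mulVec_comp_base hP, hx', Matrix.aeval_mulVec_of_mulVec_eq (hx i)]
  have hv0 : ∀ i, v i ≠ 0 := by
    intro i h0
    have h1 := hvb i
    rw [h0] at h1
    exact smul_ne_zero (hL i) (hx0 i) h1.symm
  have hvgen : ∀ i, v i ∈ Module.End.maxGenEigenspace P.mulVecLin (t i) := by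
    intro i
    rw [Module.End.mem_maxGenEigenspace]
    refine ⟨n, ?_⟩
    have h1 : P.mulVecLin - t i • (1 : Module.End E (Fin n → E)) =
        (aeval P (X - C (t i))).mulVecLin := by
      ext j : 2
      simp [Algebra.algebraMap_eq_smul_one]
    rw [h1, Matrix.mulVecLin_pow, ← map_pow, Matrix.mulVecLin_apply, Matrix.mulVec_mulVec,
      ← map_mul, ← mul_pow, Finset.mul_prod_erase _ (fun k => X - C (t k)) (Finset.mem_univ i)]
    refine pow_mulVec_eq_zero_of_aeval_head hP ?_ _
    rw [← hchar, Matrix.aeval_self_charpoly]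
  have hcomm : Commute P.mulVecLin (σ.nilp E).mulVecLin := by
    rw [commute_iff_eq, Module.End.mul_eq_comp, Module.End.mul_eq_comp, ← Matrix.mulVecLin_mul, hP,
      Matrix.mulVecLin_mul]
  obtain ⟨s, b, hs, hb, hsv, hgen⟩ := exists_basis_pow_apply hcomm (m := n)
    (by rw [Matrix.mulVecLin_pow, nilp_pow_eq_zero, Matrix.mulVecLin_zero]) ht hv0 hvgen (by
      rw [eq_top_iff]
      rintro u -
      have h1 : u ∘ σ.base ∈ Submodule.span E (Set.range x) := by
        rw [hxtop]
        trivial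
      obtain ⟨d, hd⟩ := (Submodule.mem_span_range_iff_exists_fun E).1 h1
      let y := ∑ i, (d i * ((L i).eval (t i))⁻¹) • v i
      obtain ⟨z, hz⟩ := exists_nilp_mulVec_eq (σ := σ) (v := u - y) (by
        have h2 : y ∘ σ.base = u ∘ σ.base := by
          rw [← hd]
          have h3 : y ∘ σ.base = LinearMap.funLeft E E σ.base y := rfl
          rw [h3, map_sum]
          refine Finset.sum_congr rfl fun i _ => ?_
          rw [map_smul]
          change _ • (v i ∘ σ.base) = _
          rw [hvb, smul_smul, mul_assoc, inv_mul_cancel₀ (hL i), mul_one]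
        ext k
        have h3 := congrFun h2 k
        simp only [Function.comp_apply] at h3
        simp [h3])
      rw [← add_sub_cancel y u]
      refine Submodule.add_mem_sup (Submodule.sum_mem _ fun i _ =>
        Submodule.smul_mem _ _ (Submodule.subset_span ⟨i, rfl⟩)) ⟨z, hz⟩)
  have hb' : ∀ i a, b ⟨i, a⟩ = (σ.nilp E ^ (a : ℕ)) *ᵥ v i := fun i a => by
    rw [hb, Matrix.mulVecLin_pow, Matrix.mulVecLin_apply]
  have hsv' : ∀ i, (σ.nilp E ^ s i) *ᵥ v i = 0 := fun i => by
    rw [← Matrix.mulVecLin_apply, ← Matrix.mulVecLin_pow, hsv]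
  have hcard : Fintype.card (Fin n) = Fintype.card (Σ i, Fin (s i)) := by
    rw [← Module.finrank_eq_card_basis b, Module.finrank_fin_fun, Fintype.card_fin]
  let τ : JordanType n := ⟨σ.parts, s, hs, Fintype.equivOfCardEq hcard⟩
  -- The vector `P *ᵥ v i` stays in the `i`-th generalized eigenspace, which is the cyclic module
  -- generated by `v i`; so `P` acts on it as a polynomial in `nilp`.
  have hPv : ∀ i, ∃ c : ℕ → E, P *ᵥ v i = ∑ a ∈ Finset.range n, c a • ((σ.nilp E ^ a) *ᵥ v i) := by
    intro i
    obtain ⟨c, hc⟩ := hgen i (P *ᵥ v i)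
      (Module.End.mapsTo_maxGenEigenspace_of_comm (f := P.mulVecLin) (Commute.refl _) (t i) (hvgen i))
    refine ⟨c, hc.trans ?_⟩
    have hsn : s i ≤ n := τ.size_le i
    rw [← Finset.sum_subset (Finset.range_mono hsn)]
    · exact Finset.sum_congr rfl fun a _ => by rw [Matrix.mulVecLin_pow, Matrix.mulVecLin_apply]
    · intro a _ ha
      obtain ⟨e, rfl⟩ := Nat.exists_eq_add_of_le (not_lt.1 fun h => ha (Finset.mem_range.2 h))
      rw [add_comm, pow_add, ← Matrix.mulVec_mulVec, hsv', Matrix.mulVec_zero, smul_zero]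
  choose c hc using hPv
  let h := τ.cyc (σ.nilp E) v
  have hNh : σ.nilp E * h = h * τ.nilp E := τ.mul_cyc _ _ hsv'
  refine ⟨τ, h, c, ?_, hNh, ?_⟩
  · rw [← Matrix.isUnit_iff_isUnit_det, ← Matrix.linearIndependent_cols_iff_isUnit]
    have h1 : h.col = b ∘ τ.index := funext fun j => (hb' _ _).symm
    rw [h1]
    exact b.linearIndependent.comp _ τ.index.injective
  · have h1 : σ.nilp E * (P * h) = P * h * τ.nilp E := by
      rw [← Matrix.mul_assoc, ← hP, Matrix.mul_assoc, hNh, Matrix.mul_assoc]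
    have h2 : σ.nilp E * (h * τ.blockPoly c (τ.nilp E)) =
        h * τ.blockPoly c (τ.nilp E) * τ.nilp E := by
      rw [← Matrix.mul_assoc, hNh, Matrix.mul_assoc,
        (τ.commute_blockPoly τ.commute_nilp_diagonal c).eq, Matrix.mul_assoc]
    -- Both matrices intertwine `σ.nilp` and `τ.nilp`, so it is enough to compare their columns at
    -- the block starts.
    rw [τ.eq_cyc h1, τ.eq_cyc h2]
    congr 1
    funext i
    have h3 : h.col (τ.base i) = v i := by
      rw [τ.col_cyc, pos_base, pow_zero, Matrix.one_mulVec, blk_base]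
    have h4 : (P * h).col (τ.base i) = P *ᵥ h.col (τ.base i) := rfl
    rw [h4, h3, hc, blockPoly, Finset.mul_sum]
    ext k
    rw [Matrix.col_apply, Matrix.sum_apply, Finset.sum_apply]
    refine Finset.sum_congr rfl fun a _ => ?_
    rw [← Matrix.mul_assoc, Matrix.mul_diagonal, blk_base, ← pow_mul_eq_of_mul_eq hNh, Pi.smul_apply,
      smul_eq_mul, mul_comm, ← h3]
    rfl

end JordanType

end Splitting

/-! ### Lifting commuting pairs to characteristic zero. -/

section Lifting

/-- A field over a domain `O` is a residue field of a local domain containing `O`. -/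
theorem exists_isLocalRing_surjective (O E : Type u) [CommRing O] [IsDomain O] [Field E]
    [Algebra O E] : ∃ (R : Type u) (_ : CommRing R) (_ : IsDomain R) (_ : Algebra O R)
      (φ : R →ₐ[O] E), Function.Injective (algebraMap O R) ∧ Function.Surjective φ ∧
      ∀ x, φ x ≠ 0 → IsUnit x := by
  -- One variable for each element of `E`, evaluated at itself, makes the map surjective; localizing
  -- at its kernel gives the local domain.
  let φ₀ : MvPolynomial E O →ₐ[O] E := MvPolynomial.aeval id
  have hp : (RingHom.ker φ₀).IsPrime := RingHom.ker_isPrime φ₀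
  let M := (RingHom.ker φ₀).primeCompl
  have hM : ∀ x : M, IsUnit (φ₀ x) := fun x => (show φ₀ x ≠ 0 from x.2).isUnit
  let φ : Localization M →ₐ[O] E := IsLocalization.liftAlgHom (M := M) (f := φ₀) hM
  have hφ : ∀ x, φ (algebraMap _ _ x) = φ₀ x := fun x => IsLocalization.lift_eq _ x
  have hinj : Function.Injective (algebraMap (MvPolynomial E O) (Localization M)) :=
    IsLocalization.injective (M := M) _ (RingHom.ker φ₀).primeCompl_le_nonZeroDivisors
  refine ⟨Localization M, inferInstance,
    IsLocalization.isDomain_localization (RingHom.ker φ₀).primeCompl_le_nonZeroDivisors,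
    inferInstance, φ, ?_, fun e => ⟨algebraMap (MvPolynomial E O) _ (MvPolynomial.X e), ?_⟩, fun x hx => ?_⟩
  · rw [IsScalarTower.algebraMap_eq O (MvPolynomial E O)]
    exact hinj.comp (MvPolynomial.C_injective _ _)
  · rw [hφ]
    simp [φ₀]
  · obtain ⟨⟨a, s⟩, rfl⟩ := IsLocalization.mk'_surjective M x
    have ha : φ₀ a ≠ 0 := by
      intro h0
      apply hx
      have h1 := congrArg φ (IsLocalization.mk'_spec (Localization M) a s)
      rw [map_mul, hφ, hφ, h0] at h1
      exact (mul_eq_zero.1 h1).resolve_right s.2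
    exact (IsLocalization.AtPrime.isUnit_mk'_iff (Localization M) (RingHom.ker φ₀) a s).2 ha

end Lifting

section SemisimpleModuli

open Polynomial

variable {O : Type*} [CommRing O] {n : ℕ} {α : Fin n → Oˣ} {q : ℤ}

/-- With `m = |q - 1|`, the distinct `α j` are roots of `X ^ m - 1` in the domain `O`, so their
product of linear factors divides it, and Cayley–Hamilton gives `S ^ m = 1`. Thus the defining
relation says that the two matrices commute. -/
theorem Matrix.zpow_eq_self_of_charpoly_eq [IsDomain O] (hα : Function.Injective α)
    (hq : q ≠ 1 → ∀ j, α j ^ (q - 1) = 1) {R : Type*} [CommRing R] [Algebra O R]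
    {S : Matrix (Fin n) (Fin n) R} (hS : IsUnit S.det)
    (h : S.charpoly = ∏ j, (X - C (algebraMap O R (α j : O)))) : S ^ q = S := by
  classical
  by_cases hq1 : q = 1
  · rw [hq1, zpow_one]
  obtain ⟨s, rfl⟩ := (Matrix.isUnit_iff_isUnit_det S).2 hS
  let m := (q - 1).natAbs
  have hm : 0 < m := Int.natAbs_pos.2 (sub_ne_zero.2 hq1)
  have hαm : ∀ j, (α j : O) ^ m = 1 := fun j => by
    rw [← Units.val_pow_eq_pow_val, pow_natAbs_eq_one.2 (hq hq1 j), Units.val_one]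
  have hdvd : ∏ j, (X - C (α j : O)) ∣ X ^ m - 1 := by
    have h1 : (X ^ m - 1 : O[X]) ≠ 0 := (monic_X_pow_sub_C (1 : O) hm.ne').ne_zero
    have h2 : (Finset.univ.val.map fun j => (α j : O)) ≤ (X ^ m - 1 : O[X]).roots := by
      rw [Multiset.le_iff_subset]
      · intro x hx
        obtain ⟨j, -, rfl⟩ := Multiset.mem_map.1 hx
        rw [mem_roots h1]
        simp [hαm]
      · exact Finset.univ.nodup.map (Units.val_injective.comp hα)
    have h3 := (Multiset.prod_X_sub_C_dvd_iff_le_roots h1 _).2 h2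
    rwa [Multiset.map_map] at h3
  have h1 : aeval s.val (∏ j, (X - C (α j : O))) = 0 := by
    have h2 := Matrix.aeval_self_charpoly s.val
    have h3 : ∏ j, (X - C (algebraMap O R (α j : O))) =
        (∏ j, (X - C (α j : O))).map (algebraMap O R) := by
      simp [Polynomial.map_prod]
    rwa [h, h3, aeval_map_algebraMap] at h2
  obtain ⟨f, hf⟩ := hdvd
  have h2 : s.val ^ m = 1 := by
    have h3 := congrArg (aeval s.val) hf
    rwa [map_mul, h1, zero_mul, map_sub, map_pow, aeval_X, map_one, sub_eq_zero] at h3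
  have h3 : s ^ m = 1 := Units.ext h2
  have h4 : s ^ q = s := by
    rw [← sub_add_cancel q 1, _root_.zpow_add_one, pow_natAbs_eq_one.1 h3, one_mul]
  rw [← Matrix.coe_units_zpow, h4]

theorem isModuliPair_of_mul_eq_mul [IsDomain O] (hα : Function.Injective α)
    (hq : q ≠ 1 → ∀ j, α j ^ (q - 1) = 1) {R : Type*} [CommRing R] [Algebra O R]
    {P S : Matrix (Fin n) (Fin n) R} (hP : IsUnit P.det) (hS : IsUnit S.det)
    (h : S.charpoly = ∏ j, (X - C (algebraMap O R (α j : O)))) (hPS : P * S = S * P) :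
    IsModuliPair α q P S :=
  ⟨hP, h, by rw [Matrix.zpow_eq_self_of_charpoly_eq hα hq hS h, Matrix.conj_eq_iff hP, hPS]⟩

theorem IsModuliPair.mul_eq_mul [IsDomain O] (hα : Function.Injective α)
    (hq : q ≠ 1 → ∀ j, α j ^ (q - 1) = 1) {R : Type*} [CommRing R] [Algebra O R]
    {P S : Matrix (Fin n) (Fin n) R} (h : IsModuliPair α q P S) : P * S = S * P := by
  have h1 := h.conj_eq
  rwa [Matrix.zpow_eq_self_of_charpoly_eq hα hq h.isUnit_det_right h.charpoly_eq,
    Matrix.conj_eq_iff h.isUnit_det] at h1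

/-- Pairs in block form over the residue field of a local ring lift to the local ring. -/
theorem JordanType.exists_isModuliPair_map_eq [IsDomain O] (hα : Function.Injective α)
    (hq : q ≠ 1 → ∀ j, α j ^ (q - 1) = 1) {R E : Type*} [CommRing R] [Field E] [Algebra O R]
    [Algebra O E] (φ : R →ₐ[O] E) (hφ : Function.Surjective φ) (hφu : ∀ x, φ x ≠ 0 → IsUnit x)
    (hαE : ∀ j, algebraMap O E (α j) = 1) (τ : JordanType n) {P S h : Matrix (Fin n) (Fin n) E}
    (hP : IsUnit P.det) (hh : IsUnit h.det) (hS : (S - 1) * h = h * τ.nilp E)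
    (c : Fin τ.parts → ℕ → E) (hPh : P * h = h * τ.blockPoly c (τ.nilp E)) :
    ∃ P' S' : Matrix (Fin n) (Fin n) R, IsModuliPair α q P' S' ∧ P'.map φ = P ∧ S'.map φ = S := by
  choose c' hc' using fun i a => hφ (c i a)
  choose h' hh' using fun i j => hφ (h i j)
  let H : Matrix (Fin n) (Fin n) R := Matrix.of h'
  have hmul : ∀ A B : Matrix (Fin n) (Fin n) R, (A * B).map φ = A.map φ * B.map φ :=
    fun A B => Matrix.map_mul (f := (φ : R →+* E))
  have hunit : ∀ A : Matrix (Fin n) (Fin n) R, IsUnit (A.map φ).det → IsUnit A.det := by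
    intro A hA
    refine hφu _ ?_
    rw [AlgHom.map_det]
    exact hA.ne_zero
  have hHφ : H.map φ = h := by ext i j; exact hh' i j
  have hH : IsUnit H.det := hunit H (by rwa [hHφ])
  let d : Fin n → R := fun j => algebraMap O R (α j)
  -- The deformation: over `E` the `α j` become 1, so `N` reduces to `nilp`, while `1 + N` acquires
  -- the characteristic polynomial with roots `α j`.
  let N : Matrix (Fin n) (Fin n) R := τ.nilp R + Matrix.diagonal fun j => d j - 1
  have hNd : 1 + N = τ.nilp R + Matrix.diagonal d := by
    rw [add_left_comm, ← Matrix.diagonal_one, Matrix.diagonal_add]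
    simp
  have hNφ : N.map φ = τ.nilp E := by
    have h1 : (fun j => φ (d j - 1)) = 0 := by
      funext j
      simp [d, hαE]
    change (τ.nilp R + _).map (φ : R →+* E) = _
    rw [Matrix.map_add _ (map_add _), nilp_map, Matrix.diagonal_map (map_zero _)]
    simp [d, hαE]
  let Q := τ.blockPoly c' N
  have hQφ : Q.map φ = τ.blockPoly c (τ.nilp E) := by
    have h1 := τ.blockPoly_map (φ : R →+* E) c' N
    simp only [RingHom.coe_coe, hc', hNφ] at h1
    exact h1
  -- The deformed `N` is still block diagonal, so it commutes with matrices that are scalar on each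
  -- block, and hence with block polynomials in itself.
  have hQN : Commute N Q := τ.commute_blockPoly (fun e =>
    (τ.commute_nilp_diagonal e).add_left (Matrix.commute_diagonal _ _)) c'
  have hHH := Matrix.mul_nonsing_inv _ hH
  have hHH' := Matrix.nonsing_inv_mul _ hH
  let P' := H * Q * H⁻¹
  let S' := H * (1 + N) * H⁻¹
  have hP'H : P' * H = H * Q := by
    rw [Matrix.mul_assoc, hHH', Matrix.mul_one]
  have hS'H : S' * H = H * (1 + N) := by
    rw [Matrix.mul_assoc, hHH', Matrix.mul_one]
  have hP'φ : P'.map φ = P := by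
    apply Matrix.mul_right_cancel_of_isUnit_det hh
    rw [hPh, ← hHφ, ← hmul, hP'H, hmul, hQφ]
  have hS'φ : S'.map φ = S := by
    apply Matrix.mul_right_cancel_of_isUnit_det hh
    have h1 : S * h = h + h * τ.nilp E := by
      rw [← hS, sub_mul, Matrix.one_mul, add_sub_cancel]
    rw [h1, ← hHφ, ← hmul, hS'H, mul_add, Matrix.mul_one, ← hNφ, ← hmul]
    exact Matrix.map_add _ (map_add φ) _ _
  have hchar : S'.charpoly = ∏ j, (X - C (d j)) := by
    rw [Matrix.charpoly_eq_of_mul_eq hH hS'H, hNd, charpoly_nilp_add_diagonal]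
  have hS'det : IsUnit S'.det := by
    rw [Matrix.det_eq_sign_charpoly_coeff, hchar, coeff_zero_eq_eval_zero, eval_prod]
    refine ((isUnit_one.neg).pow _).mul ?_
    refine Finset.prod_induction _ IsUnit (fun _ _ => IsUnit.mul) isUnit_one fun j _ => ?_
    rw [eval_sub, eval_X, eval_C, zero_sub]
    exact ((α j).isUnit.map (algebraMap O R)).neg
  refine ⟨P', S', isModuliPair_of_mul_eq_mul hα hq (hunit _ (by rwa [hP'φ])) hS'det hchar ?_,
    hP'φ, hS'φ⟩
  apply Matrix.mul_right_cancel_of_isUnit_det hH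
  rw [Matrix.mul_assoc, hS'H, ← Matrix.mul_assoc, hP'H, Matrix.mul_assoc, Matrix.mul_assoc, hP'H,
    ← Matrix.mul_assoc S', hS'H, Matrix.mul_assoc, ((Commute.one_left Q).add_left hQN).eq]

end SemisimpleModuli

/-! ### Distinct eigenvalues at the generic point of a special stratum. -/

section Genericity

open Polynomial

/-- The eigenvalues over `Ω` are integral over `B`, so the specialization extends to them; two equal
ones would remain equal after specialization. -/
theorem Matrix.exists_charpoly_map_eq_of_specialization {r : ℕ} {B Ω E : Type*} [CommRing B]
    [Field Ω] [IsAlgClosed Ω] [Field E] [IsAlgClosed E] (M : Matrix (Fin r) (Fin r) B)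
    (ι : B →+* Ω) (hι : Function.Injective ι) (y : B →+* E) {β : Fin r → E} (hβ : Function.Injective β)
    (h : (M.map y).charpoly = ∏ i, (X - C (β i))) : ∃ t : Fin r → Ω, Function.Injective t ∧
      (M.map ι).charpoly = ∏ i, (X - C (t i)) := by
  let _ := ι.toAlgebra
  have : FaithfulSMul B Ω := (faithfulSMul_iff_algebraMap_injective _ _).2 hι
  change ∃ t : Fin r → Ω, Function.Injective t ∧
    (M.map (algebraMap B Ω)).charpoly = ∏ i, (X - C (t i))
  obtain ⟨t, ht⟩ := (M.map (algebraMap B Ω)).exists_charpoly_eq_prod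
  refine ⟨t, ?_, ht⟩
  obtain ⟨x, hx⟩ := exists_ringHom_integralClosure_comp_eq (Ω := Ω) y
  have hint : ∀ i, IsIntegral B (t i) := fun i => by
    refine ⟨M.charpoly, M.charpoly_monic, ?_⟩
    rw [← eval_map, ← Matrix.charpoly_map, ht, eval_prod]
    exact Finset.prod_eq_zero (Finset.mem_univ i) (by simp)
  let t' : Fin r → integralClosure B Ω := fun i => ⟨t i, hint i⟩
  have h1 : M.charpoly.map (algebraMap B (integralClosure B Ω)) = ∏ i, (X - C (t' i)) := by
    apply Polynomial.map_injective (algebraMap (integralClosure B Ω) Ω) Subtype.val_injective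
    rw [Polynomial.map_map, ← IsScalarTower.algebraMap_eq, ← Matrix.charpoly_map, ht,
      map_prod_X_sub_C_univ]
    rfl
  have h2 := congrArg (Polynomial.map x) h1
  rw [Polynomial.map_map, hx, ← Matrix.charpoly_map, h, map_prod_X_sub_C_univ] at h2
  have h3 := separable_prod_X_sub_C_iff.2 hβ
  rw [h2, separable_prod_X_sub_C_iff] at h3
  intro i j hij
  exact h3 (congrArg x (Subtype.ext hij))

end Genericity

section SemisimpleModuli

open Polynomial

variable {n : ℕ}

theorem Matrix.aevalMul_one {R : Type*} [CommRing R] (N : Matrix (Fin n) (Fin n) R) :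
    Matrix.aevalMul 1 N = N := by
  rw [aevalMul, map_one, mul_one]

theorem isModuliPair_of_charpoly_eq_sub_one_pow {O : Type*} [CommRing O] [IsDomain O]
    {α : Fin n → Oˣ} {q : ℤ} (hα : Function.Injective α)
    (hq : q ≠ 1 → ∀ j, α j ^ (q - 1) = 1) {R : Type*} [CommRing R] [Algebra O R]
    (hαR : ∀ j, algebraMap O R (α j) = 1) {P S : Matrix (Fin n) (Fin n) R} (hP : IsUnit P.det)
    (hS : S.charpoly = (X - 1) ^ n) (hPS : P * S = S * P) : IsModuliPair α q P S := by
  refine isModuliPair_of_mul_eq_mul hα hq hP ?_ ?_ hPS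
  · rw [Matrix.det_eq_sign_charpoly_coeff, hS, coeff_zero_eq_eval_zero, eval_pow, eval_sub, eval_X,
      eval_one, zero_sub]
    exact (isUnit_one.neg.pow _).mul (isUnit_one.neg.pow _)
  · simp [hαR, hS]

namespace JordanType

variable {O : Type u} [CommRing O] (σ : JordanType n)

theorem head_cyc_single {R : Type*} [CommRing R] (T : Matrix (Fin n) (Fin n) R)
    (β : Fin σ.parts → R) :
    σ.head (σ.cyc T fun i => Pi.single (σ.base i) (β i)) = Matrix.diagonal β := by
  ext i j
  rw [head, Matrix.submatrix_apply]
  have h1 := congrFun (σ.col_cyc T (fun i => Pi.single (σ.base i) (β i)) (σ.base j)) (σ.base i)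
  rw [Matrix.col_apply] at h1
  rw [h1, pos_base, pow_zero, Matrix.one_mulVec, blk_base, Pi.single_apply, Matrix.diagonal_apply]
  by_cases hij : i = j
  · rw [hij, if_pos rfl, if_pos rfl]
  · rw [if_neg hij, if_neg]
    intro h2
    have h3 := congrArg σ.blk h2
    rw [blk_base, blk_base] at h3
    exact hij h3

/-- At the generic point of the fibre at `w` of the space of commuting pairs of shape `σ`, the first
matrix has distinct eigenvalues on the cokernel of `nilp`. -/
theorem exists_charpoly_head_paramP_eq {w : O} (hw : Prime w) {Ω : Type*} [Field Ω] [IsAlgClosed Ω]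
    (ι : σ.ParamRing 1 O ⧸ Ideal.span {algebraMap O (σ.ParamRing 1 O) w} →+* Ω)
    (hι : Function.Injective ι) :
    ∃ t : Fin σ.parts → Ω, Function.Injective t ∧
      (σ.head ((σ.paramP 1 O).map (ι.comp (Ideal.Quotient.mk _)))).charpoly =
        ∏ i, (X - C (t i)) := by
  have hwp : (Ideal.span {w}).IsPrime := (Ideal.span_singleton_prime hw.ne_zero).2 hw
  let E := AlgebraicClosure (FractionRing (O ⧸ Ideal.span {w}))
  have hE0 : algebraMap O E w = 0 := by
    rw [IsScalarTower.algebraMap_apply O (O ⧸ Ideal.span {w}) E, Ideal.Quotient.algebraMap_eq,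
      Ideal.Quotient.eq_zero_iff_mem.2 (Ideal.mem_span_singleton_self w), map_zero]
  -- It suffices to exhibit one point of the fibre with distinct eigenvalues on the cokernel: the
  -- explicit intertwiner whose `head` is the diagonal matrix `β`.
  obtain ⟨β, hβ0, hβ⟩ := IsAlgClosed.exists_pow_injective E (Fin σ.parts) one_pos
  simp only [pow_one] at hβ
  obtain ⟨y, -, hy⟩ := σ.exists_paramRing_algHom_single (O := O) (R := E) 1 (by simp) β
    fun i => (hβ0 i).isUnit
  let y' : (σ.ParamRing 1 O ⧸ Ideal.span {algebraMap O (σ.ParamRing 1 O) w}) →+* E :=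
    Ideal.Quotient.lift _ (y : σ.ParamRing 1 O →+* E) fun a ha => by
      obtain ⟨b, rfl⟩ := Ideal.mem_span_singleton.1 ha
      rw [map_mul, RingHom.coe_coe, AlgHom.commutes, hE0, zero_mul]
  have h1 : (σ.head ((σ.paramP 1 O).map (Ideal.Quotient.mk _))).map y' =
      σ.head ((σ.paramP 1 O).map y) := rfl
  have h2 : (σ.head ((σ.paramP 1 O).map (Ideal.Quotient.mk _))).map ι =
      σ.head ((σ.paramP 1 O).map (ι.comp (Ideal.Quotient.mk _))) := rfl
  rw [← h2]
  refine Matrix.exists_charpoly_map_eq_of_specialization _ ι hι y' hβ ?_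
  rw [h1, hy, head_cyc_single, Matrix.charpoly_diagonal]

theorem charpoly_paramS {O : Type*} [CommRing O] (f : ℤ[X]) :
    (σ.paramS f O).charpoly = (X - 1) ^ n := by
  rw [← σ.charpoly_one_add_nilp]
  refine Matrix.charpoly_eq_of_mul_eq (σ.isUnit_det_paramG f) ?_
  rw [mul_add, ← paramS_sub_one_mul, sub_mul]
  simp

theorem paramΦ_mul_paramS {O : Type*} [CommRing O] :
    σ.paramΦ 1 O * σ.paramS 1 O = σ.paramS 1 O * σ.paramΦ 1 O := by
  have h1 := σ.paramΦ_mul_paramS_sub_one (O := O) 1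
  rw [Matrix.aevalMul_one, mul_sub, sub_mul, Matrix.mul_one, Matrix.one_mul] at h1
  exact sub_left_injective h1

end JordanType

end SemisimpleModuli

/-! ### Flatness of the reduced scheme of commuting pairs. -/

section Flatness

open Polynomial

theorem exists_isAlgClosed_ringHom_injective (B : Type u) [CommRing B] [IsDomain B] :
    ∃ (Ω : Type u) (_ : Field Ω) (_ : IsAlgClosed Ω) (ι : B →+* Ω), Function.Injective ι :=
  ⟨AlgebraicClosure (FractionRing B), inferInstance, inferInstance,
    (algebraMap (FractionRing B) _).comp (algebraMap B _),
    (algebraMap (FractionRing B) _).injective.comp (IsFractionRing.injective _ _)⟩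

variable {O : Type u} [CommRing O] {n : ℕ} {α : Fin n → Oˣ} {q : ℤ}

theorem JordanType.paramP_mul_nilp_map (σ : JordanType n) {T : Type*} [CommRing T]
    (φ : σ.ParamRing 1 O →+* T) :
    (σ.paramP 1 O).map φ * σ.nilp T = σ.nilp T * (σ.paramP 1 O).map φ := by
  have h1 := congrArg (fun M => Matrix.map M φ) (σ.paramP_mul_nilp (O := O) 1)
  simpa only [Matrix.map_mul, Matrix.aevalMul_one, σ.nilp_map] using h1

/-- A commuting pair of shape `σ` in a field whose first matrix has distinct eigenvalues on the
cokernel of `nilp` lifts to a local domain containing `O`. -/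
theorem JordanType.exists_isPrime_le_ker [IsDomain O] (σ : JordanType n)
    (hα : Function.Injective α) (hq : q ≠ 1 → ∀ j, α j ^ (q - 1) = 1) {Ω : Type u} [Field Ω]
    [Algebra O Ω] (hαΩ : ∀ j, algebraMap O Ω (α j) = 1) (ψ : σ.ParamRing 1 O →+* Ω)
    {t : Fin σ.parts → Ω} (ht : Function.Injective t)
    (htc : (σ.head ((σ.paramP 1 O).map ψ)).charpoly = ∏ i, (X - C (t i)))
    (x : ModuliRing α q →ₐ[O] Ω) (hxΦ : (univΦ α q).map x = (σ.paramΦ 1 O).map ψ)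
    (hxS : (univS α q).map x = (σ.paramS 1 O).map ψ) :
    ∃ p : Ideal (ModuliRing α q), p.IsPrime ∧ p ≤ RingHom.ker x ∧
      ∀ r : O, algebraMap O (ModuliRing α q) r ∈ p → r = 0 := by
  obtain ⟨τ, h, c, hh, hNh, hPh⟩ := exists_mul_eq_blockPoly (σ := σ)
    (σ.paramP_mul_nilp_map ψ) ht htc
  have hG : IsUnit ((σ.paramG 1 O).map ψ).det := isUnit_det_map ψ (σ.isUnit_det_paramG 1)
  have hS1 : ((σ.paramS 1 O).map ψ - 1) * (σ.paramG 1 O).map ψ =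
      (σ.paramG 1 O).map ψ * σ.nilp Ω := by
    have h1 := congrArg (fun M => Matrix.map M ψ) (σ.paramS_sub_one_mul (O := O) 1)
    simpa only [Matrix.map_mul, Matrix.map_sub_one, σ.nilp_map] using h1
  have hΦ1 : (σ.paramΦ 1 O).map ψ * (σ.paramG 1 O).map ψ =
      (σ.paramG 1 O).map ψ * (σ.paramP 1 O).map ψ := by
    have h1 := congrArg (fun M => Matrix.map M ψ) (σ.paramΦ_mul (O := O) 1)
    simpa only [Matrix.map_mul] using h1
  -- The lifted pair defines a homomorphism to the domain `R`, whose kernel is the required prime.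
  -- It lies below the kernel of `x` because the lift reduces to `x`, and it meets `O` in zero
  -- because `O` embeds into `R`.
  obtain ⟨R, _, _, _, φ, hOR, hφ, hφu⟩ := exists_isLocalRing_surjective O Ω
  obtain ⟨P', S', hpair, hP', hS'⟩ := τ.exists_isModuliPair_map_eq hα hq φ hφ hφu hαΩ
    (P := (σ.paramΦ 1 O).map ψ) (S := (σ.paramS 1 O).map ψ) (h := (σ.paramG 1 O).map ψ * h)
    (isUnit_det_map ψ (σ.isUnit_det_paramΦ 1)) (by rw [Matrix.det_mul]; exact hG.mul hh)
    (by rw [← Matrix.mul_assoc, hS1, Matrix.mul_assoc, hNh, Matrix.mul_assoc]) c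
    (by rw [← Matrix.mul_assoc, hΦ1, Matrix.mul_assoc, hPh, Matrix.mul_assoc])
  obtain ⟨z', ⟨h1, h2⟩, -⟩ := existsUnique_moduliRing_lift hpair
  have h3 : φ.comp z' = x := by
    refine ModuliRing.algHom_ext ?_ ?_
    · rw [hxΦ, ← hP', ← h1]
      rfl
    · rw [hxS, ← hS', ← h2]
      rfl
  refine ⟨RingHom.ker z', RingHom.ker_isPrime _, fun a ha => ?_, fun r hr => ?_⟩
  · rw [RingHom.mem_ker, ← h3, AlgHom.comp_apply, (RingHom.mem_ker).1 ha, map_zero]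
  · rw [RingHom.mem_ker, AlgHom.commutes] at hr
    exact hOR (hr.trans (map_zero _).symm)

variable [IsDomain O]

/-- Where `w` vanishes, all `α j` equal 1 and the second matrix is unipotent. The point itself need
not lift, but it is a specialization of the generic point of the stratum of its Jordan type in the
special fibre, which does lift. -/
theorem exists_isPrime_le_of_algebraMap_mem (hα : Function.Injective α)
    (hq : q ≠ 1 → ∀ j, α j ^ (q - 1) = 1) {w : O} (hw : Prime w) (hαw : ∀ j, w ∣ (α j : O) - 1)
    (p : Ideal (ModuliRing α q)) [p.IsPrime] (hp : algebraMap O (ModuliRing α q) w ∈ p) :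
    ∃ p' : Ideal (ModuliRing α q), p'.IsPrime ∧ p' ≤ p ∧
      ∀ r : O, algebraMap O (ModuliRing α q) r ∈ p' → r = 0 := by
  let L := FractionRing (ModuliRing α q ⧸ p)
  let x : ModuliRing α q →ₐ[O] L := p.residuePoint
  have hker : RingHom.ker x = p := p.ker_residuePoint
  have hL0 : algebraMap O L w = 0 := by
    rw [← x.commutes, ← RingHom.mem_ker, hker]
    exact hp
  have hone : ∀ {T : Type u} [CommRing T] [Algebra O T], algebraMap O T w = 0 →
      ∀ j, algebraMap O T (α j) = 1 := by
    intro T _ _ hT j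
    obtain ⟨b, hb⟩ := hαw j
    rw [← sub_eq_zero, ← map_one (algebraMap O T), ← map_sub, hb, map_mul, hT, zero_mul]
  set Φ := (univΦ α q).map x
  set S := (univS α q).map x
  have hpair : IsModuliPair α q Φ S := (isModuliPair_univ α q).map x
  have hΦS := hpair.mul_eq_mul hα hq
  have hS : S.charpoly = (X - 1) ^ n := by
    rw [hpair.charpoly_eq]
    simp [hone hL0]
  obtain ⟨σ, g, hg, hNg⟩ := exists_jordanType (S - 1) ⟨n, Matrix.sub_one_pow_eq_zero hS⟩
  obtain ⟨y, hyΦ, hyS⟩ := σ.exists_paramRing_algHom_eq (O := O) 1 (by simp) hpair.isUnit_det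
    (by rw [Matrix.aevalMul_one, mul_sub, sub_mul, hΦS, Matrix.mul_one, Matrix.one_mul]) hg hNg
  let D := σ.ParamRing 1 O
  let B := D ⧸ Ideal.span {algebraMap O D w}
  let π : D →ₐ[O] B := Ideal.Quotient.mkₐ O _
  have hB0 : algebraMap O B w = 0 :=
    Ideal.Quotient.eq_zero_iff_mem.2 (Ideal.mem_span_singleton_self _)
  have hpairB : IsModuliPair α q ((σ.paramΦ 1 O).map π) ((σ.paramS 1 O).map π) := by
    refine isModuliPair_of_charpoly_eq_sub_one_pow hα hq (hone hB0)
      (isUnit_det_map (π : D →+* B) (σ.isUnit_det_paramΦ 1)) ?_ ?_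
    · refine (Matrix.charpoly_map _ (π : D →+* B)).trans ?_
      rw [σ.charpoly_paramS]
      simp
    · have h1 := congrArg (fun M => Matrix.map M (π : D →+* B)) (σ.paramΦ_mul_paramS (O := O))
      simp only [Matrix.map_mul] at h1
      exact h1
  obtain ⟨z, ⟨hzΦ, hzS⟩, -⟩ := existsUnique_moduliRing_lift hpairB
  have hwD := σ.prime_algebraMap_paramRing (O := O) 1 hw (by simp)
  have hwP := (Ideal.span_singleton_prime hwD.ne_zero).2 hwD
  obtain ⟨Ω, _, _, ι, hι⟩ := exists_isAlgClosed_ringHom_injective B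
  let _ : Algebra O Ω := (ι.comp (algebraMap O B)).toAlgebra
  let ι' : B →ₐ[O] Ω := { ι with commutes' := fun _ => rfl }
  obtain ⟨t, ht, htc⟩ := σ.exists_charpoly_head_paramP_eq hw ι hι
  obtain ⟨p', hp', hle, hp'0⟩ := σ.exists_isPrime_le_ker hα hq
    (fun j => (congrArg ι (hone hB0 j)).trans (map_one ι)) _ ht htc (ι'.comp z)
    (by rw [AlgHom.coe_comp, ← Matrix.map_map, hzΦ]; rfl)
    (by rw [AlgHom.coe_comp, ← Matrix.map_map, hzS]; rfl)
  have hzp : p' ≤ RingHom.ker z := fun a ha => hι ((hle ha).trans (map_zero ι).symm)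
  refine ⟨p', hp', hzp.trans ?_, hp'0⟩
  -- The parameters of the given point specialize the generic point of the stratum to it, so the
  -- kernel of `z` lies in `p`.
  let y' : B →ₐ[O] L := Ideal.Quotient.liftₐ _ y fun a ha => by
    obtain ⟨b, rfl⟩ := Ideal.mem_span_singleton.1 ha
    rw [map_mul, AlgHom.commutes, hL0, zero_mul]
  have h1 : y'.comp z = x := by
    refine ModuliRing.algHom_ext ?_ ?_
    · refine Eq.trans ?_ hyΦ
      rw [AlgHom.coe_comp, ← Matrix.map_map, hzΦ]
      rfl
    · refine Eq.trans ?_ hyS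
      rw [AlgHom.coe_comp, ← Matrix.map_map, hzS]
      rfl
  rw [← hker, ← h1]
  intro a ha
  rw [RingHom.mem_ker, AlgHom.comp_apply, (RingHom.mem_ker).1 ha, map_zero]

/-- The reduced moduli scheme is flat over a discrete valuation ring. -/
theorem flat_moduliRing_quotient_nilradical [IsDiscreteValuationRing O] (hα : Function.Injective α)
    (hq : q ≠ 1 → ∀ j, α j ^ (q - 1) = 1) {w : O} (hw : Prime w)
    (hαw : ∀ j, w ∣ (α j : O) - 1) :
    Module.Flat O (ModuliRing α q ⧸ nilradical (ModuliRing α q)) := by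
  have hmem : ∀ (r : O) (a : ModuliRing α q), r ≠ 0 → r • a ∈ nilradical (ModuliRing α q) →
      a ∈ nilradical (ModuliRing α q) := by
    intro r a hr ha
    rw [nilradical_eq_sInf, Ideal.mem_sInf] at ha ⊢
    intro p hp
    have hpp : p.IsPrime := hp
    have ha' := ha hp
    rw [Algebra.smul_def] at ha'
    rcases hpp.mem_or_mem ha' with h1 | h1
    -- A prime containing the nonzero scalar `r` contains `w`. The smaller prime `p'` does not
    -- contain `r`, so it contains `a`.
    · have hwp : algebraMap O (ModuliRing α q) w ∈ p := by
        obtain ⟨m, u, hu⟩ := IsDiscreteValuationRing.eq_unit_mul_pow_irreducible hr hw.irreducible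
        rw [hu, map_mul, map_pow] at h1
        rcases hpp.mem_or_mem h1 with h2 | h2
        · exact absurd (p.eq_top_of_isUnit_mem h2 (u.isUnit.map _)) hpp.ne_top
        · exact hpp.mem_of_pow_mem m h2
      obtain ⟨p', hp', hle, hp'0⟩ := exists_isPrime_le_of_algebraMap_mem hα hq hw hαw p hwp
      have h2 := ha hp'
      rw [Algebra.smul_def] at h2
      exact hle ((hp'.mem_or_mem h2).resolve_left fun h3 => hr (hp'0 r h3))
    · exact h1
  have : Module.IsTorsionFree O (ModuliRing α q ⧸ nilradical (ModuliRing α q)) := by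
    refine Module.IsTorsionFree.of_smul_eq_zero fun r a h => or_iff_not_imp_left.2 fun hr => ?_
    obtain ⟨a, rfl⟩ := Ideal.Quotient.mk_surjective a
    exact Ideal.Quotient.eq_zero_iff_mem.2 (hmem r a hr (Ideal.Quotient.eq_zero_iff_mem.1 h))
  infer_instance

end Flatness

/-! ### The ring of integers as a discrete valuation ring, and the conclusion. -/

section PadicIntegers

variable (l : ℕ) [Fact l.Prime] (K : Type*) [Field K] [Algebra ℚ_[l] K] [Algebra ℤ_[l] K]
  [IsScalarTower ℤ_[l] ℚ_[l] K]

theorem isFractionRing_integralClosure_padicInt [FiniteDimensional ℚ_[l] K] :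
    IsFractionRing (integralClosure ℤ_[l] K) K :=
  integralClosure.isFractionRing_of_finite_extension ℚ_[l] K

theorem algebraMap_integralClosure_padicInt_injective :
    Function.Injective (algebraMap ℤ_[l] (integralClosure ℤ_[l] K)) := by
  refine Function.Injective.of_comp (f := algebraMap (integralClosure ℤ_[l] K) K) ?_
  rw [← RingHom.coe_comp, ← IsScalarTower.algebraMap_eq, IsScalarTower.algebraMap_eq _ ℚ_[l] K]
  exact (algebraMap ℚ_[l] K).injective.comp (IsFractionRing.injective _ _)

theorem isDiscreteValuationRing_integralClosure_padicInt [FiniteDimensional ℚ_[l] K] :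
    IsDiscreteValuationRing (integralClosure ℤ_[l] K) := by
  have hfield : ¬ IsField (integralClosure ℤ_[l] K) := fun h =>
    IsDiscreteValuationRing.not_isField ℤ_[l] (isField_of_isIntegral_of_isField
      (algebraMap_integralClosure_padicInt_injective l K) h)
  have : IsDedekindDomain (integralClosure ℤ_[l] K) :=
    integralClosure.isDedekindDomain ℤ_[l] ℚ_[l] K
  have h : IsDiscreteValuationRing (integralClosure ℤ_[l] K) ↔
      IsDedekindDomain (integralClosure ℤ_[l] K) :=
    (IsDiscreteValuationRing.TFAE (integralClosure ℤ_[l] K) hfield).out 0 2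
  exact h.2 this

theorem natCast_mem_maximalIdeal_integralClosure_padicInt [FiniteDimensional ℚ_[l] K] :
    (l : integralClosure ℤ_[l] K) ∈ IsLocalRing.maximalIdeal (integralClosure ℤ_[l] K) := by
  have : FaithfulSMul ℤ_[l] (integralClosure ℤ_[l] K) :=
    (faithfulSMul_iff_algebraMap_injective _ _).2 (algebraMap_integralClosure_padicInt_injective l K)
  intro h
  rw [← map_natCast (algebraMap ℤ_[l] (integralClosure ℤ_[l] K)), isUnit_map_iff] at h
  exact PadicInt.prime_p.not_isUnit h

end PadicIntegers

theorem isUnit_intCast_of_not_dvd {R : Type*} [CommRing R] [IsLocalRing R] {l : ℕ}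
    (hl : l.Prime) (h : (l : R) ∈ IsLocalRing.maximalIdeal R) {q : ℤ} (hq : ¬ (l : ℤ) ∣ q) :
    IsUnit (q : R) := by
  by_contra hu
  have h1 : (q : R) ∈ IsLocalRing.maximalIdeal R := hu
  obtain ⟨a, b, hab⟩ := (Nat.prime_iff_prime_int.1 hl).coprime_iff_not_dvd.2 hq
  have h2 := congrArg (Int.cast : ℤ → R) hab
  push_cast at h2
  refine (Ideal.ne_top_iff_one _).1 (IsLocalRing.maximalIdeal.isMaximal R).ne_top ?_
  rw [← h2]
  exact Ideal.add_mem _ (Ideal.mul_mem_left _ _ h) (Ideal.mul_mem_left _ _ h1)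

theorem charP_quotient_of_natCast_mem {R : Type*} [CommRing R] {l : ℕ} (hl : l.Prime) {I : Ideal R}
    (hI : I ≠ ⊤) (h : (l : R) ∈ I) : CharP (R ⧸ I) l := by
  have : Nontrivial (R ⧸ I) := Ideal.Quotient.nontrivial_iff.2 hI
  have h1 : (l : R ⧸ I) = 0 := by
    rw [← map_natCast (Ideal.Quotient.mk I)]
    exact Ideal.Quotient.eq_zero_iff_mem.2 h
  exact ringChar.of_eq ((hl.eq_one_or_self_of_dvd _ (ringChar.dvd h1)).resolve_left
    (CharP.ringChar_ne_one))

end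

theorem mainTheorem10 (l : ℕ) [Fact l.Prime] (K : Type*) [Field K] [Algebra ℚ_[l] K]
    [Algebra ℤ_[l] K] [IsScalarTower ℤ_[l] ℚ_[l] K] [FiniteDimensional ℚ_[l] K]
    (n : ℕ) (q : ℤ) :
    let O := integralClosure ℤ_[l] K
    let k := IsLocalRing.ResidueField O
    (¬ (l : ℤ) ∣ q →
      let A := ModuliRing (fun _ : Fin n => (1 : Oˣ)) q
      (∀ Z ∈ irreducibleComponents (PrimeSpectrum A),
        Nonempty (PrimeSpectrum (ReducedFibreRing O K Z)) ∧
        ringKrullDim (ReducedFibreRing O K Z) = ((n ^ 2 : ℕ) : WithBot ℕ∞)) ∧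
      Set.BijOn (fun Z : Set (PrimeSpectrum A) => reducedFibre O k Z)
        (irreducibleComponents (PrimeSpectrum A))
        (irreducibleComponents (PrimeSpectrum (k ⊗[O] A))) ∧
      ∀ Z ∈ irreducibleComponents (PrimeSpectrum A),
        Nonempty (PrimeSpectrum (ReducedFibreRing O k Z)) ∧
        IsGenericallyReduced (ReducedFibreRing O k Z)) ∧
    (q ≡ 1 [ZMOD l] →
      ∀ α : Fin n → Oˣ, Function.Injective α → (∀ j, IsOfFinOrder (α j)) →
        (∀ j, (α j : O) - 1 ∈ IsLocalRing.maximalIdeal O) →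
        (q ≠ 1 → ∀ j, α j ^ (q - 1) = 1) →
        Module.Flat O (ModuliRing α q ⧸ nilradical (ModuliRing α q))) := by
  intro O k
  have hDVR : IsDiscreteValuationRing O := isDiscreteValuationRing_integralClosure_padicInt l K
  have hfrac : IsFractionRing O K := isFractionRing_integralClosure_padicInt l K
  have hl : l.Prime := Fact.out
  have hlm : (l : O) ∈ IsLocalRing.maximalIdeal O :=
    natCast_mem_maximalIdeal_integralClosure_padicInt l K
  obtain ⟨w, hw⟩ := IsDiscreteValuationRing.exists_irreducible O
  have hspan : IsLocalRing.maximalIdeal O = Ideal.span {w} := hw.maximalIdeal_eq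
  have hm : (Ideal.span {w}).IsMaximal := hspan ▸ IsLocalRing.maximalIdeal.isMaximal O
  refine ⟨fun hq => ?_, fun _ α hα _ hα1 hαq => ?_⟩
  · have : CharP (O ⧸ Ideal.span {w}) l :=
      charP_quotient_of_natCast_mem hl hm.ne_top (hspan ▸ hlm)
    exact unipotentRing_components l (isUnit_intCast_of_not_dvd hl hlm hq) hw.prime hm K k
      IsLocalRing.residue_surjective (IsLocalRing.ker_residue.trans hspan)
  · exact flat_moduliRing_quotient_nilradical hα hαq hw.prime fun j =>
      Ideal.mem_span_singleton.1 (hspan ▸ hα1 j)
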